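/- **Setting.** Let $\mathbf F:\mathbb R^p\times\Xi\to\mathbb R^q$, let $\xi$ be a random variable in $\Xi$, $F(x):=\mathbb E_\xi[\mathbf F(x,\xi)]$, and let $K\in\mathbb R^{q\times n}$, $K\ne 0$. Let $\mathcal R:\mathbb R^p\to\mathbb R\cup\{+\infty\}$ and $\psi:\mathbb R^n\to\mathbb R\cup\{+\infty\}$ be proper, closed and convex ($\psi$ need not be strongly convex), with $\|y\|\le M_\psi$ for all $y\in\mathrm{dom}\,\psi$, where $M_\psi\in(0,\infty)$. Consider $\min_x\max_y\{\mathcal R(x)+\mathbb E_\xi\langle Ky,\mathbf F(x,\xi)\rangle-\psi(y)\}$. Let $b_\psi:\mathrm{dom}\,\psi\to\mathbb R_+$ be continuous and $1$-strongly convex with $\min b_\psi=0$ and $B_\psi:=\sup_{\mathrm{dom}\,\psi}b_\psi<\infty$. For $\gamma\ge0$ put $\phi_\gamma(u):=\max_y\{\langle u,Ky\rangle-\psi(y)-\gamma b_\psi(y)\}$ and, for $\gamma>0$, let $y^*_\gamma(u)$ be the maximizer. Put $\Phi_\gamma:=\phi_\gamma\circ F$, $\Psi_0:=\Phi_0+\mathcal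 R$, $\Psi_0^\star:=\inf\Psi_0>-\infty$, and $$\mathcal G_\eta(x):=\tfrac1\eta\big(x-\mathrm{prox}_{\eta\mathcal R}(x-\eta\nabla\Phi_\gamma(x))\big).$$ Assume that $\mathbf F(\cdot,\xi)$ is differentiable for every $\xi$, with Jacobian $\mathbf F'(x,\xi)$, that $F$ is differentiable on $\mathrm{dom}\,\Psi_0=\mathrm{dom}\,\mathcal R$, with Jacobian $F'(x)$, and that for constants $L_F,\sigma_F,\sigma_J,M_F\in(0,\infty)$ and all $x,y\in\mathrm{dom}\,\Psi_0$ $$\mathbb E\|\mathbf F'(x,\xi)-\mathbf F'(y,\xi)\|_F^2\le L_F^2\|x-y\|^2,\quad \mathbb E\|\mathbf F(x,\xi)-F(x)\|^2\le\sigma_F^2,\quad \mathbb E\|\mathbf F'(x,\xi)-F'(x)\|_F^2\le\sigma_J^2,\quad \mathbb E\|\mathbf F'(x,\xi)\|^2\le M_F^2,$$ where $\|\cdot\|_F$ is the Frobenius norm and $\|\cdot\|$ is the Euclidean norm of vectors and the operator norm of matrices. **Algorithm.** Start from $\tilde x^0\in\mathrm{dom}\,\Psi_0$. In stage $s=1,\dots,S$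 set $x_0:=\tilde x^{s-1}$ and let $\tilde F_0$, $\tilde J_0$ be the averages of $\mathbf F(x_0,\cdot)$ over a batch of size $b_0$ and of $\mathbf F'(x_0,\cdot)$ over a batch of size $\hat b_0$. For $t=1,\dots,T$, $$\tilde F_t:=\beta\tilde F_{t-1}+\tfrac{\beta}{b_1}\sum_{\xi\in\mathcal B^1_t}[\mathbf F(x_t,\xi)-\mathbf F(x_{t-1},\xi)]+\tfrac{1-\beta}{b_2}\sum_{\zeta\in\mathcal B^2_t}\mathbf F(x_t,\zeta),$$ and $\tilde J_t$ is defined in the same way from $\mathbf F'$ and batches $\hat{\mathcal B}^1_t,\hat{\mathcal B}^2_t$ of sizes $\hat b_1,\hat b_2$. For $t=0,\dots,T$, $v_t:=\tilde J_t^\top Ky^*_\gamma(\tilde F_t)$ and $x_{t+1}:=(1-\theta)x_t+\theta\,\mathrm{prox}_{\eta\mathcal R}(x_t-\eta v_t)$. Set $\tilde x^s:=x_{T+1}$. Each batch consists of i.i.d. samples of $\xi$; the samples of different pairs $(s,t)$ are independent; batches of the same pair $(s,t)$ may depend on each other arbitrarily. The output $\bar x$ is chosen uniformly, independently of the samples,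 among all $S(T+1)$ iterates $x^{(s)}_t$, $1\le s\le S$, $0\le t\le T$. **Parameters.** Let $\varepsilon,c_0>0$ and let $b\ge1$ be an integer. Let $\kappa:=2$, or $\kappa:=1$ if $\mathcal B^1_t$ and $\mathcal B^2_t$ are always independent; let $\hat\kappa$ be chosen likewise for $\hat{\mathcal B}^1_t,\hat{\mathcal B}^2_t$. Put $$P:=\tfrac{\sqrt{26}\|K\|}{3\sqrt{c_0}}\sqrt{\kappa M_F^4\|K\|^2+c_0\hat\kappa L_F^2M_\psi^2},\qquad Q:=\tfrac{26}{9c_0}\|K\|^2\big(\kappa M_F^2\|K\|^2\sigma_F^2+c_0\hat\kappa M_\psi^2\sigma_J^2\big),$$ $L_{\Phi_\gamma}:=L_FM_\psi\|K\|+M_F^2\|K\|^2/\gamma$, $R_0:=16P[\Psi_0(\tilde x^0)-\Psi_0^\star+B_\psi]$, $\hat R_0:=24Q$, and assume $R_0>0$. Take $\gamma:=\varepsilon/\sqrt{2\hat R_0}$, $\beta:=1-\frac{b\varepsilon^2}{2\hat R_0}$, $\theta:=\frac{L_{\Phi_\gamma}\sqrt{b(1-\beta)}}{P}$, $\eta:=\frac{2}{L_{\Phi_\gamma}(3+\theta)}$,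 assuming $\beta>0$ and $\theta\le1$, and $$b_1=b_2:=\Big\lceil\tfrac{2c_0b\hat R_0}{\varepsilon^2}\Big\rceil,\quad \hat b_1=\hat b_2:=b,\quad b_0:=\Big\lceil\tfrac{4c_0\hat R_0^2}{\varepsilon^4}\Big\rceil,\quad \hat b_0:=\Big\lceil\tfrac{2\hat R_0}{\varepsilon^2}\Big\rceil,\quad T:=\Big\lfloor\tfrac{2\hat R_0}{\varepsilon^2}\Big\rfloor,\quad S:=\Big\lceil\tfrac{\sqrt2R_0}{b\varepsilon\sqrt{\hat R_0}}\Big\rceil .$$ **Theorem.** The output satisfies $\mathbb E\|\mathcal G_\eta(\bar x)\|^2\le\varepsilon^2$. The algorithm makes exactly $S[b_0+T(2b_1+b_2)]$ evaluations of $\mathbf F$ and $S[\hat b_0+T(2\hat b_1+\hat b_2)]$ evaluations of $\mathbf F'$. Let $$\mathcal T_F:=\frac{4\sqrt2c_0R_0\hat R_0^{3/2}(3+b^{-1})}{\varepsilon^5}=O\Big(\frac{R_0\hat R_0^{3/2}}{\varepsilon^5}\Big),\qquad \mathcal T_J:=\frac{2\sqrt2R_0\hat R_0^{1/2}(3+b^{-1})}{\varepsilon^3}=O\Big(\frac{R_0\hat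 R_0^{1/2}}{\varepsilon^3}\Big).$$ If the expressions that define $S$, $b_1$, $b_0$ (respectively $S$, $\hat b_0$) are integers, then the number of evaluations of $\mathbf F$ (respectively $\mathbf F'$) is at most $\mathcal T_F$ (respectively $\mathcal T_J$). In general, if the expressions that define $S$, $b_1$, $b_0$ (respectively $S$) are at least $1$ before rounding, it is at most $4\mathcal T_F$ (respectively $4\mathcal T_J$). -/

import Mathlib

open MeasureTheory ProbabilityTheory
open scoped RealInnerProductSpace

noncomputable section

/-- `ℝ^d` with its Euclidean norm. -/
abbrev Euc (d : ℕ) : Type := EuclideanSpace ℝ (Fin d)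

/-- Squared Frobenius norm of (the matrix of) a linear map. -/
def frobSq {p q : ℕ} (J : Euc p →L[ℝ] Euc q) : ℝ :=
  ∑ i : Fin p, ‖J (EuclideanSpace.single i (1 : ℝ))‖ ^ 2

/-! ### Extended-real-valued convex functions -/

/-- Effective domain of `f : ℝ^d → ℝ ∪ {+∞}`. -/
def effDom {d : ℕ} (f : Euc d → EReal) : Set (Euc d) := {x | f x ≠ ⊤}

/-- `f` is a proper, closed (lower semicontinuous), convex function `ℝ^d → ℝ ∪ {+∞}`. -/
structure ProperClosedConvex {d : ℕ} (f : Euc d → EReal) : Prop where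
  ne_bot : ∀ x, f x ≠ ⊥
  nonempty_dom : (effDom f).Nonempty
  closed : LowerSemicontinuous f
  convex : Convex ℝ {z : Euc d × ℝ | f z.1 ≤ (z.2 : EReal)}

/-- `proxOp η f z` is `prox_{η f}(z) = argmin_x { f x + ‖x - z‖² / (2 η) }`. -/
def proxOp {d : ℕ} (η : ℝ) (f : Euc d → EReal) (z : Euc d) : Euc d :=
  Classical.epsilon fun x =>
    ∀ w, f x + ((‖x - z‖ ^ 2 / (2 * η) : ℝ) : EReal) ≤ f w + ((‖w - z‖ ^ 2 / (2 * η) : ℝ) : EReal)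

/-! ### The minimax problem -/

/-- The data of the problem `min_x max_y { R x + E_ξ ⟪K y, F(x, ξ)⟫ - ψ y }`, together with the
function `bfun : dom ψ → ℝ₊` (values outside `dom ψ` are never used) that is used for smoothing. -/
structure MinimaxData (p n q : ℕ) (Ξ : Type*) [MeasurableSpace Ξ] where
  /-- the law of the random variable `ξ` -/
  law : Measure Ξ
  F : Euc p → Ξ → Euc q
  K : Euc n →L[ℝ] Euc q
  R : Euc p → EReal
  ψ : Euc n → EReal
  bfun : Euc n → ℝ

namespace MinimaxData

variable {p n q : ℕ} {Ξ : Type*} [MeasurableSpace Ξ] (D : MinimaxData p n q Ξ)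

/-- Jacobian `F'(x, ξ)` of `F(·, ξ)` at `x`. -/
def jac (x : Euc p) (ξ : Ξ) : Euc p →L[ℝ] Euc q := fderiv ℝ (fun z => D.F z ξ) x

/-- `F(x) = E_ξ F(x, ξ)`. -/
def meanF (x : Euc p) : Euc q := ∫ ξ, D.F x ξ ∂D.law

/-- Jacobian `F'(x)` of the expectation function `x ↦ F(x)`. -/
def meanJac (x : Euc p) : Euc p →L[ℝ] Euc q := fderiv ℝ D.meanF x

/-- The objective of the maximization problem that defines `φ_γ(u)`, for `y ∈ dom ψ`. -/
def dualObj (γ : ℝ) (u : Euc q) (y : Euc n) : ℝ :=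
  ⟪u, D.K y⟫ - (D.ψ y).toReal - γ * D.bfun y

/-- `φ_γ(u) = max_y { ⟪u, K y⟫ - ψ y - γ b(y) }`; `γ = 0` gives `φ₀(u) = ψ^*(Kᵀ u)`. -/
def phi (γ : ℝ) (u : Euc q) : ℝ := sSup (D.dualObj γ u '' effDom D.ψ)

/-- `y_γ^*(u)`, the maximizer in the definition of `φ_γ(u)`. -/
def dualSol (γ : ℝ) (u : Euc q) : Euc n :=
  Classical.epsilon fun y => y ∈ effDom D.ψ ∧ IsMaxOn (D.dualObj γ u) (effDom D.ψ) y

/-- `Φ_γ(x) = φ_γ(F(x))`. -/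
def Phi (γ : ℝ) (x : Euc p) : ℝ := D.phi γ (D.meanF x)

/-- `Ψ₀(x) = φ₀(F(x)) + R(x)`. -/
def Psi0 (x : Euc p) : EReal := ((D.Phi 0 x : ℝ) : EReal) + D.R x

/-- `Ψ₀^* = inf_x Ψ₀(x)`. -/
def Psi0Star : EReal := ⨅ x, D.Psi0 x

/-- The gradient mapping
`G_η(x) = (x - prox_{η R}(x - η ∇Φ_γ(x))) / η` of `Ψ_γ = Φ_γ + R`. -/
def gradMap (γ η : ℝ) (x : Euc p) : Euc p :=
  η⁻¹ • (x - proxOp η D.R (x - η • gradient (D.Phi γ) x))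

/-- `B_ψ = sup { b(y) : y ∈ dom ψ }`. -/
def Bpsi : ℝ := sSup (D.bfun '' effDom D.ψ)

/-! ### Assumptions -/

/-- Standing assumptions on the problem: `F(·, ξ)` is differentiable, `F` is differentiable on
`dom Ψ₀` (`= dom R`, because `φ₀` is finite), `R` is proper, closed and convex, `Ψ₀^* > -∞`, and
`b` is a nonnegative, continuous and `1`-strongly convex function on `dom ψ` with minimal value
`0` and `B_ψ < ∞`. -/
structure Standing : Prop where
  prob : IsProbabilityMeasure D.law
  meas_F : ∀ x, Measurable (D.F x)
  diff_F : ∀ ξ, Differentiable ℝ (fun x => D.F x ξ)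
  diff_meanF : ∀ x ∈ effDom D.R, DifferentiableAt ℝ D.meanF x
  R_pcc : ProperClosedConvex D.R
  Psi0Star_gt : ⊥ < D.Psi0Star
  bfun_cont : ContinuousOn D.bfun (effDom D.ψ)
  bfun_strong : StrongConvexOn (effDom D.ψ) 1 D.bfun
  bfun_min : IsLeast (D.bfun '' effDom D.ψ) 0
  bfun_bdd : BddAbove (D.bfun '' effDom D.ψ)

/-- Average smoothness, bounded variance and average Lipschitz continuity of `F`. Second moments
are Lebesgue integrals of nonnegative functions, so that each bound includes finiteness. Jacobians
are measured in the Frobenius norm in `smooth` and `var_J`, and in the operator norm in `lip`,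
where this is the weaker requirement. -/
structure AssumptionF (LF σF σJ MF : ℝ) : Prop where
  LF_pos : 0 < LF
  σF_pos : 0 < σF
  σJ_pos : 0 < σJ
  MF_pos : 0 < MF
  smooth : ∀ x ∈ effDom D.R, ∀ y ∈ effDom D.R,
    ∫⁻ ξ, ENNReal.ofReal (frobSq (D.jac x ξ - D.jac y ξ)) ∂D.law
      ≤ ENNReal.ofReal (LF ^ 2 * ‖x - y‖ ^ 2)
  var_F : ∀ x ∈ effDom D.R,
    ∫⁻ ξ, ENNReal.ofReal (‖D.F x ξ - D.meanF x‖ ^ 2) ∂D.law ≤ ENNReal.ofReal (σF ^ 2)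
  var_J : ∀ x ∈ effDom D.R,
    ∫⁻ ξ, ENNReal.ofReal (frobSq (D.jac x ξ - D.meanJac x)) ∂D.law ≤ ENNReal.ofReal (σJ ^ 2)
  lip : ∀ x ∈ effDom D.R,
    ∫⁻ ξ, ENNReal.ofReal (‖D.jac x ξ‖ ^ 2) ∂D.law ≤ ENNReal.ofReal (MF ^ 2)

/-- `ψ` is proper, closed and convex, and `dom ψ` is bounded by `Mψ`. -/
structure AssumptionPsi (Mψ : ℝ) : Prop where
  Mψ_pos : 0 < Mψ
  pcc : ProperClosedConvex D.ψ
  bounded : ∀ y ∈ effDom D.ψ, ‖y‖ ≤ Mψ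

/-! ### Constants -/

/-- `P = √26 ‖K‖ / (3 √c₀) * √(κ M_F⁴ ‖K‖² + c₀ κ̂ L_F² M_ψ²)`. -/
def constP (c₀ κ κJ MF LF Mψ : ℝ) : ℝ :=
  √26 * ‖D.K‖ / (3 * √c₀) * √(κ * MF ^ 4 * ‖D.K‖ ^ 2 + c₀ * κJ * LF ^ 2 * Mψ ^ 2)

/-- `Q = 26 / (9 c₀) ‖K‖² (κ M_F² ‖K‖² σ_F² + c₀ κ̂ M_ψ² σ_J²)`. -/
def constQ (c₀ κ κJ MF Mψ σF σJ : ℝ) : ℝ :=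
  26 / (9 * c₀) * ‖D.K‖ ^ 2 * (κ * MF ^ 2 * ‖D.K‖ ^ 2 * σF ^ 2 + c₀ * κJ * Mψ ^ 2 * σJ ^ 2)

/-- `L_{Φ_γ} = L_F M_ψ ‖K‖ + M_F² ‖K‖² / γ`. -/
def constL (γ MF LF Mψ : ℝ) : ℝ := LF * Mψ * ‖D.K‖ + MF ^ 2 * ‖D.K‖ ^ 2 / γ

end MinimaxData

/-! ### Mini-batches -/

/-- A realization of all mini-batches: at stage `s` the initial batches `B⁰`, `B̂⁰` of sizes
`b₀`, `bJ₀`, and at iteration `t ≥ 1` of stage `s` the batches `B¹`, `B̂¹`, `B²`, `B̂²` of sizes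
`b₁`, `bJ₁`, `b₂`, `bJ₂`. A letter `J` marks the batches for the Jacobian. Stages are numbered
from `0`. -/
structure Batches (Ξ : Type*) (b₀ bJ₀ b₁ bJ₁ b₂ bJ₂ : ℕ) where
  zero : ℕ → Fin b₀ → Ξ
  zeroJ : ℕ → Fin bJ₀ → Ξ
  one : ℕ → ℕ → Fin b₁ → Ξ
  oneJ : ℕ → ℕ → Fin bJ₁ → Ξ
  two : ℕ → ℕ → Fin b₂ → Ξ
  twoJ : ℕ → ℕ → Fin bJ₂ → Ξ

/-- The σ-algebra generated by a family of random variables. -/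
@[reducible] def sigmaOf {Ω Ξ ι : Type*} [MeasurableSpace Ξ] (X : ι → Ω → Ξ) : MeasurableSpace Ω :=
  ⨆ i, MeasurableSpace.comap (X i) inferInstance

/-- The `X i` are independent random variables with common law `P`. -/
def IsIID {Ω Ξ ι : Type*} [MeasurableSpace Ω] [MeasurableSpace Ξ]
    (X : ι → Ω → Ξ) (P : Measure Ξ) (μ : Measure Ω) : Prop :=
  (∀ i, Measurable (X i) ∧ μ.map (X i) = P) ∧ iIndepFun X μ

namespace Batches

variable {Ω Ξ : Type*} [MeasurableSpace Ξ] {b₀ bJ₀ b₁ bJ₁ b₂ bJ₂ : ℕ}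

/-- The σ-algebra generated by all samples drawn at iteration `t` of stage `s`. -/
@[reducible] def block (B : Ω → Batches Ξ b₀ bJ₀ b₁ bJ₁ b₂ bJ₂) (s : ℕ) : ℕ → MeasurableSpace Ω
  | 0 => sigmaOf (fun i ω => (B ω).zero s i) ⊔ sigmaOf (fun i ω => (B ω).zeroJ s i)
  | t + 1 =>
    (sigmaOf (fun i ω => (B ω).one s (t + 1) i) ⊔ sigmaOf (fun i ω => (B ω).oneJ s (t + 1) i)) ⊔
    (sigmaOf (fun i ω => (B ω).two s (t + 1) i) ⊔ sigmaOf (fun i ω => (B ω).twoJ s (t + 1) i))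

/-- The random mini-batches used in stages `s < S` and iterations `t ≤ T`: each batch consists of
i.i.d. samples of `ξ`, and different iterations are independent. Batches of the same iteration may
depend on each other in any way. -/
structure Admissible [MeasurableSpace Ω] (B : Ω → Batches Ξ b₀ bJ₀ b₁ bJ₁ b₂ bJ₂)
    (P : Measure Ξ) (μ : Measure Ω) (S T : ℕ) : Prop where
  zero : ∀ s < S, IsIID (fun i ω => (B ω).zero s i) P μ
  zeroJ : ∀ s < S, IsIID (fun i ω => (B ω).zeroJ s i) P μ
  one : ∀ s < S, ∀ t ∈ Finset.Icc 1 T, IsIID (fun i ω => (B ω).one s t i) P μ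
  oneJ : ∀ s < S, ∀ t ∈ Finset.Icc 1 T, IsIID (fun i ω => (B ω).oneJ s t i) P μ
  two : ∀ s < S, ∀ t ∈ Finset.Icc 1 T, IsIID (fun i ω => (B ω).two s t i) P μ
  twoJ : ∀ s < S, ∀ t ∈ Finset.Icc 1 T, IsIID (fun i ω => (B ω).twoJ s t i) P μ
  indep : iIndep (fun st : Fin S × Fin (T + 1) => block B st.1 st.2) μ

/-- In every iteration the batches `B¹` and `B²` for `F` are independent. -/
def IndepF [MeasurableSpace Ω] (B : Ω → Batches Ξ b₀ bJ₀ b₁ bJ₁ b₂ bJ₂)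
    (μ : Measure Ω) (S T : ℕ) : Prop :=
  ∀ s < S, ∀ t ∈ Finset.Icc 1 T,
    Indep (sigmaOf (fun i ω => (B ω).one s t i)) (sigmaOf (fun i ω => (B ω).two s t i)) μ

/-- In every iteration the batches `B̂¹` and `B̂²` for the Jacobian are independent. -/
def IndepJ [MeasurableSpace Ω] (B : Ω → Batches Ξ b₀ bJ₀ b₁ bJ₁ b₂ bJ₂)
    (μ : Measure Ω) (S T : ℕ) : Prop :=
  ∀ s < S, ∀ t ∈ Finset.Icc 1 T,
    Indep (sigmaOf (fun i ω => (B ω).oneJ s t i)) (sigmaOf (fun i ω => (B ω).twoJ s t i)) μ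

end Batches

/-! ### The algorithm -/

/-- Constant parameters: smoothness parameter `γ`, weight `β = β̂`, step sizes `θ` and `η`. -/
structure StepParams where
  γ : ℝ
  β : ℝ
  θ : ℝ
  η : ℝ

/-- State at iteration `t`: the iterate `x_t`, the estimators `F̃_t` and `J̃_t`, and the logs of all
oracle queries `F(x, ξ)` and `F'(x, ξ)` made so far. -/
structure AlgState (p q : ℕ) (Ξ : Type*) where
  x : Euc p
  Fest : Euc q
  Jest : Euc p →L[ℝ] Euc q
  logF : List (Euc p × Ξ)
  logJ : List (Euc p × Ξ)

namespace MinimaxData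

variable {p n q : ℕ} {Ξ : Type*} [MeasurableSpace Ξ] (D : MinimaxData p n q Ξ)
  {b₀ bJ₀ b₁ bJ₁ b₂ bJ₂ : ℕ}

/-- `x_{t+1} = (1 - θ) x_t + θ prox_{η R}(x_t - η v_t)` with `v_t = J̃_tᵀ K y_γ^*(F̃_t)`. -/
def nextX (par : StepParams) (st : AlgState p q Ξ) : Euc p :=
  let v : Euc p := ContinuousLinearMap.adjoint st.Jest (D.K (D.dualSol par.γ st.Fest))
  (1 - par.θ) • st.x + par.θ • proxOp par.η D.R (st.x - par.η • v)

/-- Initialization of stage `s` at `x₀`, with the initial mini-batches. -/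
def startState (B : Batches Ξ b₀ bJ₀ b₁ bJ₁ b₂ bJ₂) (s : ℕ) (x₀ : Euc p)
    (logF logJ : List (Euc p × Ξ)) : AlgState p q Ξ where
  x := x₀
  Fest := (b₀ : ℝ)⁻¹ • ∑ i, D.F x₀ (B.zero s i)
  Jest := (bJ₀ : ℝ)⁻¹ • ∑ i, D.jac x₀ (B.zeroJ s i)
  logF := logF ++ List.ofFn (fun i => (x₀, B.zero s i))
  logJ := logJ ++ List.ofFn (fun i => (x₀, B.zeroJ s i))

/-- Passage from iteration `t - 1` to iteration `t` in stage `s`: the new iterate `x_t` and the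
hybrid estimators at `x_t`. -/
def stepState (par : StepParams) (B : Batches Ξ b₀ bJ₀ b₁ bJ₁ b₂ bJ₂) (s t : ℕ)
    (st : AlgState p q Ξ) : AlgState p q Ξ :=
  let x : Euc p := D.nextX par st
  { x := x
    Fest := par.β • st.Fest
      + (par.β / b₁) • ∑ i, (D.F x (B.one s t i) - D.F st.x (B.one s t i))
      + ((1 - par.β) / b₂) • ∑ i, D.F x (B.two s t i)
    Jest := par.β • st.Jest
      + (par.β / bJ₁) • ∑ i, (D.jac x (B.oneJ s t i) - D.jac st.x (B.oneJ s t i))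
      + ((1 - par.β) / bJ₂) • ∑ i, D.jac x (B.twoJ s t i)
    logF := st.logF ++ List.ofFn (fun i => (x, B.one s t i))
      ++ List.ofFn (fun i => (st.x, B.one s t i)) ++ List.ofFn (fun i => (x, B.two s t i))
    logJ := st.logJ ++ List.ofFn (fun i => (x, B.oneJ s t i))
      ++ List.ofFn (fun i => (st.x, B.oneJ s t i)) ++ List.ofFn (fun i => (x, B.twoJ s t i)) }

/-- State at iteration `t` of stage `s`, when the stage is started at `x₀`. -/
def stageState (par : StepParams) (B : Batches Ξ b₀ bJ₀ b₁ bJ₁ b₂ bJ₂) (s : ℕ) (x₀ : Euc p)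
    (logF logJ : List (Euc p × Ξ)) : ℕ → AlgState p q Ξ
  | 0 => D.startState B s x₀ logF logJ
  | t + 1 => D.stepState par B s (t + 1) (stageState par B s x₀ logF logJ t)

/-- The restarting variant: the point `x̃^s` and the query logs after `s` stages, each of which
consists of the iterations `0, …, T` and returns its last iterate `x_{T+1}`. -/
def restart (par : StepParams) (B : Batches Ξ b₀ bJ₀ b₁ bJ₁ b₂ bJ₂) (T : ℕ) (x₀ : Euc p) :
    ℕ → Euc p × List (Euc p × Ξ) × List (Euc p × Ξ)
  | 0 => (x₀, [], [])
  | s + 1 =>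
    let r := restart par B T x₀ s
    let st := D.stageState par B s r.1 r.2.1 r.2.2 T
    (D.nextX par st, st.logF, st.logJ)

/-- The iterate `x_t` of stage `s` (stages are numbered from `0`) in the restarting variant. -/
def iterate (par : StepParams) (B : Batches Ξ b₀ bJ₀ b₁ bJ₁ b₂ bJ₂) (T : ℕ) (x₀ : Euc p)
    (s t : ℕ) : Euc p :=
  let r := D.restart par B T x₀ s
  (D.stageState par B s r.1 r.2.1 r.2.2 t).x

/-- Number of evaluations of `F(x, ξ)` made in the first `S` stages. -/
def evalsF (par : StepParams) (B : Batches Ξ b₀ bJ₀ b₁ bJ₁ b₂ bJ₂) (T : ℕ) (x₀ : Euc p)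
    (S : ℕ) : ℕ := (D.restart par B T x₀ S).2.1.length

/-- Number of evaluations of the Jacobian `F'(x, ξ)` made in the first `S` stages. -/
def evalsJ (par : StepParams) (B : Batches Ξ b₀ bJ₀ b₁ bJ₁ b₂ bJ₂) (T : ℕ) (x₀ : Euc p)
    (S : ℕ) : ℕ := (D.restart par B T x₀ S).2.2.length

end MinimaxData

/-- The random index `τ` is uniformly distributed and independent of the samples used by the
algorithm. -/
structure UniformOutput {Ω Ξ : Type*} [MeasurableSpace Ω] [MeasurableSpace Ξ]
    {b₀ bJ₀ b₁ bJ₁ b₂ bJ₂ : ℕ} (B : Ω → Batches Ξ b₀ bJ₀ b₁ bJ₁ b₂ bJ₂) (μ : Measure Ω)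
    (S T : ℕ) (τ : Ω → Fin S × Fin (T + 1)) : Prop where
  meas : Measurable τ
  uniform : ∀ i, μ (τ ⁻¹' {i}) = ENNReal.ofReal (1 / ((S : ℝ) * ((T : ℝ) + 1)))
  indep : Indep (MeasurableSpace.comap τ inferInstance)
    (⨆ st : Fin S × Fin (T + 1), Batches.block B st.1 st.2) μ

end

noncomputable section

set_option linter.unusedSectionVars false

/-! ### Proper closed convex functions and proximal operators -/

namespace ProperClosedConvex

variable {d : ℕ} {f : Euc d → EReal}

/-! The inner maximization is strongly concave, so `dualSol` is Lipschitz with constant `‖K‖ / γ`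
and `phi γ` is differentiable with gradient `K (dualSol γ u)`. Composed with the average smoothness
of `F` this gives the quadratic upper bound `Phi_le_quadratic` with constant `L = constL`. A damped
proximal step along an inexact direction `v` then decreases `Ψ_γ = Φ_γ + R` by a multiple of the
squared gradient mapping plus a multiple of the squared step, up to a weighted sum of the squared
errors of the two estimators (`PsiS_nextPt_le`).

The error of a hybrid estimator contracts by `β²` in mean square, and it grows by a multiple of the
squared step, divided by the batch size, and by a small variance term (`lintegral_hybrid_error_le`).
Hence `Ψ_γ` plus the two mean squared errors divided by `1 - β²` is a Lyapunov function: the squared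
step gained in the descent pays for the growth of the errors, provided that the inequality of
`coupling_le` holds, and `θ` and `P` are chosen for it. Summed over a stage, this bounds the
gradient mappings by the decrease of `Ψ_γ` plus noise (`stage_sum`). A restart continues from the
last iterate with fresh estimators, so the stages telescope (`sum_gradSq_le`). After division by `S
(T + 1)` the initial gap contributes at most `ε² / 2` and the noise at most `ε² / 3`
(`accuracy_le`).

Two points need care. The moment bounds hold only on `dom R`, which may have empty interior, so the
Jacobian of the expectation and the expected Jacobian are compared only along directions that stay
in `dom R` (`meanJac_apply_sub`). This is enough, because the proximal operator does not see
perturbations orthogonal to those directions (`proxOp_eq_of_inner_eq_zero`). Moreover, integrability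
along the iterates is not known beforehand: the mean recursions are written with nonnegative
integrals, and finiteness is propagated by the recursions themselves.

The oracle counts follow from the lengths of the query logs. A quantity that is at least one at most
doubles when it is rounded up; doubling both the number of stages and the batch sizes gives the
factor `4`. -/

theorem coe_toReal (hf : ProperClosedConvex f) {x : Euc d} (hx : x ∈ effDom f) :
    ((f x).toReal : EReal) = f x :=
  EReal.coe_toReal hx (hf.ne_bot x)

theorem convexOn (hf : ProperClosedConvex f) :
    ConvexOn ℝ (effDom f) (fun x => (f x).toReal) := by
  have key : ∀ x ∈ effDom f, ∀ y ∈ effDom f, ∀ a b : ℝ, 0 ≤ a → 0 ≤ b → a + b = 1 →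
      f (a • x + b • y) ≤ ((a * (f x).toReal + b * (f y).toReal : ℝ) : EReal) := by
    intro x hx y hy a b ha hb hab
    have h1 : ((x, (f x).toReal) : Euc d × ℝ) ∈ {z : Euc d × ℝ | f z.1 ≤ (z.2 : EReal)} :=
      (hf.coe_toReal hx).ge
    have h2 : ((y, (f y).toReal) : Euc d × ℝ) ∈ {z : Euc d × ℝ | f z.1 ≤ (z.2 : EReal)} :=
      (hf.coe_toReal hy).ge
    exact hf.convex h1 h2 ha hb hab
  have hdom : Convex ℝ (effDom f) := fun x hx y hy a b ha hb hab =>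
    ne_top_of_le_ne_top (EReal.coe_ne_top _) (key x hx y hy a b ha hb hab)
  refine ⟨hdom, fun x hx y hy a b ha hb hab => ?_⟩
  have h := key x hx y hy a b ha hb hab
  rw [← hf.coe_toReal (hdom hx hy ha hb hab)] at h
  simpa using EReal.coe_le_coe_iff.1 h

theorem lowerSemicontinuousOn_toReal (hf : ProperClosedConvex f) :
    LowerSemicontinuousOn (fun x => (f x).toReal) (effDom f) := by
  intro x hx c hc
  have h1 : (c : EReal) < f x := by
    rw [← hf.coe_toReal hx]; exact EReal.coe_lt_coe_iff.2 hc
  filter_upwards [(hf.closed x c h1).filter_mono nhdsWithin_le_nhds, self_mem_nhdsWithin]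
    with y hy hyd
  rw [← hf.coe_toReal hyd] at hy
  exact EReal.coe_lt_coe_iff.1 hy

theorem measurable_toReal (hf : ProperClosedConvex f) :
    Measurable (fun x => (f x).toReal) :=
  hf.closed.measurable.ereal_toReal

/-- A minimizer of `f + h` over the domain of `f`. -/
theorem exists_isMinOn_add (hf : ProperClosedConvex f) {h : Euc d → ℝ}
    (hh : ContinuousOn h (effDom f)) {x₀ : Euc d} (hx₀ : x₀ ∈ effDom f) (c ρ : ℝ)
    (hc : ∀ x ∈ effDom f, (f x).toReal + h x ≤ (f x₀).toReal + h x₀ →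
      (f x).toReal ≤ c ∧ ‖x‖ ≤ ρ) :
    ∃ y ∈ effDom f, ∀ w ∈ effDom f, (f y).toReal + h y ≤ (f w).toReal + h w := by
  -- The domain need not be closed, and `h` is continuous only there. A sublevel set of `f` is
  -- closed by semicontinuity and lies inside the domain, so its intersection with a ball is a
  -- compact set on which `f + h` is lower semicontinuous.
  set A : Set (Euc d) := f ⁻¹' Set.Iic (c : EReal) ∩ Metric.closedBall 0 ρ with hA
  have hAC : A ⊆ effDom f := fun x hx => ne_top_of_le_ne_top (EReal.coe_ne_top _) hx.1
  have hmem : ∀ x ∈ effDom f, (f x).toReal + h x ≤ (f x₀).toReal + h x₀ → x ∈ A := by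
    intro x hx hle
    obtain ⟨h1, h2⟩ := hc x hx hle
    refine ⟨?_, by simpa using h2⟩
    change f x ≤ c
    rw [← hf.coe_toReal hx]; exact EReal.coe_le_coe_iff.2 h1
  have hcomp : IsCompact A :=
    (isCompact_closedBall 0 ρ).inter_left (hf.closed.isClosed_preimage _)
  have hlsc : LowerSemicontinuousOn (fun x => (f x).toReal + h x) A :=
    (hf.lowerSemicontinuousOn_toReal.mono hAC).add (hh.mono hAC).lowerSemicontinuousOn
  obtain ⟨y, hyA, hy⟩ := hlsc.exists_isMinOn ⟨x₀, hmem x₀ hx₀ le_rfl⟩ hcomp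
  refine ⟨y, hAC hyA, fun w hw => ?_⟩
  rcases le_total ((f w).toReal + h w) ((f x₀).toReal + h x₀) with hle | hle
  · exact hy (hmem w hw hle)
  · exact (hy (hmem x₀ hx₀ le_rfl)).trans hle

/-- On the unit ball around `x₀` the minimum of `f` is a lower bound. Outside, convexity on the
segment from `x₀` to `x`, evaluated where it leaves the ball, prevents `f` from falling faster than
linearly. This makes the proximal objective coercive. -/
theorem exists_linear_lower_bound (hf : ProperClosedConvex f) {x₀ : Euc d}
    (hx₀ : x₀ ∈ effDom f) :
    ∃ A B : ℝ, 0 ≤ B ∧ ∀ x ∈ effDom f, A - B * ‖x - x₀‖ ≤ (f x).toReal := by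
  obtain ⟨y, hyA, hy⟩ := (hf.closed.lowerSemicontinuousOn (Metric.closedBall x₀ 1)).exists_isMinOn
    ⟨x₀, by simp⟩ (isCompact_closedBall x₀ 1)
  have hyx : f y ≤ f x₀ := hy (by simp : x₀ ∈ Metric.closedBall x₀ 1)
  have hyd : y ∈ effDom f := ne_top_of_le_ne_top hx₀ hyx
  have hball : ∀ x ∈ effDom f, ‖x - x₀‖ ≤ 1 → (f y).toReal ≤ (f x).toReal := by
    intro x hx hle
    have h : f y ≤ f x := hy (by simpa [dist_eq_norm] using hle : x ∈ Metric.closedBall x₀ 1)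
    rw [← hf.coe_toReal hx, ← hf.coe_toReal hyd] at h
    exact EReal.coe_le_coe_iff.1 h
  have h0 : (f y).toReal ≤ (f x₀).toReal := hball x₀ hx₀ (by simp)
  refine ⟨(f y).toReal, (f x₀).toReal - (f y).toReal, by linarith, fun x hx => ?_⟩
  rcases le_or_gt ‖x - x₀‖ 1 with hle | hgt
  · have := hball x hx hle
    nlinarith [norm_nonneg (x - x₀)]
  · set ρ := ‖x - x₀‖ with hρ
    have hρ0 : 0 < ρ := by linarith
    have h1 : 0 ≤ 1 - ρ⁻¹ := by
      have := inv_le_one_of_one_le₀ hgt.le; linarith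
    have h2 : 0 ≤ ρ⁻¹ := by positivity
    have hz := hf.convexOn.2 hx₀ hx h1 h2 (by ring)
    have hzd := hf.convexOn.1 hx₀ hx h1 h2 (by ring)
    have hb := hball _ hzd (by
      have : (1 - ρ⁻¹) • x₀ + ρ⁻¹ • x - x₀ = ρ⁻¹ • (x - x₀) := by module
      rw [this, norm_smul, Real.norm_of_nonneg h2, ← hρ, inv_mul_cancel₀ hρ0.ne'])
    have h3 := hb.trans hz
    simp only [smul_eq_mul] at h3
    have h4 : ρ * (f y).toReal ≤ (ρ - 1) * (f x₀).toReal + (f x).toReal := by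
      have := mul_le_mul_of_nonneg_left h3 hρ0.le
      have e : ρ * ((1 - ρ⁻¹) * (f x₀).toReal + ρ⁻¹ * (f x).toReal)
          = (ρ - 1) * (f x₀).toReal + (f x).toReal := by field_simp
      linarith
    nlinarith

variable {η : ℝ}

theorem exists_prox (hf : ProperClosedConvex f) (hη : 0 < η) (z : Euc d) :
    ∃ y ∈ effDom f, ∀ w ∈ effDom f,
      (f y).toReal + ‖y - z‖ ^ 2 / (2 * η) ≤ (f w).toReal + ‖w - z‖ ^ 2 / (2 * η) := by
  obtain ⟨x₀, hx₀⟩ := hf.nonempty_dom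
  obtain ⟨A, B, hB, hAB⟩ := hf.exists_linear_lower_bound hx₀
  set c := (f x₀).toReal + ‖x₀ - z‖ ^ 2 / (2 * η) with hc
  set E := c - A + B * ‖z - x₀‖ with hE
  -- On the sublevel set, `s = ‖x - z‖` satisfies `s² ≤ 2η (B s + |E|)`. If `s` exceeded both `1`
  -- and `2η (B + |E|)`, this would fail; the radius adds these two bounds and `‖z‖`.
  refine hf.exists_isMinOn_add (h := fun x => ‖x - z‖ ^ 2 / (2 * η)) (by fun_prop) hx₀ c
    (1 + 2 * η * (B + |E|) + ‖z‖) fun x hx hle => ?_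
  have hq : 0 ≤ ‖x - z‖ ^ 2 / (2 * η) := by positivity
  refine ⟨by linarith, ?_⟩
  have h1 := hAB x hx
  have h2 : ‖x - x₀‖ ≤ ‖x - z‖ + ‖z - x₀‖ := norm_sub_le_norm_sub_add_norm_sub _ _ _
  have h3 : ‖x‖ ≤ ‖x - z‖ + ‖z‖ := by simpa using norm_add_le (x - z) z
  set s := ‖x - z‖ with hs
  have h4 : s ^ 2 / (2 * η) ≤ B * s + |E| := by
    have := mul_le_mul_of_nonneg_left h2 hB
    have := le_abs_self E
    linarith
  rw [div_le_iff₀ (by positivity)] at h4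
  by_contra! hcon
  have h5 : 1 + 2 * η * (B + |E|) < s := by linarith
  have h6 : 0 ≤ |E| := abs_nonneg E
  have h7 : 0 ≤ η * (B + |E|) := by positivity
  have h8 : 0 ≤ η * |E| := by positivity
  nlinarith [mul_nonneg h8 (by linarith : (0:ℝ) ≤ s - 1)]

theorem proxOp_spec (hf : ProperClosedConvex f) (hη : 0 < η) (z : Euc d) :
    proxOp η f z ∈ effDom f ∧ ∀ w ∈ effDom f,
      (f (proxOp η f z)).toReal + ‖proxOp η f z - z‖ ^ 2 / (2 * η)
        ≤ (f w).toReal + ‖w - z‖ ^ 2 / (2 * η) := by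
  obtain ⟨y, hy, hmin⟩ := hf.exists_prox hη z
  have hspec : ∀ w, f (proxOp η f z) + ((‖proxOp η f z - z‖ ^ 2 / (2 * η) : ℝ) : EReal)
      ≤ f w + ((‖w - z‖ ^ 2 / (2 * η) : ℝ) : EReal) := by
    refine Classical.epsilon_spec (p := fun x => ∀ w, f x + ((‖x - z‖ ^ 2 / (2 * η) : ℝ) : EReal)
      ≤ f w + ((‖w - z‖ ^ 2 / (2 * η) : ℝ) : EReal)) ⟨y, fun w => ?_⟩
    by_cases hw : w ∈ effDom f
    · rw [← hf.coe_toReal hy, ← hf.coe_toReal hw]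
      exact_mod_cast hmin w hw
    · have : f w = ⊤ := not_not.1 hw
      rw [this, EReal.top_add_coe]; exact le_top
  have hd : proxOp η f z ∈ effDom f := by
    intro htop
    have := hspec y
    rw [htop, EReal.top_add_coe, ← hf.coe_toReal hy, ← EReal.coe_add] at this
    exact EReal.coe_ne_top _ (top_le_iff.1 this)
  refine ⟨hd, fun w hw => ?_⟩
  have := hspec w
  rw [← hf.coe_toReal hd, ← hf.coe_toReal hw] at this
  exact_mod_cast this

theorem proxOp_mem (hf : ProperClosedConvex f) (hη : 0 < η) (z : Euc d) :
    proxOp η f z ∈ effDom f := (hf.proxOp_spec hη z).1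

/-- The optimality condition of the proximal operator. -/
theorem proxOp_inner_le (hf : ProperClosedConvex f) (hη : 0 < η) (z : Euc d) {w : Euc d}
    (hw : w ∈ effDom f) :
    (f (proxOp η f z)).toReal + ⟪z - proxOp η f z, w - proxOp η f z⟫ / η ≤ (f w).toReal := by
  obtain ⟨hd, hmin⟩ := hf.proxOp_spec hη z
  set y := proxOp η f z with hy
  -- The minimizer is compared with the point at fraction `l` of the way to `w`. After division by
  -- `l` the quadratic remainder carries a factor `l`, which disappears as `l → 0⁺`.
  have key : ∀ l : ℝ, 0 < l → l ≤ 1 →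
      (f y).toReal + ⟪z - y, w - y⟫ / η ≤ (f w).toReal + l * (‖w - y‖ ^ 2 / (2 * η)) := by
    intro l hl0 hl1
    have h1 : 0 ≤ 1 - l := by linarith
    have hz := hf.convexOn.2 hd hw h1 hl0.le (by ring)
    have hzd := hf.convexOn.1 hd hw h1 hl0.le (by ring)
    have hm := hmin _ hzd
    simp only [smul_eq_mul] at hz
    have e : (1 - l) • y + l • w - z = (y - z) + l • (w - y) := by module
    have e2 : ⟪y - z, w - y⟫ = - ⟪z - y, w - y⟫ := by rw [← inner_neg_left, neg_sub]
    rw [e, norm_add_sq_real, norm_smul, Real.norm_of_nonneg hl0.le, inner_smul_right, e2] at hm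
    have h5 : l * ((f y).toReal + ⟪z - y, w - y⟫ / η)
        ≤ l * ((f w).toReal + l * (‖w - y‖ ^ 2 / (2 * η))) := by
      have e3 : (‖y - z‖ ^ 2 + 2 * (l * -⟪z - y, w - y⟫) + (l * ‖w - y‖) ^ 2) / (2 * η)
        = ‖y - z‖ ^ 2 / (2 * η) - l * (⟪z - y, w - y⟫ / η)
          + l * (l * (‖w - y‖ ^ 2 / (2 * η))) := by field_simp; ring
      rw [e3] at hm
      linarith
    exact le_of_mul_le_mul_left h5 hl0
  have hlim : Filter.Tendsto (fun l : ℝ => (f w).toReal + l * (‖w - y‖ ^ 2 / (2 * η)))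
      (nhdsWithin 0 (Set.Ioi 0)) (nhds ((f w).toReal + 0 * (‖w - y‖ ^ 2 / (2 * η)))) :=
    tendsto_nhdsWithin_of_tendsto_nhds (by
      apply Continuous.tendsto (f := fun l : ℝ => (f w).toReal + l * (‖w - y‖ ^ 2 / (2 * η)))
      fun_prop)
  rw [zero_mul, add_zero] at hlim
  refine ge_of_tendsto hlim ?_
  filter_upwards [Ioc_mem_nhdsGT (zero_lt_one' ℝ)] with l hl using key l hl.1 hl.2

/-- Firm nonexpansiveness: each proximal point is tested in the optimality condition of the other
one, and in the sum the values of `f` cancel. -/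
theorem norm_proxOp_sub_sq_le (hf : ProperClosedConvex f) (hη : 0 < η) (z w : Euc d) :
    ‖proxOp η f z - proxOp η f w‖ ^ 2 ≤ ⟪z - w, proxOp η f z - proxOp η f w⟫ := by
  have h1 := hf.proxOp_inner_le hη z (hf.proxOp_mem hη w)
  have h2 := hf.proxOp_inner_le hη w (hf.proxOp_mem hη z)
  set a := proxOp η f z
  set b := proxOp η f w
  have h3 : (⟪z - a, b - a⟫ + ⟪w - b, a - b⟫) / η ≤ 0 := by rw [add_div]; linarith
  have h4 : ⟪z - a, b - a⟫ + ⟪w - b, a - b⟫ ≤ 0 := by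
    rwa [div_le_iff₀ hη, zero_mul] at h3
  have h5 : ⟪z - a, b - a⟫ + ⟪w - b, a - b⟫ = ‖a - b‖ ^ 2 - ⟪z - w, a - b⟫ := by
    rw [← real_inner_self_eq_norm_sq, ← neg_sub a b, inner_neg_right]
    simp only [inner_sub_left]; ring
  linarith

theorem norm_proxOp_sub_le (hf : ProperClosedConvex f) (hη : 0 < η) (z w : Euc d) :
    ‖proxOp η f z - proxOp η f w‖ ≤ ‖z - w‖ := by
  have h1 := (hf.norm_proxOp_sub_sq_le hη z w).trans (real_inner_le_norm _ _)
  rcases (norm_nonneg (proxOp η f z - proxOp η f w)).eq_or_lt with h | h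
  · rw [← h]; positivity
  · rw [sq] at h1; exact le_of_mul_le_mul_right h1 h

theorem continuous_proxOp (hf : ProperClosedConvex f) (hη : 0 < η) :
    Continuous (proxOp η f) :=
  (LipschitzWith.of_dist_le_mul (K := 1) fun z w => by
    simpa [dist_eq_norm] using hf.norm_proxOp_sub_le hη z w).continuous

/-- The proximal operator ignores perturbations orthogonal to the domain. -/
theorem proxOp_eq_of_inner_eq_zero (hf : ProperClosedConvex f) (hη : 0 < η) {x z w : Euc d}
    (h : ∀ y ∈ effDom f, ⟪z - w, y - x⟫ = 0) : proxOp η f z = proxOp η f w := by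
  have h1 := hf.norm_proxOp_sub_sq_le hη z w
  have h2 : ⟪z - w, proxOp η f z - proxOp η f w⟫ = 0 := by
    rw [← sub_sub_sub_cancel_right (proxOp η f z) _ x, inner_sub_right, h _ (hf.proxOp_mem hη z),
      h _ (hf.proxOp_mem hη w), sub_zero]
  rw [h2] at h1
  exact sub_eq_zero.1 (norm_eq_zero.1 (by nlinarith [norm_nonneg (proxOp η f z - proxOp η f w)]))

end ProperClosedConvex

/-! ### The smoothed dual function -/

namespace MinimaxData

variable {p n q : ℕ} {Ξ : Type*} [MeasurableSpace Ξ] {D : MinimaxData p n q Ξ} {Mψ γ : ℝ}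

theorem Standing.bfun_nonneg (hD : D.Standing) {y : Euc n} (hy : y ∈ effDom D.ψ) :
    0 ≤ D.bfun y := hD.bfun_min.2 ⟨y, hy, rfl⟩

theorem Standing.bfun_le (hD : D.Standing) {y : Euc n} (hy : y ∈ effDom D.ψ) :
    D.bfun y ≤ D.Bpsi := le_csSup hD.bfun_bdd ⟨y, hy, rfl⟩

theorem Standing.Bpsi_nonneg (hD : D.Standing) : 0 ≤ D.Bpsi := by
  obtain ⟨y, hy, h0⟩ := hD.bfun_min.1
  exact h0 ▸ hD.bfun_le hy

theorem exists_dual_max (hD : D.Standing) (hψ : D.AssumptionPsi Mψ) (hγ : 0 ≤ γ) (u : Euc q) :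
    ∃ y, y ∈ effDom D.ψ ∧ IsMaxOn (D.dualObj γ u) (effDom D.ψ) y := by
  obtain ⟨x₀, hx₀⟩ := hψ.pcc.nonempty_dom
  set h : Euc n → ℝ := fun y => γ * D.bfun y - ⟪u, D.K y⟫ with hh
  obtain ⟨y, hy, hmin⟩ := hψ.pcc.exists_isMinOn_add (h := h)
    ((continuousOn_const.mul hD.bfun_cont).sub (by fun_prop)) hx₀
    ((D.ψ x₀).toReal + h x₀ + ‖u‖ * (‖D.K‖ * Mψ)) Mψ (fun x hx hle => by
      refine ⟨?_, hψ.bounded x hx⟩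
      have h1 : ⟪u, D.K x⟫ ≤ ‖u‖ * (‖D.K‖ * Mψ) :=
        (real_inner_le_norm _ _).trans (mul_le_mul_of_nonneg_left
          ((D.K.le_opNorm x).trans (mul_le_mul_of_nonneg_left (hψ.bounded x hx) (norm_nonneg _)))
          (norm_nonneg _))
      have h2 : 0 ≤ γ * D.bfun x := mul_nonneg hγ (hD.bfun_nonneg hx)
      simp only [hh] at hle ⊢
      linarith)
  refine ⟨y, hy, fun w hw => ?_⟩
  have := hmin w hw
  simp only [hh, Set.mem_ofPred_eq, dualObj] at this ⊢
  linarith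

theorem dualSol_spec (hD : D.Standing) (hψ : D.AssumptionPsi Mψ) (hγ : 0 ≤ γ) (u : Euc q) :
    D.dualSol γ u ∈ effDom D.ψ ∧ IsMaxOn (D.dualObj γ u) (effDom D.ψ) (D.dualSol γ u) :=
  Classical.epsilon_spec (exists_dual_max hD hψ hγ u)

theorem phi_eq (hD : D.Standing) (hψ : D.AssumptionPsi Mψ) (hγ : 0 ≤ γ) (u : Euc q) :
    D.phi γ u = D.dualObj γ u (D.dualSol γ u) := by
  obtain ⟨h1, h2⟩ := dualSol_spec hD hψ hγ u
  exact IsGreatest.csSup_eq ⟨⟨_, h1, rfl⟩, by rintro _ ⟨y, hy, rfl⟩; exact h2 hy⟩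

theorem dualObj_le_phi (hD : D.Standing) (hψ : D.AssumptionPsi Mψ) (hγ : 0 ≤ γ) (u : Euc q)
    {y : Euc n} (hy : y ∈ effDom D.ψ) : D.dualObj γ u y ≤ D.phi γ u := by
  rw [phi_eq hD hψ hγ]; exact (dualSol_spec hD hψ hγ u).2 hy

theorem phi_le_phi_zero (hD : D.Standing) (hψ : D.AssumptionPsi Mψ) (hγ : 0 ≤ γ) (u : Euc q) :
    D.phi γ u ≤ D.phi 0 u := by
  have h1 := (dualSol_spec hD hψ hγ u).1
  have h2 := dualObj_le_phi hD hψ le_rfl u h1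
  rw [phi_eq hD hψ hγ]
  have := mul_nonneg hγ (hD.bfun_nonneg h1)
  simp only [dualObj] at h2 ⊢
  linarith

/-- The unsmoothed maximizer is admissible in the smoothed problem and loses at most `γ B_ψ` there.
Together with `phi_le_phi_zero`, the bias of smoothing lies between `0` and `γ B_ψ`. -/
theorem phi_zero_le (hD : D.Standing) (hψ : D.AssumptionPsi Mψ) (hγ : 0 ≤ γ) (u : Euc q) :
    D.phi 0 u ≤ D.phi γ u + γ * D.Bpsi := by
  have h1 := (dualSol_spec hD hψ le_rfl u).1
  have h2 := dualObj_le_phi hD hψ hγ u h1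
  rw [phi_eq hD hψ le_rfl]
  have := mul_le_mul_of_nonneg_left (hD.bfun_le h1) hγ
  simp only [dualObj] at h2 ⊢
  linarith

theorem norm_K_dualSol_le (hD : D.Standing) (hψ : D.AssumptionPsi Mψ) (hγ : 0 ≤ γ) (u : Euc q) :
    ‖D.K (D.dualSol γ u)‖ ≤ ‖D.K‖ * Mψ :=
  (D.K.le_opNorm _).trans (mul_le_mul_of_nonneg_left
    (hψ.bounded _ (dualSol_spec hD hψ hγ u).1) (norm_nonneg _))

/-- Strong concavity of the dual objective at its maximizer. -/
theorem dualObj_add_le (hD : D.Standing) (hψ : D.AssumptionPsi Mψ) (hγ : 0 ≤ γ) (u : Euc q)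
    {w : Euc n} (hw : w ∈ effDom D.ψ) :
    D.dualObj γ u w + γ / 2 * ‖w - D.dualSol γ u‖ ^ 2 ≤ D.phi γ u := by
  obtain ⟨hd, hmax⟩ := dualSol_spec hD hψ hγ u
  rw [phi_eq hD hψ hγ]
  set y := D.dualSol γ u with hy
  -- Maximality is tested at `(1 - l) y + l w`. The modulus of strong convexity contributes `l (1 -
  -- l) γ / 2`, and one factor `l` is divided out before letting `l → 0⁺`.
  have key : ∀ l : ℝ, 0 < l → l ≤ 1 →
      D.dualObj γ u w + (1 - l) * (γ / 2 * ‖w - y‖ ^ 2) ≤ D.dualObj γ u y := by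
    intro l hl0 hl1
    have h1 : 0 ≤ 1 - l := by linarith
    have hz := hψ.pcc.convexOn.2 hd hw h1 hl0.le (by ring)
    have hzd := hψ.pcc.convexOn.1 hd hw h1 hl0.le (by ring)
    have hb := hD.bfun_strong.2 hd hw h1 hl0.le (by ring)
    have hm := hmax hzd
    simp only [Set.mem_ofPred_eq, smul_eq_mul, dualObj, map_add, map_smul, inner_add_right,
      inner_smul_right] at hm hz hb ⊢
    rw [norm_sub_rev y w] at hb
    have hb' := mul_le_mul_of_nonneg_left hb hγ
    refine le_of_mul_le_mul_left ?_ hl0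
    nlinarith
  have hlim : Filter.Tendsto (fun l : ℝ => D.dualObj γ u w + (1 - l) * (γ / 2 * ‖w - y‖ ^ 2))
      (nhdsWithin 0 (Set.Ioi 0))
      (nhds (D.dualObj γ u w + (1 - 0) * (γ / 2 * ‖w - y‖ ^ 2))) :=
    tendsto_nhdsWithin_of_tendsto_nhds (Continuous.tendsto
      (f := fun l : ℝ => D.dualObj γ u w + (1 - l) * (γ / 2 * ‖w - y‖ ^ 2)) (by fun_prop) _)
  rw [sub_zero, one_mul] at hlim
  refine le_of_tendsto hlim ?_
  filter_upwards [Ioc_mem_nhdsGT (zero_lt_one' ℝ)] with l hl using key l hl.1 hl.2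

theorem dualObj_sub (γ : ℝ) (u v : Euc q) (y : Euc n) :
    D.dualObj γ v y = D.dualObj γ u y + ⟪v - u, D.K y⟫ := by
  simp only [dualObj, inner_sub_left]; ring

/-- Quadratic growth around both maximizers, added: everything cancels except the coupling term `⟪v
- u, K (b - a)⟫`, which therefore dominates `γ ‖a - b‖²`. -/
theorem norm_dualSol_sub_le (hD : D.Standing) (hψ : D.AssumptionPsi Mψ) (hγ : 0 < γ)
    (u v : Euc q) : ‖D.dualSol γ u - D.dualSol γ v‖ ≤ ‖D.K‖ / γ * ‖u - v‖ := by
  have hu := (dualSol_spec hD hψ hγ.le u).1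
  have hv := (dualSol_spec hD hψ hγ.le v).1
  have h1 := dualObj_add_le hD hψ hγ.le u hv
  have h2 := dualObj_add_le hD hψ hγ.le v hu
  rw [phi_eq hD hψ hγ.le] at h1 h2
  rw [dualObj_sub γ u v, dualObj_sub γ u v] at h2
  set a := D.dualSol γ u
  set b := D.dualSol γ v
  rw [norm_sub_rev b a] at h1
  have h3 : γ * ‖a - b‖ ^ 2 ≤ ⟪v - u, D.K (b - a)⟫ := by
    rw [map_sub, inner_sub_right]; linarith
  have h4 : ⟪v - u, D.K (b - a)⟫ ≤ ‖u - v‖ * (‖D.K‖ * ‖a - b‖) := by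
    rw [norm_sub_rev u v, norm_sub_rev a b]
    exact (real_inner_le_norm _ _).trans
      (mul_le_mul_of_nonneg_left (D.K.le_opNorm _) (norm_nonneg _))
  rcases (norm_nonneg (a - b)).eq_or_lt with h | h
  · rw [← h]; positivity
  · rw [div_mul_eq_mul_div, le_div_iff₀ hγ]
    refine le_of_mul_le_mul_right ?_ h
    nlinarith

theorem continuous_dualSol (hD : D.Standing) (hψ : D.AssumptionPsi Mψ) (hγ : 0 < γ) :
    Continuous (D.dualSol γ) :=
  (LipschitzWith.of_dist_le_mul (K := (‖D.K‖ / γ).toNNReal) fun z w => by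
    rw [Real.coe_toNNReal _ (by positivity), dist_eq_norm, dist_eq_norm]
    exact norm_dualSol_sub_le hD hψ hγ z w).continuous

theorem phi_lower (hD : D.Standing) (hψ : D.AssumptionPsi Mψ) (hγ : 0 ≤ γ) (u v : Euc q) :
    D.phi γ u + ⟪v - u, D.K (D.dualSol γ u)⟫ ≤ D.phi γ v := by
  rw [phi_eq hD hψ hγ u, ← dualObj_sub]
  exact dualObj_le_phi hD hψ hγ v (dualSol_spec hD hψ hγ u).1

/-- Moving the maximizer from `a` to `b` costs `γ / 2 ‖b - a‖²` in the problem for `u`, and Young's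
inequality absorbs the gain `⟪v - u, K (b - a)⟫` into this cost. What remains is quadratic in `v -
u`. -/
theorem phi_upper (hD : D.Standing) (hψ : D.AssumptionPsi Mψ) (hγ : 0 < γ) (u v : Euc q) :
    D.phi γ v ≤ D.phi γ u + ⟪v - u, D.K (D.dualSol γ u)⟫
      + ‖D.K‖ ^ 2 / (2 * γ) * ‖v - u‖ ^ 2 := by
  have hv := (dualSol_spec hD hψ hγ.le v).1
  have h1 := dualObj_add_le hD hψ hγ.le u hv
  rw [phi_eq hD hψ hγ.le v, dualObj_sub γ u v]
  set a := D.dualSol γ u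
  set b := D.dualSol γ v
  have h2 : ⟪v - u, D.K b⟫ = ⟪v - u, D.K a⟫ + ⟪v - u, D.K (b - a)⟫ := by
    rw [map_sub, inner_sub_right]; ring
  have h4 : ⟪v - u, D.K (b - a)⟫ ≤ ‖v - u‖ * (‖D.K‖ * ‖b - a‖) :=
    (real_inner_le_norm _ _).trans
      (mul_le_mul_of_nonneg_left (D.K.le_opNorm _) (norm_nonneg _))
  have h5 : ‖v - u‖ * (‖D.K‖ * ‖b - a‖)
      ≤ γ / 2 * ‖b - a‖ ^ 2 + ‖D.K‖ ^ 2 / (2 * γ) * ‖v - u‖ ^ 2 := by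
    have e : γ / 2 * ‖b - a‖ ^ 2 + ‖D.K‖ ^ 2 / (2 * γ) * ‖v - u‖ ^ 2
        - ‖v - u‖ * (‖D.K‖ * ‖b - a‖)
        = (γ * ‖b - a‖ - ‖D.K‖ * ‖v - u‖) ^ 2 / (2 * γ) := by
      field_simp; ring
    have : 0 ≤ (γ * ‖b - a‖ - ‖D.K‖ * ‖v - u‖) ^ 2 / (2 * γ) := by positivity
    linarith
  linarith

/-- Danskin's theorem: `phi_lower` and `phi_upper` enclose the remainder of the linearization
between `0` and a multiple of `‖v - u‖²`. -/
theorem hasGradientAt_phi (hD : D.Standing) (hψ : D.AssumptionPsi Mψ) (hγ : 0 < γ) (u : Euc q) :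
    HasGradientAt (D.phi γ) (D.K (D.dualSol γ u)) u := by
  rw [hasGradientAt_iff_isLittleO]
  have hO : (fun v => D.phi γ v - D.phi γ u - ⟪D.K (D.dualSol γ u), v - u⟫)
      =O[nhds u] fun v => ‖v - u‖ ^ 2 := by
    refine Asymptotics.IsBigO.of_bound (‖D.K‖ ^ 2 / (2 * γ)) (Filter.Eventually.of_forall ?_)
    intro v
    have h1 := phi_lower hD hψ hγ.le u v
    have h2 := phi_upper hD hψ hγ u v
    rw [real_inner_comm] at h1 h2
    rw [Real.norm_of_nonneg (by linarith), Real.norm_of_nonneg (by positivity)]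
    linarith
  refine hO.trans_isLittleO ?_
  have := (Asymptotics.isLittleO_norm_pow_id (E' := Euc q) (one_lt_two)).comp_tendsto
    (f := fun w : Euc q => ‖w‖ ^ 2) (k := fun v : Euc q => v - u) (l' := nhds u) (by
      have : Filter.Tendsto (fun v : Euc q => v - u) (nhds u) (nhds (u - u)) :=
        Continuous.tendsto (by fun_prop) u
      simpa using this)
  exact this

theorem continuous_phi (hD : D.Standing) (hψ : D.AssumptionPsi Mψ) (hγ : 0 < γ) :
    Continuous (D.phi γ) :=
  continuous_iff_continuousAt.2 fun u => (hasGradientAt_phi hD hψ hγ u).hasFDerivAt.continuousAt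

end MinimaxData

/-! ### Second moments of mini-batch estimators -/

/-- Independence makes the joint law a product, and Tonelli's theorem integrates one factor first.
This takes the place of conditioning on the past: `X` may be frozen while the fresh samples `Y` are
averaged, with no integrability requirement. -/
theorem lintegral_comp_of_indepFun {Ω α β : Type*} [MeasurableSpace Ω] [MeasurableSpace α]
    [MeasurableSpace β] {μ : Measure Ω} [IsProbabilityMeasure μ] {X : Ω → α} {Y : Ω → β}
    (hX : Measurable X) (hY : Measurable Y) (h : IndepFun X Y μ) {f : α × β → ENNReal}
    (hf : Measurable f) :
    ∫⁻ ω, f (X ω, Y ω) ∂μ = ∫⁻ ω, ∫⁻ ω', f (X ω, Y ω') ∂μ ∂μ := by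
  have : IsProbabilityMeasure (μ.map Y) := Measure.isProbabilityMeasure_map hY.aemeasurable
  have : IsProbabilityMeasure (μ.map X) := Measure.isProbabilityMeasure_map hX.aemeasurable
  rw [← lintegral_map (g := fun ω => (X ω, Y ω)) hf (hX.prodMk hY),
    h.map_prod_eq_prod_map_map hX.aemeasurable hY.aemeasurable, lintegral_prod _ hf.aemeasurable,
    lintegral_map hf.lintegral_prod_right' hX]
  exact lintegral_congr fun ω => lintegral_map (by fun_prop) hY

section SecondMoment

variable {Ω Ξ E : Type*} [MeasurableSpace Ω] [MeasurableSpace Ξ] {μ : Measure Ω} {P : Measure Ξ}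
  [IsProbabilityMeasure μ] [IsProbabilityMeasure P]
  [NormedAddCommGroup E] [InnerProductSpace ℝ E] [CompleteSpace E] [MeasurableSpace E]
  [BorelSpace E] [SecondCountableTopology E]

theorem integral_norm_sq_eq_lintegral {Z : Ω → E} (hZ : MemLp Z 2 μ) :
    ENNReal.ofReal (∫ ω, ‖Z ω‖ ^ 2 ∂μ) = ∫⁻ ω, ENNReal.ofReal (‖Z ω‖ ^ 2) ∂μ :=
  ofReal_integral_eq_lintegral_ofReal hZ.integrable_norm_pow'
    (Filter.Eventually.of_forall fun _ => by positivity)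

theorem memLp_two_of_lintegral_le {Z : Ω → E} (hZ : AEStronglyMeasurable Z μ) {c : ℝ}
    (h : ∫⁻ ω, ENNReal.ofReal (‖Z ω‖ ^ 2) ∂μ ≤ ENNReal.ofReal c) : MemLp Z 2 μ := by
  refine (memLp_two_iff_integrable_sq_norm hZ).2 ⟨hZ.norm.pow 2, ?_⟩
  refine (lt_of_le_of_lt (lintegral_mono fun ω => ?_) (h.trans_lt ENNReal.ofReal_lt_top))
  rw [Real.enorm_of_nonneg (by positivity)]

theorem MeasureTheory.MemLp.integrable_inner_of_memLp_two {X Y : Ω → E} (hX : MemLp X 2 μ)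
    (hY : MemLp Y 2 μ) : Integrable (fun ω => ⟪X ω, Y ω⟫) μ := by
  have h1 : Integrable (fun ω => ‖X ω‖ ^ 2) μ := hX.integrable_norm_pow'
  have h2 : Integrable (fun ω => ‖Y ω‖ ^ 2) μ := hY.integrable_norm_pow'
  refine (h1.add h2).mono' (hX.1.inner hY.1) (Filter.Eventually.of_forall fun ω => ?_)
  have h3 := norm_inner_le_norm (𝕜 := ℝ) (X ω) (Y ω)
  simp only [Pi.add_apply]
  nlinarith [sq_nonneg (‖X ω‖ - ‖Y ω‖), sq_nonneg (‖X ω‖), sq_nonneg (‖Y ω‖)]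

theorem integral_inner_of_indepFun {X Y : Ω → E} (h : IndepFun X Y μ) (hX : Integrable X μ)
    (hY : Integrable Y μ) : ∫ ω, ⟪X ω, Y ω⟫ ∂μ = ⟪∫ ω, X ω ∂μ, ∫ ω, Y ω ∂μ⟫ :=
  h.integral_bilin hX hY (innerSL ℝ)

theorem integral_norm_add_sq {X Y : Ω → E} (hX : MemLp X 2 μ) (hY : MemLp Y 2 μ) :
    ∫ ω, ‖X ω + Y ω‖ ^ 2 ∂μ = ∫ ω, ‖X ω‖ ^ 2 ∂μ + 2 * ∫ ω, ⟪X ω, Y ω⟫ ∂μ + ∫ ω, ‖Y ω‖ ^ 2 ∂μ := by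
  have h1 : Integrable (fun ω => ‖X ω‖ ^ 2) μ := hX.integrable_norm_pow'
  have h2 : Integrable (fun ω => ‖Y ω‖ ^ 2) μ := hY.integrable_norm_pow'
  have h3 : Integrable (fun ω => ⟪X ω, Y ω⟫) μ := hX.integrable_inner_of_memLp_two hY
  simp_rw [norm_add_sq_real]
  have h4 : Integrable (fun ω => ‖X ω‖ ^ 2 + 2 * ⟪X ω, Y ω⟫) μ := h1.add (h3.const_mul 2)
  rw [integral_add h4 h2, integral_add h1 (h3.const_mul 2), integral_const_mul]

/-- Independent centered vectors are orthogonal in `L²`, so all cross terms vanish. This is the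
source of the factor one over the batch size. -/
theorem integral_norm_sum_sq {ι : Type*} (s : Finset ι) {Z : ι → Ω → E}
    (hZ : ∀ i, MemLp (Z i) 2 μ) (h0 : ∀ i, ∫ ω, Z i ω ∂μ = 0) (hi : iIndepFun Z μ) :
    ∫ ω, ‖∑ i ∈ s, Z i ω‖ ^ 2 ∂μ = ∑ i ∈ s, ∫ ω, ‖Z i ω‖ ^ 2 ∂μ := by
  classical
  induction s using Finset.induction_on with
  | empty => simp
  | insert j s hj ih =>
    have hm : ∀ i, AEMeasurable (Z i) μ := fun i => (hZ i).1.aemeasurable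
    have hsum : MemLp (fun ω => ∑ i ∈ s, Z i ω) 2 μ := memLp_finsetSum s fun i _ => hZ i
    have hind : ∫ ω, ⟪Z j ω, ∑ i ∈ s, Z i ω⟫ ∂μ = 0 := by
      simp_rw [inner_sum]
      rw [integral_finsetSum _ fun i _ => (hZ j).integrable_inner_of_memLp_two (hZ i)]
      refine Finset.sum_eq_zero fun i his => ?_
      have hne : j ≠ i := fun h => hj (h ▸ his)
      rw [integral_inner_of_indepFun (hi.indepFun hne) ((hZ j).integrable one_le_two)
        ((hZ i).integrable one_le_two), h0, inner_zero_left]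
    simp_rw [Finset.sum_insert hj]
    rw [integral_norm_add_sq (hZ j) hsum, hind, ih]
    ring

/-- The mean minimizes the second moment of the deviation. -/
theorem integral_norm_sub_mean_sq_le {f : Ξ → E} (hf : MemLp f 2 P) (c : E) :
    ∫ ξ, ‖f ξ - ∫ x, f x ∂P‖ ^ 2 ∂P ≤ ∫ ξ, ‖f ξ - c‖ ^ 2 ∂P := by
  set e := ∫ x, f x ∂P with he
  have h1 : MemLp (fun ξ => f ξ - e) 2 P := hf.sub (memLp_const e)
  have h2 := integral_norm_add_sq h1 (memLp_const (e - c))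
  have h3 : ∫ ξ, ⟪f ξ - e, e - c⟫ ∂P = 0 := by
    have h4 : ∫ ξ, ⟪e - c, f ξ - e⟫ ∂P = ⟪e - c, ∫ ξ, (f ξ - e) ∂P⟫ :=
      integral_inner (h1.integrable one_le_two) _
    simp_rw [real_inner_comm] at h4
    rw [h4, integral_sub (hf.integrable one_le_two) (integrable_const _)]
    simp [← he]
  simp only [sub_add_sub_cancel] at h2
  rw [h2, h3]
  simp

/-! ### Averages over mini-batches and the hybrid update. -/

section Batch

variable {m : ℕ} {X : Fin m → Ω → Ξ} {f : Ξ → E}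

theorem IsIID.memLp_comp (hX : IsIID X P μ) (hf : MemLp f 2 P) (i : Fin m) :
    MemLp (fun ω => f (X i ω)) 2 μ := by
  have h := hX.1 i
  rw [← h.2] at hf
  exact hf.comp_of_map h.1.aemeasurable

theorem IsIID.integral_comp (hX : IsIID X P μ) {F : Type*} [NormedAddCommGroup F]
    [NormedSpace ℝ F] {g : Ξ → F} (hg : AEStronglyMeasurable g P) (i : Fin m) :
    ∫ ω, g (X i ω) ∂μ = ∫ ξ, g ξ ∂P := by
  have h := hX.1 i
  rw [← h.2] at hg ⊢
  exact (integral_map h.1.aemeasurable hg).symm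

/-- The error of a mini-batch average is square integrable, centered, and has a variance that is
inversely proportional to the batch size. -/
theorem IsIID.batch_error (hX : IsIID X P μ) (hm : 0 < m) (hfm : Measurable f)
    (hf : MemLp f 2 P) :
    MemLp (fun ω => (m : ℝ)⁻¹ • ∑ i, f (X i ω) - ∫ ξ, f ξ ∂P) 2 μ ∧
      ∫ ω, ((m : ℝ)⁻¹ • ∑ i, f (X i ω) - ∫ ξ, f ξ ∂P) ∂μ = 0 ∧
      ∫ ω, ‖(m : ℝ)⁻¹ • ∑ i, f (X i ω) - ∫ ξ, f ξ ∂P‖ ^ 2 ∂μ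
        = (m : ℝ)⁻¹ * ∫ ξ, ‖f ξ - ∫ x, f x ∂P‖ ^ 2 ∂P := by
  have hm' : (m : ℝ) ≠ 0 := by positivity
  set e := ∫ x, f x ∂P with he
  have hfe : MemLp (fun ξ => f ξ - e) 2 P := hf.sub (memLp_const e)
  have hfem : Measurable (fun ξ => f ξ - e) := hfm.sub_const e
  set Z : Fin m → Ω → E := fun i ω => f (X i ω) - e with hZdef
  have hZ : ∀ i, MemLp (Z i) 2 μ := fun i => hX.memLp_comp hfe i
  have h0 : ∀ i, ∫ ω, Z i ω ∂μ = 0 := fun i => by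
    rw [hX.integral_comp (g := fun ξ => f ξ - e) hfe.1 i,
      integral_sub (hf.integrable one_le_two) (integrable_const _)]
    simp [← he]
  have hi : iIndepFun Z μ := hX.2.comp (fun _ ξ => f ξ - e) fun _ => hfem
  have heq : ∀ ω, (m : ℝ)⁻¹ • ∑ i, f (X i ω) - e = (m : ℝ)⁻¹ • ∑ i, Z i ω := fun ω => by
    simp only [hZdef, Finset.sum_sub_distrib, Finset.sum_const, Finset.card_univ,
      Fintype.card_fin, smul_sub]
    rw [← Nat.cast_smul_eq_nsmul ℝ, smul_smul, inv_mul_cancel₀ hm', one_smul]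
  simp_rw [heq]
  refine ⟨(memLp_finsetSum _ fun i _ => hZ i).const_smul _, ?_, ?_⟩
  · rw [integral_smul, integral_finsetSum _ fun i _ => (hZ i).integrable one_le_two]
    simp [h0]
  · simp_rw [norm_smul, mul_pow]
    rw [integral_const_mul, integral_norm_sum_sq _ hZ h0 hi]
    have : ∀ i, ∫ ω, ‖Z i ω‖ ^ 2 ∂μ = ∫ ξ, ‖f ξ - e‖ ^ 2 ∂P := fun i =>
      hX.integral_comp (g := fun ξ => ‖f ξ - e‖ ^ 2) hfe.integrable_norm_pow'.1 i
    simp_rw [this]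
    simp only [Finset.sum_const, Finset.card_univ, Fintype.card_fin, nsmul_eq_mul, norm_inv,
      Real.norm_natCast]
    field_simp

/-- One step of the hybrid estimator, started with the error `a`. -/
theorem hybrid_second_moment {k : ℕ} {Y : Fin k → Ω → Ξ} {g : Ξ → E} (hX : IsIID X P μ)
    (hY : IsIID Y P μ) (hm : 0 < m) (hk : 0 < k) (hfm : Measurable f) (hf : MemLp f 2 P)
    (hgm : Measurable g) (hg : MemLp g 2 P) {κ : ℝ}
    (hκ : κ = 2 ∨ κ = 1 ∧ Indep (sigmaOf X) (sigmaOf Y) μ) (a : E) (β : ℝ) :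
    ∫⁻ ω, ENNReal.ofReal (‖a + (β • ((m : ℝ)⁻¹ • ∑ i, f (X i ω) - ∫ ξ, f ξ ∂P)
        + (1 - β) • ((k : ℝ)⁻¹ • ∑ i, g (Y i ω) - ∫ ξ, g ξ ∂P))‖ ^ 2) ∂μ
      ≤ ENNReal.ofReal (‖a‖ ^ 2 + κ * (β ^ 2 / m * ∫ ξ, ‖f ξ - ∫ x, f x ∂P‖ ^ 2 ∂P
        + (1 - β) ^ 2 / k * ∫ ξ, ‖g ξ - ∫ x, g x ∂P‖ ^ 2 ∂P)) := by
  obtain ⟨hA, hA0, hA2⟩ := hX.batch_error hm hfm hf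
  obtain ⟨hB, hB0, hB2⟩ := hY.batch_error hk hgm hg
  have hind : κ = 2 ∨ κ = 1 ∧ IndepFun (fun ω => (m : ℝ)⁻¹ • ∑ i, f (X i ω) - ∫ ξ, f ξ ∂P)
      (fun ω => (k : ℝ)⁻¹ • ∑ i, g (Y i ω) - ∫ ξ, g ξ ∂P) μ := by
    refine hκ.imp id fun ⟨h1, h2⟩ => ⟨h1, ?_⟩
    refine indep_of_indep_of_le_left (indep_of_indep_of_le_right h2 ?_) ?_
    · refine Measurable.comap_le (m₁ := sigmaOf Y) ?_
      have : ∀ i, Measurable[sigmaOf Y] (Y i) := fun i =>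
        Measurable.mono (comap_measurable (Y i))
          (le_iSup (fun i => MeasurableSpace.comap (Y i) _) i) le_rfl
      exact ((Finset.measurable_sum _ fun i _ => hgm.comp (this i)).const_smul _).sub_const _
    · refine Measurable.comap_le (m₁ := sigmaOf X) ?_
      have : ∀ i, Measurable[sigmaOf X] (X i) := fun i =>
        Measurable.mono (comap_measurable (X i))
          (le_iSup (fun i => MeasurableSpace.comap (X i) _) i) le_rfl
      exact ((Finset.measurable_sum _ fun i _ => hfm.comp (this i)).const_smul _).sub_const _
  set A : Ω → E := fun ω => (m : ℝ)⁻¹ • ∑ i, f (X i ω) - ∫ ξ, f ξ ∂P with hAdef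
  set B : Ω → E := fun ω => (k : ℝ)⁻¹ • ∑ i, g (Y i ω) - ∫ ξ, g ξ ∂P with hBdef
  have hA' : MemLp (fun ω => β • A ω) 2 μ := hA.const_smul β
  have hB' : MemLp (fun ω => (1 - β) • B ω) 2 μ := hB.const_smul (1 - β)
  have hZ : MemLp (fun ω => β • A ω + (1 - β) • B ω) 2 μ := hA'.add hB'
  have hZ0 : ∫ ω, (β • A ω + (1 - β) • B ω) ∂μ = 0 := by
    rw [integral_add (hA'.integrable one_le_two) (hB'.integrable one_le_two), integral_smul,
      integral_smul, hA0, hB0]; simp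
  have hT : MemLp (fun ω => a + (β • A ω + (1 - β) • B ω)) 2 μ := (memLp_const a).add hZ
  rw [← integral_norm_sq_eq_lintegral hT]
  refine ENNReal.ofReal_le_ofReal ?_
  rw [integral_norm_add_sq (memLp_const a) hZ, integral_inner (hZ.integrable one_le_two), hZ0]
  simp only [inner_zero_right, mul_zero, add_zero, integral_const, probReal_univ, smul_eq_mul,
    one_mul]
  gcongr
  have eA : ∫ ω, ‖β • A ω‖ ^ 2 ∂μ = β ^ 2 / m * ∫ ξ, ‖f ξ - ∫ x, f x ∂P‖ ^ 2 ∂P := by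
    simp_rw [norm_smul, mul_pow]
    rw [integral_const_mul, hA2, Real.norm_eq_abs, sq_abs]; ring
  have eB : ∫ ω, ‖(1 - β) • B ω‖ ^ 2 ∂μ
      = (1 - β) ^ 2 / k * ∫ ξ, ‖g ξ - ∫ x, g x ∂P‖ ^ 2 ∂P := by
    simp_rw [norm_smul, mul_pow]
    rw [integral_const_mul, hB2, Real.norm_eq_abs, sq_abs]; ring
  rw [← eA, ← eB]
  -- The two fluctuations may be correlated inside one iteration. Without further information the
  -- parallelogram law costs the factor `2`; if the batches are independent, the cross term has mean
  -- zero and the factor is `1`.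
  rcases hind with rfl | ⟨rfl, hind⟩
  · have i1 : Integrable (fun ω => ‖β • A ω‖ ^ 2) μ := hA'.integrable_norm_pow'
    have i2 : Integrable (fun ω => ‖(1 - β) • B ω‖ ^ 2) μ := hB'.integrable_norm_pow'
    rw [← integral_add i1 i2, ← integral_const_mul]
    refine integral_mono hZ.integrable_norm_pow' ((i1.add i2).const_mul 2) fun ω => ?_
    change ‖β • A ω + (1 - β) • B ω‖ ^ 2 ≤ 2 * (‖β • A ω‖ ^ 2 + ‖(1 - β) • B ω‖ ^ 2)
    have := parallelogram_law_with_norm ℝ (β • A ω) ((1 - β) • B ω)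
    nlinarith [mul_self_nonneg ‖β • A ω - (1 - β) • B ω‖]
  · rw [integral_norm_add_sq hA' hB']
    simp_rw [inner_smul_left, inner_smul_right]
    rw [integral_const_mul, integral_const_mul, integral_inner_of_indepFun hind
      (hA.integrable one_le_two) (hB.integrable one_le_two), hA0]
    simp

end Batch

end SecondMoment

/-! ### Increments of curves -/

/-- No integrability of the derivative is assumed: if its norm has infinite integral the bound is
trivial, and otherwise the fundamental theorem of calculus applies. -/
theorem enorm_sub_le_lintegral_deriv {E : Type*} [NormedAddCommGroup E] [NormedSpace ℝ E]
    [CompleteSpace E] [SecondCountableTopology E] {c c' : ℝ → E}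
    (hc : ∀ t, HasDerivAt c (c' t) t) :
    ‖c 1 - c 0‖ₑ ≤ ∫⁻ t in Set.Icc (0 : ℝ) 1, ‖c' t‖ₑ := by
  borelize E
  have hm : Measurable c' := by
    have : c' = deriv c := funext fun t => (hc t).deriv.symm
    rw [this]; exact measurable_deriv c
  by_cases hfin : ∫⁻ t in Set.Icc (0 : ℝ) 1, ‖c' t‖ₑ = ⊤
  · rw [hfin]; exact le_top
  have hint : IntegrableOn c' (Set.Icc 0 1) :=
    ⟨hm.aestronglyMeasurable, lt_top_iff_ne_top.2 hfin⟩
  rw [← intervalIntegral.integral_eq_sub_of_hasDerivAt (fun t _ => hc t)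
    ((intervalIntegrable_iff_integrableOn_Icc_of_le zero_le_one).2 hint),
    intervalIntegral.integral_of_le zero_le_one, ← integral_Icc_eq_integral_Ioc]
  exact enorm_integral_le_lintegral_enorm _

/-! ### Linear maps as families of columns -/

/-- The columns of a linear map `ℝ^p → ℝ^q`, with the Frobenius norm. -/
abbrev Cols (p q : ℕ) : Type := PiLp 2 (fun _ : Fin p => Euc q)

/-- The columns of (the matrix of) a linear map. -/
def cols {p q : ℕ} (J : Euc p →L[ℝ] Euc q) : Cols p q :=
  WithLp.toLp 2 fun i => J (EuclideanSpace.single i (1 : ℝ))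

/-- Evaluation at `h` of the linear map with given columns. -/
def colEval {p q : ℕ} (h : Euc p) : Cols p q →L[ℝ] Euc q :=
  ∑ i, h i • PiLp.proj 2 (fun _ : Fin p => Euc q) i

/-- The adjoint of the linear map with given columns. -/
def colAdj {p q : ℕ} (A : Cols p q) (w : Euc q) : Euc p :=
  WithLp.toLp 2 fun i => ⟪A i, w⟫

section Cols

variable {p q : ℕ}

/-- This is why Jacobians are represented by columns. The operator norm does not come from an inner
product, whereas `Cols p q` is a Hilbert space in which the variance identities for mini-batches
hold. -/
theorem norm_cols_sq (J : Euc p →L[ℝ] Euc q) : ‖cols J‖ ^ 2 = frobSq J := by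
  rw [PiLp.norm_sq_eq_of_L2]; rfl

theorem cols_add (J J' : Euc p →L[ℝ] Euc q) : cols (J + J') = cols J + cols J' := rfl

theorem cols_sub (J J' : Euc p →L[ℝ] Euc q) : cols (J - J') = cols J - cols J' := rfl

theorem cols_smul (a : ℝ) (J : Euc p →L[ℝ] Euc q) : cols (a • J) = a • cols J := rfl

theorem cols_sum {ι : Type*} (s : Finset ι) (J : ι → Euc p →L[ℝ] Euc q) :
    cols (∑ i ∈ s, J i) = ∑ i ∈ s, cols (J i) :=
  map_sum (AddMonoidHom.mk' cols cols_add) J s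

theorem sum_smul_single (h : Euc p) : ∑ i, h i • EuclideanSpace.single i (1 : ℝ) = h := by
  ext j; simp [Finset.sum_apply, Pi.single_apply]

theorem colEval_cols (J : Euc p →L[ℝ] Euc q) (h : Euc p) : colEval h (cols J) = J h := by
  conv_rhs => rw [← sum_smul_single h, map_sum]
  simp [colEval, cols]

theorem colAdj_cols (J : Euc p →L[ℝ] Euc q) (w : Euc q) :
    colAdj (cols J) w = ContinuousLinearMap.adjoint J w := by
  ext i
  have : (ContinuousLinearMap.adjoint J w) i
      = ⟪EuclideanSpace.single i (1 : ℝ), ContinuousLinearMap.adjoint J w⟫ := by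
    simp [EuclideanSpace.inner_single_left]
  rw [this, ContinuousLinearMap.adjoint_inner_right]; rfl

theorem inner_colAdj (A : Cols p q) (w : Euc q) (h : Euc p) :
    ⟪colAdj A w, h⟫ = ⟪w, colEval h A⟫ := by
  simp only [colEval, sum_apply, inner_sum, smul_apply, inner_smul_right, PiLp.proj_apply]
  rw [PiLp.inner_apply]
  exact Finset.sum_congr rfl fun i _ => by
    rw [real_inner_comm (A i) w]; rfl

theorem colAdj_sub_left (A A' : Cols p q) (w : Euc q) :
    colAdj (A - A') w = colAdj A w - colAdj A' w := by
  ext i; simp [colAdj, inner_sub_left]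

theorem colAdj_sub_right (A : Cols p q) (w w' : Euc q) :
    colAdj A (w - w') = colAdj A w - colAdj A w' := by
  ext i; simp [colAdj, inner_sub_right]

theorem norm_colAdj_le (A : Cols p q) (w : Euc q) : ‖colAdj A w‖ ≤ ‖A‖ * ‖w‖ := by
  refine le_of_sq_le_sq ?_ (by positivity)
  rw [mul_pow, PiLp.norm_sq_eq_of_L2, PiLp.norm_sq_eq_of_L2, Finset.sum_mul]
  refine Finset.sum_le_sum fun i _ => ?_
  rw [← mul_pow]
  exact pow_le_pow_left₀ (norm_nonneg _) (norm_inner_le_norm _ _) 2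

/-- A map and its adjoint have the same operator norm. Unlike `norm_colAdj_le`, this keeps an
operator-norm constant, as needed for `MF`, which does not control the Frobenius norm without a
dimension factor. -/
theorem norm_colAdj_le_of_colEval {A : Cols p q} {M : ℝ} (hM : 0 ≤ M)
    (hA : ∀ h, ‖colEval h A‖ ≤ M * ‖h‖) (w : Euc q) : ‖colAdj A w‖ ≤ M * ‖w‖ := by
  have h1 : ‖colAdj A w‖ ^ 2 ≤ ‖w‖ * (M * ‖colAdj A w‖) := by
    rw [← real_inner_self_eq_norm_sq, inner_colAdj]
    exact (real_inner_le_norm _ _).trans (mul_le_mul_of_nonneg_left (hA _) (norm_nonneg _))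
  rcases (norm_nonneg (colAdj A w)).eq_or_lt with h | h
  · rw [← h]; positivity
  · refine le_of_mul_le_mul_right ?_ h
    nlinarith

theorem measurable_colAdj : Measurable fun z : Cols p q × Euc q => colAdj z.1 z.2 := by
  refine (WithLp.measurable_toLp 2 (Fin p → ℝ)).comp (measurable_pi_lambda _ fun i => ?_)
  have h1 : Measurable fun z : Cols p q × Euc q => z.1 i := by fun_prop
  exact h1.inner measurable_snd

end Cols

/-! ### Jensen's inequality for squares of nonnegative functions. -/

theorem ofReal_norm_sq {E : Type*} [NormedAddCommGroup E] (x : E) :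
    ENNReal.ofReal (‖x‖ ^ 2) = ‖x‖ₑ ^ 2 := by
  rw [ENNReal.ofReal_pow (norm_nonneg _), ofReal_norm]

theorem sq_lintegral_le {α : Type*} [MeasurableSpace α] {ν : Measure α} [IsProbabilityMeasure ν]
    {f : α → ENNReal} (hf : AEMeasurable f ν) : (∫⁻ x, f x ∂ν) ^ 2 ≤ ∫⁻ x, f x ^ 2 ∂ν := by
  have h := ENNReal.lintegral_mul_le_Lp_mul_Lq ν (Real.HolderConjugate.two_two) hf
    (aemeasurable_const (b := (1 : ENNReal)))
  simp only [Pi.mul_apply, mul_one, ENNReal.one_rpow, lintegral_const, measure_univ] at h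
  calc (∫⁻ x, f x ∂ν) ^ 2 ≤ ((∫⁻ x, f x ^ (2 : ℝ) ∂ν) ^ (1 / 2 : ℝ)) ^ 2 := by gcongr
    _ = ∫⁻ x, f x ^ 2 ∂ν := by
      rw [← ENNReal.rpow_natCast, ← ENNReal.rpow_mul]
      simp

theorem lintegral_le_of_sq_le {α : Type*} [MeasurableSpace α] {ν : Measure α}
    [IsProbabilityMeasure ν] {f : α → ENNReal} (hf : AEMeasurable f ν) {c : ℝ} (hc : 0 ≤ c)
    (h : ∫⁻ x, f x ^ 2 ∂ν ≤ ENNReal.ofReal (c ^ 2)) : ∫⁻ x, f x ∂ν ≤ ENNReal.ofReal c := by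
  have h1 := (sq_lintegral_le hf).trans h
  rw [ENNReal.ofReal_pow hc] at h1
  exact (ENNReal.pow_le_pow_left_iff two_ne_zero).1 h1

/-! ### Moments, increments and first-order expansion of the expectation. -/

namespace MinimaxData

variable {p n q : ℕ} {Ξ : Type*} [MeasurableSpace Ξ] {D : MinimaxData p n q Ξ}
  {LF σF σJ MF Mψ γ : ℝ}

/-- The columns of the expected Jacobian `E F'(x, ξ)`. Its action on directions that are not
tangent to `dom R` may differ from that of the Jacobian of the expectation. -/
def meanCols (D : MinimaxData p n q Ξ) (x : Euc p) : Cols p q := ∫ ξ, cols (D.jac x ξ) ∂D.law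

theorem hasFDerivAt_F (hD : D.Standing) (ξ : Ξ) (x : Euc p) :
    HasFDerivAt (fun z => D.F z ξ) (D.jac x ξ) x := (hD.diff_F ξ x).hasFDerivAt

theorem measurable_F (hD : D.Standing) : Measurable fun z : Euc p × Ξ => D.F z.1 z.2 :=
  (stronglyMeasurable_uncurry_of_continuous_of_stronglyMeasurable (u := D.F)
    (fun ξ => (hD.diff_F ξ).continuous) fun x => (hD.meas_F x).stronglyMeasurable).measurable

/-- A directional derivative is the pointwise limit of the jointly measurable difference quotients
with increments `e / k`. -/
theorem measurable_jac_apply (hD : D.Standing) (e : Euc p) :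
    Measurable fun z : Euc p × Ξ => D.jac z.1 z.2 e := by
  refine measurable_of_tendsto_metrizable
    (f := fun (k : ℕ) (z : Euc p × Ξ) =>
      (k : ℝ) • (D.F (z.1 + (k : ℝ)⁻¹ • e) z.2 - D.F z.1 z.2)) (fun k => ?_) ?_
  · have h1 : Measurable fun z : Euc p × Ξ => D.F (z.1 + (k : ℝ)⁻¹ • e) z.2 :=
      (measurable_F hD).comp ((measurable_fst.add_const _).prodMk measurable_snd)
    exact (h1.sub (measurable_F hD)).const_smul (k : ℝ)
  · rw [tendsto_pi_nhds]
    intro z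
    exact ((hasFDerivAt_F hD z.2 z.1).lim_real e).comp tendsto_natCast_atTop_atTop

theorem measurable_cols_jac (hD : D.Standing) :
    Measurable fun z : Euc p × Ξ => cols (D.jac z.1 z.2) :=
  (WithLp.measurable_toLp 2 (Fin p → Euc q)).comp
    (measurable_pi_lambda _ fun _ => measurable_jac_apply hD _)

theorem memLp_F (hD : D.Standing) (hF : D.AssumptionF LF σF σJ MF) {x : Euc p}
    (hx : x ∈ effDom D.R) : MemLp (D.F x) 2 D.law := by
  have := hD.prob
  have h : MemLp (fun ξ => D.F x ξ - D.meanF x) 2 D.law :=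
    memLp_two_of_lintegral_le ((hD.meas_F x).sub_const _).aestronglyMeasurable (hF.var_F x hx)
  simpa [Pi.add_def] using h.add (memLp_const (D.meanF x))

theorem memLp_cols_jac (hD : D.Standing) (hF : D.AssumptionF LF σF σJ MF) {x : Euc p}
    (hx : x ∈ effDom D.R) : MemLp (fun ξ => cols (D.jac x ξ)) 2 D.law := by
  have := hD.prob
  have hm : Measurable fun ξ => cols (D.jac x ξ) :=
    (measurable_cols_jac hD).comp measurable_prodMk_left
  have h : MemLp (fun ξ => cols (D.jac x ξ) - cols (D.meanJac x)) 2 D.law :=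
    memLp_two_of_lintegral_le (c := σJ ^ 2) (hm.sub_const _).aestronglyMeasurable (by
      simp_rw [← cols_sub, norm_cols_sq]; exact hF.var_J x hx)
  simpa [Pi.add_def] using h.add (memLp_const (cols (D.meanJac x)))

theorem variance_F_le (hD : D.Standing) (hF : D.AssumptionF LF σF σJ MF) {x : Euc p}
    (hx : x ∈ effDom D.R) : ∫ ξ, ‖D.F x ξ - D.meanF x‖ ^ 2 ∂D.law ≤ σF ^ 2 := by
  have := hD.prob
  have h : MemLp (fun ξ => D.F x ξ - D.meanF x) 2 D.law :=
    (memLp_F hD hF hx).sub (memLp_const _)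
  have h1 := hF.var_F x hx
  rw [← integral_norm_sq_eq_lintegral h] at h1
  exact (ENNReal.ofReal_le_ofReal_iff (by positivity)).1 h1

/-- The assumption bounds the deviation from `meanJac`, which need not be the mean of the random
Jacobians. Centering at the true mean can only decrease the second moment, so the constant `σJ`
survives. -/
theorem variance_cols_le (hD : D.Standing) (hF : D.AssumptionF LF σF σJ MF) {x : Euc p}
    (hx : x ∈ effDom D.R) :
    ∫ ξ, ‖cols (D.jac x ξ) - D.meanCols x‖ ^ 2 ∂D.law ≤ σJ ^ 2 := by
  have := hD.prob
  have h0 := memLp_cols_jac hD hF hx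
  refine (integral_norm_sub_mean_sq_le h0 (cols (D.meanJac x))).trans ?_
  have h : MemLp (fun ξ => cols (D.jac x ξ) - cols (D.meanJac x)) 2 D.law :=
    h0.sub (memLp_const _)
  have h1 := hF.var_J x hx
  simp_rw [← norm_cols_sq, cols_sub] at h1
  rw [← integral_norm_sq_eq_lintegral h] at h1
  exact (ENNReal.ofReal_le_ofReal_iff (by positivity)).1 h1

theorem second_moment_cols_sub_le (hD : D.Standing) (hF : D.AssumptionF LF σF σJ MF) {x y : Euc p}
    (hx : x ∈ effDom D.R) (hy : y ∈ effDom D.R) :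
    ∫ ξ, ‖cols (D.jac x ξ) - cols (D.jac y ξ)‖ ^ 2 ∂D.law ≤ LF ^ 2 * ‖x - y‖ ^ 2 := by
  have := hD.prob
  have h : MemLp (fun ξ => cols (D.jac x ξ) - cols (D.jac y ξ)) 2 D.law :=
    (memLp_cols_jac hD hF hx).sub (memLp_cols_jac hD hF hy)
  have h1 := hF.smooth x hx y hy
  simp_rw [← norm_cols_sq, cols_sub] at h1
  rw [← integral_norm_sq_eq_lintegral h] at h1
  exact (ENNReal.ofReal_le_ofReal_iff (by positivity)).1 h1

theorem lintegral_jac_apply_sq_le (hF : D.AssumptionF LF σF σJ MF)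
    {x : Euc p} (hx : x ∈ effDom D.R) (h : Euc p) :
    ∫⁻ ξ, ‖D.jac x ξ h‖ₑ ^ 2 ∂D.law ≤ ENNReal.ofReal ((MF * ‖h‖) ^ 2) := by
  calc ∫⁻ ξ, ‖D.jac x ξ h‖ₑ ^ 2 ∂D.law
      ≤ ∫⁻ ξ, ENNReal.ofReal (‖D.jac x ξ‖ ^ 2) * ENNReal.ofReal (‖h‖ ^ 2) ∂D.law := by
        refine lintegral_mono fun ξ => ?_
        rw [← ofReal_norm_sq, ← ENNReal.ofReal_mul (by positivity), ← mul_pow]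
        exact ENNReal.ofReal_le_ofReal
          (pow_le_pow_left₀ (norm_nonneg _) ((D.jac x ξ).le_opNorm h) 2)
    _ ≤ ENNReal.ofReal ((MF * ‖h‖) ^ 2) := by
        rw [lintegral_mul_const' _ _ ENNReal.ofReal_ne_top, mul_pow,
          ENNReal.ofReal_mul (by positivity)]
        gcongr
        exact hF.lip x hx

theorem lintegral_jac_sub_apply_le (hD : D.Standing) (hF : D.AssumptionF LF σF σJ MF)
    {x y : Euc p} (hx : x ∈ effDom D.R) (hy : y ∈ effDom D.R) (h : Euc p) :
    ∫⁻ ξ, ‖D.jac x ξ h - D.jac y ξ h‖ₑ ∂D.law ≤ ENNReal.ofReal (LF * ‖x - y‖ * ‖h‖) := by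
  have := hD.prob
  have hL := hF.LF_pos
  have hm : ∀ x, Measurable fun ξ => D.jac x ξ h := fun x =>
    (measurable_jac_apply hD h).comp measurable_prodMk_left
  refine lintegral_le_of_sq_le ((hm x).sub (hm y)).enorm.aemeasurable (by positivity) ?_
  calc ∫⁻ ξ, ‖D.jac x ξ h - D.jac y ξ h‖ₑ ^ 2 ∂D.law
      ≤ ∫⁻ ξ, ENNReal.ofReal (frobSq (D.jac x ξ - D.jac y ξ)) * ENNReal.ofReal (‖h‖ ^ 2)
          ∂D.law := by
        refine lintegral_mono fun ξ => ?_
        rw [← ofReal_norm_sq, ← ENNReal.ofReal_mul (by rw [← norm_cols_sq]; positivity)]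
        refine ENNReal.ofReal_le_ofReal ?_
        set J := D.jac x ξ - D.jac y ξ with hJ
        have h1 : D.jac x ξ h - D.jac y ξ h = J h := rfl
        rw [h1, ← norm_cols_sq, ← mul_pow]
        refine pow_le_pow_left₀ (norm_nonneg _) ?_ 2
        -- The operator norm is at most the Frobenius norm; passing to the adjoint reduces this to
        -- Cauchy–Schwarz on each column.
        have h2 : ‖J‖ ≤ ‖cols J‖ := by
          rw [← (ContinuousLinearMap.adjoint (𝕜 := ℝ) (E := Euc p) (F := Euc q)).norm_map J]
          refine ContinuousLinearMap.opNorm_le_bound _ (norm_nonneg _) fun w => ?_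
          rw [← colAdj_cols]; exact norm_colAdj_le _ _
        exact (J.le_opNorm h).trans (mul_le_mul_of_nonneg_right h2 (norm_nonneg _))
    _ ≤ ENNReal.ofReal ((LF * ‖x - y‖ * ‖h‖) ^ 2) := by
        rw [lintegral_mul_const' _ _ ENNReal.ofReal_ne_top, mul_pow, mul_pow,
          ENNReal.ofReal_mul (by positivity)]
        gcongr
        exact hF.smooth x hx y hy

theorem segment_mem (hD : D.Standing) {x h : Euc p} (hx : x ∈ effDom D.R)
    (hy : x + h ∈ effDom D.R) {t : ℝ} (ht : t ∈ Set.Icc (0 : ℝ) 1) :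
    x + t • h ∈ effDom D.R := by
  have := hD.R_pcc.convexOn.1 hx hy (by linarith [ht.2] : (0 : ℝ) ≤ 1 - t) ht.1 (by ring)
  convert this using 1; module

theorem measurable_jac_segment (hD : D.Standing) (x h : Euc p) :
    Measurable fun z : Ξ × ℝ => D.jac (x + z.2 • h) z.1 h :=
  (measurable_jac_apply hD h).comp
    ((measurable_const.add (measurable_snd.smul_const h)).prodMk measurable_fst)

/-- No Lipschitz bound is available for a single sample. The increment is integrated along the
segment, which stays in the convex set `dom R`; Jensen's inequality in the segment parameter and
Tonelli's theorem then allow the moment bound on the Jacobian to be used at each point of the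
segment. -/
theorem second_moment_F_sub_le (hD : D.Standing) (hF : D.AssumptionF LF σF σJ MF) {x y : Euc p}
    (hx : x ∈ effDom D.R) (hy : y ∈ effDom D.R) :
    ∫ ξ, ‖D.F x ξ - D.F y ξ‖ ^ 2 ∂D.law ≤ MF ^ 2 * ‖x - y‖ ^ 2 := by
  have := hD.prob
  have hL2 : MemLp (fun ξ => D.F x ξ - D.F y ξ) 2 D.law :=
    (memLp_F hD hF hx).sub (memLp_F hD hF hy)
  refine (ENNReal.ofReal_le_ofReal_iff (by positivity)).1 ?_
  rw [integral_norm_sq_eq_lintegral hL2]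
  obtain ⟨h, rfl⟩ : ∃ h, x = y + h := ⟨x - y, by abel⟩
  have hprob : IsProbabilityMeasure (volume.restrict (Set.Icc (0 : ℝ) 1)) := ⟨by simp⟩
  have hm := measurable_jac_segment hD y h
  calc ∫⁻ ξ, ENNReal.ofReal (‖D.F (y + h) ξ - D.F y ξ‖ ^ 2) ∂D.law
      ≤ ∫⁻ ξ, (∫⁻ t in Set.Icc (0 : ℝ) 1, ‖D.jac (y + t • h) ξ h‖ₑ ^ 2) ∂D.law := by
        refine lintegral_mono fun ξ => ?_
        have hc : ∀ t : ℝ, HasDerivAt (fun t : ℝ => D.F (y + t • h) ξ)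
            (D.jac (y + t • h) ξ h) t := fun t =>
          (hasFDerivAt_F hD ξ _).comp_hasDerivAt t
            (by simpa using ((hasDerivAt_id t).smul_const h).const_add y)
        have h1 := enorm_sub_le_lintegral_deriv hc
        simp only [one_smul, zero_smul, add_zero] at h1
        rw [ofReal_norm_sq]
        refine (pow_le_pow_left' h1 2).trans (sq_lintegral_le ?_)
        exact (hm.comp measurable_prodMk_left).enorm.aemeasurable
    _ = ∫⁻ t in Set.Icc (0 : ℝ) 1, ∫⁻ ξ, ‖D.jac (y + t • h) ξ h‖ₑ ^ 2 ∂D.law :=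
        lintegral_lintegral_swap (hm.enorm.pow_const 2).aemeasurable
    _ ≤ ∫⁻ t in Set.Icc (0 : ℝ) 1, ENNReal.ofReal ((MF * ‖h‖) ^ 2) :=
        setLIntegral_mono measurable_const fun t ht =>
          lintegral_jac_apply_sq_le hF (segment_mem hD hy hx ht) h
    _ = ENNReal.ofReal (MF ^ 2 * ‖y + h - y‖ ^ 2) := by simp [mul_pow]

theorem meanF_sub (hD : D.Standing) (hF : D.AssumptionF LF σF σJ MF) {x y : Euc p}
    (hx : x ∈ effDom D.R) (hy : y ∈ effDom D.R) :
    D.meanF x - D.meanF y = ∫ ξ, (D.F x ξ - D.F y ξ) ∂D.law := by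
  have := hD.prob
  exact (integral_sub ((memLp_F hD hF hx).integrable one_le_two)
    ((memLp_F hD hF hy).integrable one_le_two)).symm

theorem norm_integral_le_of_sq {Ω E : Type*} [MeasurableSpace Ω] {μ : Measure Ω}
    [IsProbabilityMeasure μ] [NormedAddCommGroup E] [NormedSpace ℝ E] {Z : Ω → E}
    (hZ : AEStronglyMeasurable Z μ) {c : ℝ} (hc : 0 ≤ c)
    (h : ∫⁻ ω, ‖Z ω‖ₑ ^ 2 ∂μ ≤ ENNReal.ofReal (c ^ 2)) : ‖∫ ω, Z ω ∂μ‖ ≤ c := by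
  have h1 := (enorm_integral_le_lintegral_enorm Z).trans (lintegral_le_of_sq_le hZ.enorm hc h)
  rw [← ofReal_norm] at h1
  exact (ENNReal.ofReal_le_ofReal_iff hc).1 h1

theorem norm_meanF_sub_le (hD : D.Standing) (hF : D.AssumptionF LF σF σJ MF) {x y : Euc p}
    (hx : x ∈ effDom D.R) (hy : y ∈ effDom D.R) :
    ‖D.meanF x - D.meanF y‖ ≤ MF * ‖x - y‖ := by
  have := hD.prob
  have hM := hF.MF_pos
  have hL2 : MemLp (fun ξ => D.F x ξ - D.F y ξ) 2 D.law :=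
    (memLp_F hD hF hx).sub (memLp_F hD hF hy)
  rw [meanF_sub hD hF hx hy]
  refine norm_integral_le_of_sq hL2.1 (by positivity) ?_
  simp_rw [← ofReal_norm_sq]
  rw [← integral_norm_sq_eq_lintegral hL2, mul_pow]
  exact ENNReal.ofReal_le_ofReal (second_moment_F_sub_le hD hF hx hy)

theorem colEval_meanCols (hD : D.Standing) (hF : D.AssumptionF LF σF σJ MF) {x : Euc p}
    (hx : x ∈ effDom D.R) (h : Euc p) :
    colEval h (D.meanCols x) = ∫ ξ, D.jac x ξ h ∂D.law := by
  have := hD.prob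
  rw [meanCols, ← ContinuousLinearMap.integral_comp_comm _
    ((memLp_cols_jac hD hF hx).integrable one_le_two)]
  simp_rw [colEval_cols]

theorem norm_colEval_meanCols_le (hD : D.Standing) (hF : D.AssumptionF LF σF σJ MF) {x : Euc p}
    (hx : x ∈ effDom D.R) (h : Euc p) : ‖colEval h (D.meanCols x)‖ ≤ MF * ‖h‖ := by
  have := hD.prob
  have hM := hF.MF_pos
  rw [colEval_meanCols hD hF hx]
  refine norm_integral_le_of_sq ?_ (by positivity) (lintegral_jac_apply_sq_le hF hx h)
  exact ((measurable_jac_apply hD h).comp measurable_prodMk_left).aestronglyMeasurable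

/-- First-order expansion of the expectation on the domain of `R`, with the expected Jacobian. -/
theorem norm_meanF_taylor_le (hD : D.Standing) (hF : D.AssumptionF LF σF σJ MF) {x y : Euc p}
    (hx : x ∈ effDom D.R) (hy : y ∈ effDom D.R) :
    ‖D.meanF y - D.meanF x - colEval (y - x) (D.meanCols x)‖ ≤ LF / 2 * ‖y - x‖ ^ 2 := by
  have := hD.prob
  have hL := hF.LF_pos
  obtain ⟨h, rfl⟩ : ∃ h, y = x + h := ⟨y - x, by abel⟩
  have hm := measurable_jac_segment hD x h
  have hm0 : Measurable fun ξ => D.jac x ξ h :=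
    (measurable_jac_apply hD h).comp measurable_prodMk_left
  rw [add_sub_cancel_left, meanF_sub hD hF hy hx, colEval_meanCols hD hF hx, ← integral_sub]
  rotate_left
  · exact ((memLp_F hD hF hy).sub (memLp_F hD hF hx)).integrable one_le_two
  · simpa only [colEval_cols] using
      (colEval h).integrable_comp ((memLp_cols_jac hD hF hx).integrable one_le_two)
  refine (ENNReal.ofReal_le_ofReal_iff (by positivity)).1 ?_
  rw [ofReal_norm]
  refine (enorm_integral_le_lintegral_enorm _).trans ?_
  have hm2 : Measurable fun z : Ξ × ℝ => ‖D.jac (x + z.2 • h) z.1 h - D.jac x z.1 h‖ₑ :=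
    (hm.sub (hm0.comp measurable_fst)).enorm
  calc ∫⁻ ξ, ‖D.F (x + h) ξ - D.F x ξ - D.jac x ξ h‖ₑ ∂D.law
      ≤ ∫⁻ ξ, (∫⁻ t in Set.Icc (0 : ℝ) 1, ‖D.jac (x + t • h) ξ h - D.jac x ξ h‖ₑ) ∂D.law := by
        refine lintegral_mono fun ξ => ?_
        -- With the linear part subtracted, the velocity of the curve is an increment of the
        -- Jacobian. Its mean is of order `t`, and integrating `t` over the unit interval gives the
        -- factor `1 / 2`.
        have hc : ∀ t : ℝ, HasDerivAt (fun t : ℝ => D.F (x + t • h) ξ - t • D.jac x ξ h)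
            (D.jac (x + t • h) ξ h - D.jac x ξ h) t := fun t =>
          ((hasFDerivAt_F hD ξ _).comp_hasDerivAt t
            (by simpa using ((hasDerivAt_id t).smul_const h).const_add x)).sub
            (by simpa using (hasDerivAt_id t).smul_const (D.jac x ξ h))
        have h1 := enorm_sub_le_lintegral_deriv hc
        simp only [one_smul, zero_smul, add_zero, sub_zero] at h1
        convert h1 using 2
        abel
    _ = ∫⁻ t in Set.Icc (0 : ℝ) 1, ∫⁻ ξ, ‖D.jac (x + t • h) ξ h - D.jac x ξ h‖ₑ ∂D.law :=
        lintegral_lintegral_swap hm2.aemeasurable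
    _ ≤ ∫⁻ t in Set.Icc (0 : ℝ) 1, ENNReal.ofReal (LF * ‖h‖ ^ 2 * t) := by
        refine setLIntegral_mono (by fun_prop) fun t ht => ?_
        refine (lintegral_jac_sub_apply_le hD hF (segment_mem hD hx hy ht) hx h).trans_eq ?_
        rw [add_sub_cancel_left, norm_smul, Real.norm_of_nonneg ht.1]
        congr 1; ring
    _ = ENNReal.ofReal (LF / 2 * ‖h‖ ^ 2) := by
        rw [← ofReal_integral_eq_lintegral_ofReal
          (Continuous.integrableOn_Icc (by fun_prop))
          ((ae_restrict_iff' measurableSet_Icc).2 (Filter.Eventually.of_forall fun t ht =>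
            mul_nonneg (by positivity) ht.1)),
          integral_Icc_eq_integral_Ioc, ← intervalIntegral.integral_of_le zero_le_one,
          intervalIntegral.integral_const_mul, integral_id]
        congr 1; ring

/-- On directions tangent to the domain of `R`, the Jacobian of the expectation is the expected
Jacobian. -/
theorem meanJac_apply_sub (hD : D.Standing) (hF : D.AssumptionF LF σF σJ MF) {x y : Euc p}
    (hx : x ∈ effDom D.R) (hy : y ∈ effDom D.R) :
    D.meanJac x (y - x) = colEval (y - x) (D.meanCols x) := by
  obtain ⟨h, rfl⟩ : ∃ h, y = x + h := ⟨y - x, by abel⟩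
  rw [add_sub_cancel_left]
  -- Both sides are limits of the same difference quotients with increments `h / k`. For `k ≥ 1` the
  -- points `x + h / k` lie in `dom R`, so the expansion with the expected Jacobian applies to them.
  have h1 := ((hD.diff_meanF x hx).hasFDerivAt.lim_real h).comp
    (tendsto_natCast_atTop_atTop (R := ℝ))
  refine tendsto_nhds_unique h1 ?_
  rw [tendsto_iff_norm_sub_tendsto_zero]
  refine squeeze_zero' (g := fun k : ℕ => LF / 2 * ‖h‖ ^ 2 * (k : ℝ)⁻¹)
    (Filter.Eventually.of_forall fun _ => norm_nonneg _) ?_ ?_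
  · filter_upwards [Filter.eventually_ge_atTop 1] with k hk
    have hk0 : (0 : ℝ) < k := by exact_mod_cast hk
    have hk1 : (k : ℝ)⁻¹ ∈ Set.Icc (0 : ℝ) 1 :=
      ⟨by positivity, inv_le_one_of_one_le₀ (by exact_mod_cast hk)⟩
    have h2 := norm_meanF_taylor_le hD hF hx (segment_mem hD hx hy hk1)
    rw [add_sub_cancel_left] at h2
    have h3 : colEval ((k : ℝ)⁻¹ • h) (D.meanCols x)
        = (k : ℝ)⁻¹ • colEval h (D.meanCols x) := by
      simp [colEval, Finset.smul_sum, smul_smul]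
    rw [h3] at h2
    have h4 : (k : ℝ) • (D.meanF (x + (k : ℝ)⁻¹ • h) - D.meanF x) - colEval h (D.meanCols x)
        = (k : ℝ) • (D.meanF (x + (k : ℝ)⁻¹ • h) - D.meanF x
          - (k : ℝ)⁻¹ • colEval h (D.meanCols x)) := by
      rw [smul_sub _ _ ((k : ℝ)⁻¹ • _), smul_smul, mul_inv_cancel₀ hk0.ne', one_smul]
    simp only [Function.comp_apply]
    rw [h4, norm_smul, Real.norm_of_nonneg hk0.le]
    rw [norm_smul, Real.norm_of_nonneg hk1.1] at h2
    calc _ ≤ (k : ℝ) * (LF / 2 * ((k : ℝ)⁻¹ * ‖h‖) ^ 2) := by gcongr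
      _ = _ := by field_simp
  · simpa using (tendsto_inv_atTop_nhds_zero_nat (𝕜 := ℝ)).const_mul (LF / 2 * ‖h‖ ^ 2)

theorem measurable_meanF (hD : D.Standing) : Measurable D.meanF := by
  have := hD.prob
  exact (measurable_F hD).stronglyMeasurable.integral_prod_right'.measurable

theorem measurable_meanCols (hD : D.Standing) : Measurable D.meanCols := by
  have := hD.prob
  exact (measurable_cols_jac hD).stronglyMeasurable.integral_prod_right'.measurable

end MinimaxData

/-! ### Descent of the smoothed objective -/

namespace MinimaxData

variable {p n q : ℕ} {Ξ : Type*} [MeasurableSpace Ξ] {D : MinimaxData p n q Ξ}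
  {LF σF σJ MF Mψ γ η θ : ℝ}

/-- The smoothed objective `Ψ_γ = Φ_γ + R` on the domain of `R`. -/
def PsiS (D : MinimaxData p n q Ξ) (γ : ℝ) (x : Euc p) : ℝ := D.Phi γ x + (D.R x).toReal

/-- The estimator `v = J̃ᵀ K y_γ^*(F̃)`, for `J̃` given by its columns. -/
def gradEst (D : MinimaxData p n q Ξ) (γ : ℝ) (A : Cols p q) (u : Euc q) : Euc p :=
  colAdj A (D.K (D.dualSol γ u))

/-- The gradient of `Φ_γ`, up to a component orthogonal to the domain of `R`. -/
def tanGrad (D : MinimaxData p n q Ξ) (γ : ℝ) (x : Euc p) : Euc p :=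
  D.gradEst γ (D.meanCols x) (D.meanF x)

/-- The next iterate. -/
def nextPt (D : MinimaxData p n q Ξ) (γ η θ : ℝ) (x : Euc p) (A : Cols p q) (u : Euc q) : Euc p :=
  (1 - θ) • x + θ • proxOp η D.R (x - η • D.gradEst γ A u)

theorem constL_pos (hK : D.K ≠ 0) (hF : D.AssumptionF LF σF σJ MF) (hψ : D.AssumptionPsi Mψ)
    (hγ : 0 < γ) : 0 < D.constL γ MF LF Mψ := by
  have h1 := hF.LF_pos
  have h2 := hF.MF_pos
  have h3 := hψ.Mψ_pos
  have h4 : 0 < ‖D.K‖ := norm_pos_iff.2 hK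
  unfold constL; positivity

/-- The two summands of `constL` have different sources: `LF * Mψ * ‖K‖` bounds the Taylor remainder
of the inner map paired with the dual vector, and `MF² ‖K‖² / γ` is the curvature of `phi γ` times
the squared Lipschitz constant of the inner map. -/
theorem Phi_le_quadratic (hD : D.Standing) (hF : D.AssumptionF LF σF σJ MF)
    (hψ : D.AssumptionPsi Mψ) (hγ : 0 < γ) {x y : Euc p}
    (hx : x ∈ effDom D.R) (hy : y ∈ effDom D.R) :
    D.Phi γ y ≤ D.Phi γ x + ⟪D.tanGrad γ x, y - x⟫
      + D.constL γ MF LF Mψ / 2 * ‖y - x‖ ^ 2 := by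
  have h1 := phi_upper hD hψ hγ (D.meanF x) (D.meanF y)
  have h2 := norm_meanF_sub_le hD hF hy hx
  have h3 := norm_meanF_taylor_le hD hF hx hy
  have hw := norm_K_dualSol_le hD hψ hγ.le (D.meanF x)
  have hKM : 0 ≤ ‖D.K‖ * Mψ := mul_nonneg (norm_nonneg _) hψ.Mψ_pos.le
  unfold Phi tanGrad gradEst
  rw [inner_colAdj]
  set w := D.K (D.dualSol γ (D.meanF x))
  set e := D.meanF y - D.meanF x - colEval (y - x) (D.meanCols x) with he
  have h4 : ⟪D.meanF y - D.meanF x, w⟫ = ⟪w, colEval (y - x) (D.meanCols x)⟫ + ⟪w, e⟫ := by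
    rw [← inner_add_right, real_inner_comm, he]; congr 1; abel
  have h5 : ⟪w, e⟫ ≤ ‖D.K‖ * Mψ * (LF / 2 * ‖y - x‖ ^ 2) :=
    (real_inner_le_norm _ _).trans (mul_le_mul hw h3 (norm_nonneg _) hKM)
  have h6 : ‖D.meanF y - D.meanF x‖ ^ 2 ≤ (MF * ‖y - x‖) ^ 2 :=
    pow_le_pow_left₀ (norm_nonneg _) h2 2
  have h7 := mul_le_mul_of_nonneg_left h6 (by positivity : 0 ≤ ‖D.K‖ ^ 2 / (2 * γ))
  have h8 : D.constL γ MF LF Mψ / 2 * ‖y - x‖ ^ 2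
      = ‖D.K‖ * Mψ * (LF / 2 * ‖y - x‖ ^ 2) + ‖D.K‖ ^ 2 / (2 * γ) * (MF * ‖y - x‖) ^ 2 := by
    unfold constL; field_simp
  linarith

theorem hasFDerivAt_Phi (hD : D.Standing) (hψ : D.AssumptionPsi Mψ) (hγ : 0 < γ) {x : Euc p}
    (hx : x ∈ effDom D.R) :
    HasFDerivAt (D.Phi γ)
      ((innerSL ℝ (D.K (D.dualSol γ (D.meanF x)))).comp (D.meanJac x)) x :=
  (hasGradientAt_phi hD hψ hγ (D.meanF x)).hasFDerivAt.comp x (hD.diff_meanF x hx).hasFDerivAt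

/-- The chain rule produces `meanJac`, while the estimators approximate `meanCols`. The two agree
along `y - x`, so the resulting gradients differ by a vector orthogonal to `dom R`. -/
theorem inner_gradient_sub_tanGrad (hD : D.Standing) (hF : D.AssumptionF LF σF σJ MF)
    (hψ : D.AssumptionPsi Mψ) (hγ : 0 < γ) {x y : Euc p}
    (hx : x ∈ effDom D.R) (hy : y ∈ effDom D.R) :
    ⟪gradient (D.Phi γ) x - D.tanGrad γ x, y - x⟫ = 0 := by
  rw [inner_sub_left, tanGrad, gradEst, inner_colAdj, gradient,
    InnerProductSpace.toDual_symm_apply, (hasFDerivAt_Phi hD hψ hγ hx).fderiv,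
    ← meanJac_apply_sub hD hF hx hy]
  simp

/-- The orthogonal discrepancy between the two gradients is invisible to the proximal operator. From
here on the true gradient can be replaced by `tanGrad`, which is measurable and is the target of the
estimators. -/
theorem gradMap_eq (hD : D.Standing) (hF : D.AssumptionF LF σF σJ MF)
    (hψ : D.AssumptionPsi Mψ) (hγ : 0 < γ) (hη : 0 < η) {x : Euc p} (hx : x ∈ effDom D.R) :
    D.gradMap γ η x = η⁻¹ • (x - proxOp η D.R (x - η • D.tanGrad γ x)) := by
  rw [gradMap, hD.R_pcc.proxOp_eq_of_inner_eq_zero hη (x := x)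
    (w := x - η • D.tanGrad γ x)]
  intro y hy
  have : x - η • gradient (D.Phi γ) x - (x - η • D.tanGrad γ x)
      = (-η) • (gradient (D.Phi γ) x - D.tanGrad γ x) := by module
  rw [this, inner_smul_left, inner_gradient_sub_tanGrad hD hF hψ hγ hx hy, mul_zero]

/-- Weighted squared error of the estimators at `x`. -/
def estErr (D : MinimaxData p n q Ξ) (γ MF Mψ : ℝ) (x : Euc p) (A : Cols p q) (u : Euc q) : ℝ :=
  ‖D.K‖ ^ 2 * Mψ ^ 2 * ‖A - D.meanCols x‖ ^ 2
    + MF ^ 2 * ‖D.K‖ ^ 4 / γ ^ 2 * ‖u - D.meanF x‖ ^ 2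

/-- The error splits into the Jacobian error applied to a bounded dual vector, and the exact mean
Jacobian applied to the error of the dual solution, which is Lipschitz in `u`. The factor `2` comes
from squaring a sum of two terms. -/
theorem norm_gradEst_sub_sq_le (hD : D.Standing) (hF : D.AssumptionF LF σF σJ MF)
    (hψ : D.AssumptionPsi Mψ) (hγ : 0 < γ) {x : Euc p} (hx : x ∈ effDom D.R)
    (A : Cols p q) (u : Euc q) :
    ‖D.gradEst γ A u - D.tanGrad γ x‖ ^ 2 ≤ 2 * D.estErr γ MF Mψ x A u := by
  have hM := hF.MF_pos
  have hψ0 := hψ.Mψ_pos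
  have e : D.gradEst γ A u - D.tanGrad γ x
      = colAdj (A - D.meanCols x) (D.K (D.dualSol γ u))
        + colAdj (D.meanCols x) (D.K (D.dualSol γ u - D.dualSol γ (D.meanF x))) := by
    rw [map_sub, colAdj_sub_right, colAdj_sub_left, tanGrad, gradEst, gradEst]; abel
  have h1 : ‖colAdj (A - D.meanCols x) (D.K (D.dualSol γ u))‖
      ≤ ‖A - D.meanCols x‖ * (‖D.K‖ * Mψ) :=
    (norm_colAdj_le _ _).trans
      (mul_le_mul_of_nonneg_left (norm_K_dualSol_le hD hψ hγ.le u) (norm_nonneg _))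
  have h2 : ‖colAdj (D.meanCols x) (D.K (D.dualSol γ u - D.dualSol γ (D.meanF x)))‖
      ≤ MF * (‖D.K‖ * (‖D.K‖ / γ * ‖u - D.meanF x‖)) := by
    refine (norm_colAdj_le_of_colEval hM.le (norm_colEval_meanCols_le hD hF hx) _).trans ?_
    gcongr
    refine (D.K.le_opNorm _).trans ?_
    gcongr
    exact norm_dualSol_sub_le hD hψ hγ _ _
  rw [e]
  have h3 := (norm_add_le _ _).trans (add_le_add h1 h2)
  refine (pow_le_pow_left₀ (norm_nonneg _) h3 2).trans ?_
  refine (add_sq_le).trans_eq ?_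
  unfold estErr
  field_simp

theorem nextPt_mem (hD : D.Standing) (hη : 0 < η) (hθ : 0 < θ) (hθ1 : θ ≤ 1) {x : Euc p}
    (hx : x ∈ effDom D.R) (A : Cols p q) (u : Euc q) :
    D.nextPt γ η θ x A u ∈ effDom D.R :=
  hD.R_pcc.convexOn.1 hx (hD.R_pcc.proxOp_mem hη _) (by linarith) hθ.le (by ring)

/-- One iteration decreases the smoothed objective, up to the error of the estimators. -/
theorem PsiS_nextPt_le (hD : D.Standing) (hK : D.K ≠ 0) (hF : D.AssumptionF LF σF σJ MF)
    (hψ : D.AssumptionPsi Mψ) (hγ : 0 < γ) (hθ : 0 < θ) (hθ1 : θ ≤ 1) {L : ℝ}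
    (hL : L = D.constL γ MF LF Mψ) (hη : η = 2 / (L * (3 + θ))) {x : Euc p}
    (hx : x ∈ effDom D.R) (A : Cols p q) (u : Euc q) :
    D.PsiS γ (D.nextPt γ η θ x A u) + θ / (16 * L) * ‖D.gradMap γ η x‖ ^ 2
        + L / (2 * θ) * ‖D.nextPt γ η θ x A u - x‖ ^ 2
      ≤ D.PsiS γ x + 13 * θ / (9 * L) * D.estErr γ MF Mψ x A u := by
  have hL0 : 0 < L := hL ▸ constL_pos hK hF hψ hγ
  have hη0 : 0 < η := by rw [hη]; positivity
  have hxp := nextPt_mem (γ := γ) hD hη0 hθ hθ1 hx A u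
  have hΦ := Phi_le_quadratic hD hF hψ hγ hx hxp
  rw [← hL] at hΦ
  have he := norm_gradEst_sub_sq_le hD hF hψ hγ hx A u
  have hG := gradMap_eq hD hF hψ hγ hη0 hx
  have hpm := hD.R_pcc.proxOp_mem hη0 (x - η • D.gradEst γ A u)
  have hR := hD.R_pcc.convexOn.2 hx hpm (by linarith : 0 ≤ 1 - θ) hθ.le (by ring)
  have hp := hD.R_pcc.proxOp_inner_le hη0 (x - η • D.gradEst γ A u) hx
  have hne := hD.R_pcc.norm_proxOp_sub_le hη0 (x - η • D.gradEst γ A u) (x - η • D.tanGrad γ x)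
  have hdiff : D.nextPt γ η θ x A u - x
      = θ • (proxOp η D.R (x - η • D.gradEst γ A u) - x) := by
    unfold nextPt; module
  have hxpdef : D.nextPt γ η θ x A u
      = (1 - θ) • x + θ • proxOp η D.R (x - η • D.gradEst γ A u) := rfl
  rw [← hxpdef] at hR
  simp only [smul_eq_mul] at hR
  set v := D.gradEst γ A u
  set g := D.tanGrad γ x
  set xh := proxOp η D.R (x - η • v)
  set xp := D.nextPt γ η θ x A u
  set d := ‖xh - x‖ with hd
  set e := ‖v - g‖ with hee
  -- Optimality of the proximal point, tested at the current iterate.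
  have hp' : (D.R xh).toReal + ⟪v, xh - x⟫ + d ^ 2 / η ≤ (D.R x).toReal := by
    have e1 : ⟪x - η • v - xh, x - xh⟫ = d ^ 2 + η * ⟪v, xh - x⟫ := by
      have : x - η • v - xh = -(xh - x) - η • v := by abel
      rw [this, ← neg_sub xh x, inner_neg_right, inner_sub_left, inner_neg_left,
        real_inner_self_eq_norm_sq, inner_smul_left]
      simp; ring
    rw [e1, add_div, mul_div_cancel_left₀ _ hη0.ne'] at hp
    linarith
  rw [hdiff, inner_smul_right, norm_smul, Real.norm_of_nonneg hθ.le] at hΦ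
  rw [hdiff, norm_smul, Real.norm_of_nonneg hθ.le]
  have hcs : ⟪g, xh - x⟫ - ⟪v, xh - x⟫ ≤ e * d := by
    rw [← inner_sub_left, hee, norm_sub_rev v g]; exact real_inner_le_norm _ _
  have hGn : ‖D.gradMap γ η x‖ ≤ d / η + e := by
    rw [hG, norm_smul, norm_inv, Real.norm_of_nonneg hη0.le]
    have h1 : ‖x - η • v - (x - η • g)‖ = η * e := by
      have : x - η • v - (x - η • g) = (-η) • (v - g) := by module
      rw [this, norm_smul, norm_neg, Real.norm_of_nonneg hη0.le]
    rw [h1] at hne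
    have h2 : ‖x - proxOp η D.R (x - η • g)‖ ≤ d + η * e := by
      have : x - proxOp η D.R (x - η • g) = -(xh - x) + (xh - proxOp η D.R (x - η • g)) := by abel
      rw [this]
      refine (norm_add_le _ _).trans ?_
      rw [norm_neg]; linarith
    calc η⁻¹ * ‖x - proxOp η D.R (x - η • g)‖ ≤ η⁻¹ * (d + η * e) := by gcongr
      _ = d / η + e := by field_simp
  have hηi : 1 / η = L * (3 + θ) / 2 := by rw [hη]; field_simp
  have hdη : d / η = L * (3 + θ) / 2 * d := by rw [← hηi]; ring
  have hd2η : d ^ 2 / η = L * (3 + θ) / 2 * d ^ 2 := by rw [← hηi]; ring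
  rw [hdη] at hGn
  rw [hd2η] at hp'
  have hd0 : 0 ≤ d := norm_nonneg _
  have he0 : 0 ≤ e := norm_nonneg _
  have hG2 : ‖D.gradMap γ η x‖ ^ 2 ≤ 8 * L ^ 2 * d ^ 2 + 2 * e ^ 2 := by
    -- Here `θ ≤ 1` enters through `1 / η = L (3 + θ) / 2 ≤ 2 L`.
    have h1 : ‖D.gradMap γ η x‖ ≤ 2 * L * d + e := by
      refine hGn.trans ?_
      have : L * (3 + θ) / 2 * d ≤ 2 * L * d := by
        apply mul_le_mul_of_nonneg_right _ hd0; nlinarith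
      linarith
    refine (pow_le_pow_left₀ (norm_nonneg _) h1 2).trans ?_
    nlinarith [sq_nonneg (2 * L * d - e)]
  have hG3 : θ / (16 * L) * ‖D.gradMap γ η x‖ ^ 2 ≤ θ * (L * d ^ 2 / 2 + e ^ 2 / (8 * L)) := by
    calc _ ≤ θ / (16 * L) * (8 * L ^ 2 * d ^ 2 + 2 * e ^ 2) := by gcongr
      _ = _ := by field_simp; ring
  have hed : e * d ≤ L * d ^ 2 / 2 + e ^ 2 / (2 * L) := by
    have : L * d ^ 2 / 2 + e ^ 2 / (2 * L) - e * d = (L * d - e) ^ 2 / (2 * L) := by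
      field_simp; ring
    have : 0 ≤ (L * d - e) ^ 2 / (2 * L) := by positivity
    linarith
  -- The error coefficient is `5 / 8`, doubled by the bound on `e²`. The resulting `5 / 4` is
  -- weakened to `13 / 9`, the constant behind `P` and `Q`.
  have hfin : θ * (5 / 8 * (e ^ 2 / L)) ≤ 13 * θ / (9 * L) * D.estErr γ MF Mψ x A u := by
    have h0 : 0 ≤ D.estErr γ MF Mψ x A u := by
      have := sq_nonneg e; linarith
    calc θ * (5 / 8 * (e ^ 2 / L)) ≤ θ * (5 / 8 * ((2 * D.estErr γ MF Mψ x A u) / L)) := by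
          gcongr
      _ = 5 / 4 * (θ / L * D.estErr γ MF Mψ x A u) := by ring
      _ ≤ 13 / 9 * (θ / L * D.estErr γ MF Mψ x A u) :=
        mul_le_mul_of_nonneg_right (by norm_num) (by positivity)
      _ = _ := by field_simp
  have hX : L / (2 * θ) * (θ * d) ^ 2 = θ * (L * d ^ 2 / 2) := by field_simp
  -- The `θ` inside `η` is chosen so that `d² / η` cancels the curvature term `L θ² d² / 2` exactly
  -- and leaves `3 / 2 * L d²`. Of this, three equal shares pay for Young's inequality, for the
  -- gradient mapping and for the squared step.
  have hsum : θ * (e * d) - θ * (L * (3 + θ) / 2 * d ^ 2) + L / 2 * (θ * d) ^ 2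
      ≤ θ * (L * d ^ 2 / 2 + e ^ 2 / (2 * L)) - θ * (3 / 2 * L * d ^ 2) := by
    have h1 := mul_le_mul_of_nonneg_left hed hθ.le
    have h2 : θ * (L * (3 + θ) / 2 * d ^ 2)
        = θ * (3 / 2 * L * d ^ 2) + L / 2 * (θ * d) ^ 2 := by ring
    linarith
  have h13 : θ * (L * d ^ 2 / 2 + e ^ 2 / (2 * L)) - θ * (3 / 2 * L * d ^ 2)
      + θ * (L * d ^ 2 / 2 + e ^ 2 / (8 * L)) + θ * (L * d ^ 2 / 2)
      = θ * (5 / 8 * (e ^ 2 / L)) := by field_simp; ring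
  have hp'' := mul_le_mul_of_nonneg_left hp' hθ.le
  have hcs' := mul_le_mul_of_nonneg_left hcs hθ.le
  unfold PsiS
  rw [hX]
  linarith

/-! ### Bounds on the smoothed objective -/

theorem Psi0_eq (hD : D.Standing) {x : Euc p} (hx : x ∈ effDom D.R) :
    D.Psi0 x = ((D.Phi 0 x + (D.R x).toReal : ℝ) : EReal) := by
  rw [Psi0, EReal.coe_add, hD.R_pcc.coe_toReal hx]

theorem Psi0Star_toReal_le (hD : D.Standing) {x : Euc p} (hx : x ∈ effDom D.R) :
    D.Psi0Star.toReal ≤ D.Phi 0 x + (D.R x).toReal := by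
  have h1 : D.Psi0Star ≤ ((D.Phi 0 x + (D.R x).toReal : ℝ) : EReal) := by
    rw [← Psi0_eq hD hx]; exact iInf_le _ _
  have h2 : D.Psi0Star ≠ ⊤ := ne_top_of_le_ne_top (EReal.coe_ne_top _) h1
  rw [← EReal.coe_toReal h2 hD.Psi0Star_gt.ne'] at h1
  exact EReal.coe_le_coe_iff.1 h1

/-- Subtracting this bound makes the objective gap nonnegative, so that it can be carried through
nonnegative integrals without loss. -/
theorem PsiS_lower (hD : D.Standing) (hψ : D.AssumptionPsi Mψ) (hγ : 0 ≤ γ) {x : Euc p}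
    (hx : x ∈ effDom D.R) : D.Psi0Star.toReal - γ * D.Bpsi ≤ D.PsiS γ x := by
  have h1 := Psi0Star_toReal_le hD hx
  have h2 := phi_zero_le hD hψ hγ (D.meanF x)
  unfold PsiS; unfold Phi at h1 ⊢; linarith

theorem PsiS_upper (hD : D.Standing) (hψ : D.AssumptionPsi Mψ) (hγ : 0 ≤ γ) {x : Euc p}
    (hx : x ∈ effDom D.R) : D.PsiS γ x ≤ (D.Psi0 x).toReal := by
  rw [Psi0_eq hD hx, EReal.toReal_coe]
  have h2 := phi_le_phi_zero hD hψ hγ (D.meanF x)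
  unfold PsiS Phi; linarith

/-! ### Measurability -/

theorem measurable_PsiS (hD : D.Standing) (hψ : D.AssumptionPsi Mψ) (hγ : 0 < γ) :
    Measurable (D.PsiS γ) :=
  ((continuous_phi hD hψ hγ).measurable.comp (measurable_meanF hD)).add
    hD.R_pcc.measurable_toReal

theorem measurable_gradEst (hD : D.Standing) (hψ : D.AssumptionPsi Mψ) (hγ : 0 < γ) :
    Measurable fun z : Cols p q × Euc q => D.gradEst γ z.1 z.2 :=
  measurable_colAdj.comp (measurable_fst.prodMk
    ((D.K.continuous.comp (continuous_dualSol hD hψ hγ)).measurable.comp measurable_snd))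

theorem measurable_nextPt (hD : D.Standing) (hψ : D.AssumptionPsi Mψ) (hγ : 0 < γ) (hη : 0 < η) :
    Measurable fun z : Euc p × Cols p q × Euc q => D.nextPt γ η θ z.1 z.2.1 z.2.2 := by
  have h1 : Measurable fun z : Euc p × Cols p q × Euc q => D.gradEst γ z.2.1 z.2.2 :=
    (measurable_gradEst hD hψ hγ).comp measurable_snd
  have h2 : Measurable fun z : Euc p × Cols p q × Euc q =>
      proxOp η D.R (z.1 - η • D.gradEst γ z.2.1 z.2.2) :=
    (hD.R_pcc.continuous_proxOp hη).measurable.comp (measurable_fst.sub (h1.const_smul η))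
  unfold nextPt
  exact (measurable_fst.const_smul (1 - θ)).add (h2.const_smul θ)

/-- On the domain of `R`, the gradient mapping is the restriction of a measurable function. -/
theorem exists_measurable_gradMap (hD : D.Standing) (hF : D.AssumptionF LF σF σJ MF)
    (hψ : D.AssumptionPsi Mψ) (hγ : 0 < γ) (hη : 0 < η) :
    ∃ G : Euc p → Euc p, Measurable G ∧ ∀ x ∈ effDom D.R, D.gradMap γ η x = G x := by
  refine ⟨fun x => η⁻¹ • (x - proxOp η D.R (x - η • D.tanGrad γ x)), ?_,
    fun x hx => gradMap_eq hD hF hψ hγ hη hx⟩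
  have h0 : Measurable fun x => (D.meanCols x, D.meanF x) :=
    (measurable_meanCols hD).prodMk (measurable_meanF hD)
  have h1 : Measurable fun x => D.tanGrad γ x := by
    have e : D.tanGrad γ = (fun z : Cols p q × Euc q => D.gradEst γ z.1 z.2) ∘
        fun x => (D.meanCols x, D.meanF x) := by
      funext x; rw [tanGrad, Function.comp_apply]
    rw [e]
    exact (measurable_gradEst (γ := γ) hD hψ hγ).comp h0
  have h2 : Measurable fun x => proxOp η D.R (x - η • D.tanGrad γ x) :=
    (hD.R_pcc.continuous_proxOp hη).measurable.comp (measurable_id.sub (h1.const_smul η))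
  exact (measurable_id.sub h2).const_smul η⁻¹

end MinimaxData

/-! ### Errors of the hybrid estimators -/

/-- The hybrid estimator at `x'`, updated from the estimator `e` at `x`. -/
def hybrid {X Ξ E : Type*} [AddCommGroup E] [Module ℝ E] {m k : ℕ} (β : ℝ) (H : X → Ξ → E)
    (x x' : X) (e : E) (X₁ : Fin m → Ξ) (X₂ : Fin k → Ξ) : E :=
  β • e + (β / m) • ∑ i, (H x' (X₁ i) - H x (X₁ i)) + ((1 - β) / k) • ∑ i, H x' (X₂ i)

section Hybrid

variable {Ω Ξ X E : Type*} [MeasurableSpace Ω] [MeasurableSpace Ξ] {μ : Measure Ω}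
  {P : Measure Ξ} [IsProbabilityMeasure μ] [IsProbabilityMeasure P]
  [NormedAddCommGroup X] [MeasurableSpace X] [BorelSpace X] [SecondCountableTopology X]
  [NormedAddCommGroup E] [InnerProductSpace ℝ E] [CompleteSpace E] [MeasurableSpace E]
  [BorelSpace E] [SecondCountableTopology E]
  {m k : ℕ} {H : X → Ξ → E} {C : Set X} {Λ σ κ : ℝ}

/-- The new error is the old one, damped by `β`, plus two sampling fluctuations. When `h` is the
expectation of `H`, both fluctuations are centered given the past. -/
theorem hybrid_sub_eq {h : X → E} (β : ℝ) (x x' : X) (e : E)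
    (X₁ : Fin m → Ξ) (X₂ : Fin k → Ξ) :
    hybrid β H x x' e X₁ X₂ - h x' = β • (e - h x)
      + (β • ((m : ℝ)⁻¹ • ∑ i, (H x' (X₁ i) - H x (X₁ i)) - (h x' - h x))
        + (1 - β) • ((k : ℝ)⁻¹ • ∑ i, H x' (X₂ i) - h x')) := by
  unfold hybrid
  module

theorem measurable_hybrid (hH : Measurable fun z : X × Ξ => H z.1 z.2) (β : ℝ) :
    Measurable fun z : (X × X × E) × ((Fin m → Ξ) × (Fin k → Ξ)) =>
      hybrid β H z.1.1 z.1.2.1 z.1.2.2 z.2.1 z.2.2 := by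
  have h1 : ∀ i, Measurable fun z : (X × X × E) × ((Fin m → Ξ) × (Fin k → Ξ)) =>
      H z.1.2.1 (z.2.1 i) := fun i =>
    hH.comp (f := fun z : (X × X × E) × ((Fin m → Ξ) × (Fin k → Ξ)) => (z.1.2.1, z.2.1 i))
      (by fun_prop)
  have h2 : ∀ i, Measurable fun z : (X × X × E) × ((Fin m → Ξ) × (Fin k → Ξ)) =>
      H z.1.1 (z.2.1 i) := fun i =>
    hH.comp (f := fun z : (X × X × E) × ((Fin m → Ξ) × (Fin k → Ξ)) => (z.1.1, z.2.1 i))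
      (by fun_prop)
  have h3 : ∀ i, Measurable fun z : (X × X × E) × ((Fin m → Ξ) × (Fin k → Ξ)) =>
      H z.1.2.1 (z.2.2 i) := fun i =>
    hH.comp (f := fun z : (X × X × E) × ((Fin m → Ξ) × (Fin k → Ξ)) => (z.1.2.1, z.2.2 i))
      (by fun_prop)
  have h4 : Measurable fun z : (X × X × E) × ((Fin m → Ξ) × (Fin k → Ξ)) => z.1.2.2 := by fun_prop
  exact ((h4.const_smul β).add ((Finset.measurable_sum _ fun i _ =>
    (h1 i).sub (h2 i)).const_smul _)).add ((Finset.measurable_sum _ fun i _ => h3 i).const_smul _)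

theorem Measurable.hybrid (hH : Measurable fun z : X × Ξ => H z.1 z.2) (β : ℝ) {x x' : Ω → X}
    {e : Ω → E} (hx : Measurable x) (hx' : Measurable x') (he : Measurable e)
    {X₁ : Ω → Fin m → Ξ} {X₂ : Ω → Fin k → Ξ} (h₁ : ∀ i, Measurable fun ω => X₁ ω i)
    (h₂ : ∀ i, Measurable fun ω => X₂ ω i) :
    Measurable fun ω => hybrid β H (x ω) (x' ω) (e ω) (X₁ ω) (X₂ ω) :=
  (measurable_hybrid hH β).comp ((hx.prodMk (hx'.prodMk he)).prodMk
    ((measurable_pi_lambda X₁ h₁).prodMk (measurable_pi_lambda X₂ h₂)))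

/-- The recursive bound on the mean squared error of the hybrid estimator. -/
theorem lintegral_hybrid_error_le (hH : Measurable fun z : X × Ξ => H z.1 z.2)
    (hL2 : ∀ x ∈ C, MemLp (H x) 2 P)
    (hΛ : ∀ x ∈ C, ∀ y ∈ C, ∫ ξ, ‖H x ξ - H y ξ‖ ^ 2 ∂P ≤ Λ ^ 2 * ‖x - y‖ ^ 2)
    (hσ : ∀ x ∈ C, ∫ ξ, ‖H x ξ - ∫ ζ, H x ζ ∂P‖ ^ 2 ∂P ≤ σ ^ 2)
    (hm : 0 < m) (hk : 0 < k) {X₁ : Fin m → Ω → Ξ} {X₂ : Fin k → Ω → Ξ}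
    (h₁ : IsIID X₁ P μ) (h₂ : IsIID X₂ P μ)
    (hκ : κ = 2 ∨ κ = 1 ∧ Indep (sigmaOf X₁) (sigmaOf X₂) μ)
    {x x' : Ω → X} {e : Ω → E} (hx : Measurable x) (hx' : Measurable x') (he : Measurable e)
    (hxC : ∀ ω, x ω ∈ C) (hxC' : ∀ ω, x' ω ∈ C)
    (hind : IndepFun (fun ω => (x ω, x' ω, e ω)) (fun ω => (fun i => X₁ i ω, fun i => X₂ i ω)) μ)
    (β : ℝ) :
    ∫⁻ ω, ENNReal.ofReal (‖hybrid β H (x ω) (x' ω) (e ω) (fun i => X₁ i ω) (fun i => X₂ i ω)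
        - ∫ ζ, H (x' ω) ζ ∂P‖ ^ 2) ∂μ
      ≤ ENNReal.ofReal (β ^ 2) * ∫⁻ ω, ENNReal.ofReal (‖e ω - ∫ ζ, H (x ω) ζ ∂P‖ ^ 2) ∂μ
        + ENNReal.ofReal (κ * (β ^ 2 / m) * Λ ^ 2)
          * ∫⁻ ω, ENNReal.ofReal (‖x' ω - x ω‖ ^ 2) ∂μ
        + ENNReal.ofReal (κ * ((1 - β) ^ 2 / k) * σ ^ 2) := by
  set h : X → E := fun x => ∫ ζ, H x ζ ∂P with hh
  have hhm : Measurable h := hH.stronglyMeasurable.integral_prod_right'.measurable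
  have hκ0 : 0 ≤ κ := by rcases hκ with rfl | ⟨rfl, -⟩ <;> norm_num
  set W : Ω → (Fin m → Ξ) × (Fin k → Ξ) := fun ω => (fun i => X₁ i ω, fun i => X₂ i ω) with hW
  have hWm : Measurable W :=
    (measurable_pi_lambda _ fun i => (h₁.1 i).1).prodMk (measurable_pi_lambda _ fun i => (h₂.1 i).1)
  have hfm : Measurable fun z : (X × X × E) × ((Fin m → Ξ) × (Fin k → Ξ)) =>
      ENNReal.ofReal (‖hybrid β H z.1.1 z.1.2.1 z.1.2.2 z.2.1 z.2.2 - h z.1.2.1‖ ^ 2) := by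
    have h1 : Measurable fun z : (X × X × E) × ((Fin m → Ξ) × (Fin k → Ξ)) => h z.1.2.1 :=
      hhm.comp (by fun_prop)
    exact (((measurable_hybrid hH β).sub h1).norm.pow_const 2).ennreal_ofReal
  have hZm : Measurable fun ω => (x ω, x' ω, e ω) := hx.prodMk (hx'.prodMk he)
  -- The points `x`, `x'` and the old estimate are frozen, and only the fresh samples are averaged.
  have key := lintegral_comp_of_indepFun hZm hWm hind hfm
  simp only [hW] at key
  rw [key]
  have hHx : ∀ x, Measurable (H x) := fun x => hH.comp measurable_prodMk_left
  have hem : Measurable fun ω => ENNReal.ofReal (‖e ω - h (x ω)‖ ^ 2) :=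
    ((he.sub (hhm.comp hx)).norm.pow_const 2).ennreal_ofReal
  have hxm : Measurable fun ω => ENNReal.ofReal (‖x' ω - x ω‖ ^ 2) :=
    ((hx'.sub hx).norm.pow_const 2).ennreal_ofReal
  calc _ ≤ ∫⁻ ω, (ENNReal.ofReal (β ^ 2) * ENNReal.ofReal (‖e ω - h (x ω)‖ ^ 2)
        + ENNReal.ofReal (κ * (β ^ 2 / m) * Λ ^ 2) * ENNReal.ofReal (‖x' ω - x ω‖ ^ 2)
        + ENNReal.ofReal (κ * ((1 - β) ^ 2 / k) * σ ^ 2)) ∂μ := by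
        refine lintegral_mono fun ω => ?_
        have hC := hxC ω
        have hC' := hxC' ω
        have hf2 : MemLp (fun ξ => H (x' ω) ξ - H (x ω) ξ) 2 P := (hL2 _ hC').sub (hL2 _ hC)
        have hb := hybrid_second_moment h₁ h₂ hm hk ((hHx (x' ω)).sub (hHx (x ω))) hf2
          (hHx (x' ω)) (hL2 _ hC') hκ (β • (e ω - h (x ω))) β
        have hmean : ∫ ξ, (H (x' ω) ξ - H (x ω) ξ) ∂P = h (x' ω) - h (x ω) :=
          integral_sub ((hL2 _ hC').integrable one_le_two) ((hL2 _ hC).integrable one_le_two)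
        -- The variance of an increment is at most its raw second moment, which the average
        -- Lipschitz bound controls.
        have hv := (integral_norm_sub_mean_sq_le hf2 0)
        simp only [sub_zero] at hv
        have hv' := hv.trans (hΛ _ hC' _ hC)
        have hs := hσ _ hC'
        simp only [Pi.sub_apply] at hb
        rw [hmean] at hb hv'
        simp_rw [hybrid_sub_eq (h := h)]
        refine hb.trans ?_
        rw [← ENNReal.ofReal_mul (by positivity), ← ENNReal.ofReal_mul (by positivity),
          ← ENNReal.ofReal_add (by positivity) (by positivity),
          ← ENNReal.ofReal_add (by positivity) (by positivity)]
        refine ENNReal.ofReal_le_ofReal ?_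
        rw [norm_smul, mul_pow, Real.norm_eq_abs, sq_abs, add_assoc]
        gcongr
        rw [mul_assoc, mul_assoc, mul_assoc κ, ← mul_add]
        gcongr
    _ = _ := by
        rw [lintegral_add_right _ measurable_const, lintegral_add_right _ (hxm.const_mul _),
          lintegral_const_mul _ hem, lintegral_const_mul _ hxm]
        simp [hh]

/-- The mean squared error of a mini-batch average at a random point. -/
theorem lintegral_batch_error_le (hH : Measurable fun z : X × Ξ => H z.1 z.2)
    (hL2 : ∀ x ∈ C, MemLp (H x) 2 P)
    (hσ : ∀ x ∈ C, ∫ ξ, ‖H x ξ - ∫ ζ, H x ζ ∂P‖ ^ 2 ∂P ≤ σ ^ 2)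
    (hm : 0 < m) {X₁ : Fin m → Ω → Ξ} (h₁ : IsIID X₁ P μ) {x : Ω → X} (hx : Measurable x)
    (hxC : ∀ ω, x ω ∈ C) (hind : IndepFun x (fun ω i => X₁ i ω) μ) :
    ∫⁻ ω, ENNReal.ofReal (‖(m : ℝ)⁻¹ • ∑ i, H (x ω) (X₁ i ω) - ∫ ζ, H (x ω) ζ ∂P‖ ^ 2) ∂μ
      ≤ ENNReal.ofReal (σ ^ 2 / m) := by
  set h : X → E := fun x => ∫ ζ, H x ζ ∂P with hh
  have hhm : Measurable h := hH.stronglyMeasurable.integral_prod_right'.measurable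
  have hWm : Measurable fun ω i => X₁ i ω := measurable_pi_lambda _ fun i => (h₁.1 i).1
  have hfm : Measurable fun z : X × (Fin m → Ξ) =>
      ENNReal.ofReal (‖(m : ℝ)⁻¹ • ∑ i, H z.1 (z.2 i) - h z.1‖ ^ 2) := by
    have h1 : ∀ i, Measurable fun z : X × (Fin m → Ξ) => H z.1 (z.2 i) := fun i =>
      hH.comp (f := fun z : X × (Fin m → Ξ) => (z.1, z.2 i)) (by fun_prop)
    exact ((((Finset.measurable_sum _ fun i _ => h1 i).const_smul _).sub
      (hhm.comp measurable_fst)).norm.pow_const 2).ennreal_ofReal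
  have key := lintegral_comp_of_indepFun hx hWm hind hfm
  simp only at key
  rw [key]
  calc _ ≤ ∫⁻ _, ENNReal.ofReal (σ ^ 2 / m) ∂μ := by
        refine lintegral_mono fun ω => ?_
        obtain ⟨hA, -, hA2⟩ := h₁.batch_error hm (f := H (x ω))
          (hH.comp measurable_prodMk_left) (hL2 _ (hxC ω))
        rw [← integral_norm_sq_eq_lintegral hA, hA2]
        refine ENNReal.ofReal_le_ofReal ?_
        rw [div_eq_inv_mul]
        exact mul_le_mul_of_nonneg_left (hσ _ (hxC ω)) (by positivity)
    _ = _ := by simp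

end Hybrid

/-! ### The state of the algorithm -/

namespace Batches

variable {Ω Ξ : Type*} [MeasurableSpace Ξ] [mΩ : MeasurableSpace Ω] {b₀ bJ₀ b₁ bJ₁ b₂ bJ₂ : ℕ}
  {B : Ω → Batches Ξ b₀ bJ₀ b₁ bJ₁ b₂ bJ₂} {s t : ℕ}

theorem measurable_of_sigmaOf_le {ι : Type*} {X : ι → Ω → Ξ} (h : sigmaOf X ≤ mΩ) (i : ι) :
    Measurable (X i) :=
  measurable_iff_comap_le.2 ((le_iSup (fun i => MeasurableSpace.comap (X i) _) i).trans h)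

theorem sigmaOf_le {ι : Type*} {X : ι → Ω → Ξ} (h : ∀ i, Measurable (X i)) : sigmaOf X ≤ mΩ :=
  iSup_le fun i => (h i).comap_le

theorem measurable_zero (h : block B s 0 ≤ mΩ) (i : Fin b₀) :
    Measurable fun ω => (B ω).zero s i :=
  measurable_of_sigmaOf_le (X := fun i ω => (B ω).zero s i) (le_sup_left.trans h) i

theorem measurable_zeroJ (h : block B s 0 ≤ mΩ) (i : Fin bJ₀) :
    Measurable fun ω => (B ω).zeroJ s i :=
  measurable_of_sigmaOf_le (X := fun i ω => (B ω).zeroJ s i) (le_sup_right.trans h) i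

theorem measurable_one (h : block B s (t + 1) ≤ mΩ) (i : Fin b₁) :
    Measurable fun ω => (B ω).one s (t + 1) i :=
  measurable_of_sigmaOf_le (X := fun i ω => (B ω).one s (t + 1) i)
    ((le_sup_left.trans le_sup_left).trans h) i

theorem measurable_oneJ (h : block B s (t + 1) ≤ mΩ) (i : Fin bJ₁) :
    Measurable fun ω => (B ω).oneJ s (t + 1) i :=
  measurable_of_sigmaOf_le (X := fun i ω => (B ω).oneJ s (t + 1) i)
    ((le_sup_right.trans le_sup_left).trans h) i

theorem measurable_two (h : block B s (t + 1) ≤ mΩ) (i : Fin b₂) :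
    Measurable fun ω => (B ω).two s (t + 1) i :=
  measurable_of_sigmaOf_le (X := fun i ω => (B ω).two s (t + 1) i)
    ((le_sup_left.trans le_sup_right).trans h) i

theorem measurable_twoJ (h : block B s (t + 1) ≤ mΩ) (i : Fin bJ₂) :
    Measurable fun ω => (B ω).twoJ s (t + 1) i :=
  measurable_of_sigmaOf_le (X := fun i ω => (B ω).twoJ s (t + 1) i)
    ((le_sup_right.trans le_sup_right).trans h) i

variable {P : Measure Ξ} {μ : Measure Ω} {S T : ℕ}

theorem Admissible.block_le (hB : Admissible B P μ S T) (hs : s < S) (ht : t ≤ T) :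
    block B s t ≤ mΩ := by
  cases t with
  | zero =>
    exact sup_le (sigmaOf_le fun i => ((hB.zero s hs).1 i).1)
      (sigmaOf_le fun i => ((hB.zeroJ s hs).1 i).1)
  | succ t =>
    have ht' : t + 1 ∈ Finset.Icc 1 T := Finset.mem_Icc.2 ⟨by omega, ht⟩
    exact sup_le (sup_le (sigmaOf_le fun i => ((hB.one s hs _ ht').1 i).1)
        (sigmaOf_le fun i => ((hB.oneJ s hs _ ht').1 i).1))
      (sup_le (sigmaOf_le fun i => ((hB.two s hs _ ht').1 i).1)
        (sigmaOf_le fun i => ((hB.twoJ s hs _ ht').1 i).1))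

/-- The σ-algebra generated by the samples drawn before iteration `t` of stage `s`. -/
@[reducible] def past (B : Ω → Batches Ξ b₀ bJ₀ b₁ bJ₁ b₂ bJ₂) (S T s t : ℕ) :
    MeasurableSpace Ω :=
  ⨆ st ∈ {st : Fin S × Fin (T + 1) | st.1.1 < s ∨ st.1.1 = s ∧ st.2.1 < t},
    block B st.1 st.2

theorem block_le_past {s' t' : ℕ} (hs' : s' < S) (ht' : t' ≤ T)
    (h : s' < s ∨ s' = s ∧ t' < t) : block B s' t' ≤ past B S T s t :=
  le_iSup₂_of_le (f := fun (st : Fin S × Fin (T + 1))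
    (_ : st ∈ {st : Fin S × Fin (T + 1) | st.1.1 < s ∨ st.1.1 = s ∧ st.2.1 < t}) =>
      block B st.1 st.2) (⟨s', hs'⟩, ⟨t', by omega⟩) h le_rfl

/-- The blocks are jointly independent, and the block of `(s, t)` is not among the lexicographically
earlier ones that generate the past. -/
theorem Admissible.indep_past (hB : Admissible B P μ S T) (hs : s < S) (ht : t ≤ T) :
    Indep (past B S T s t) (block B s t) μ := by
  have h := indep_iSup_of_disjoint (m := fun st : Fin S × Fin (T + 1) => block B st.1 st.2)
    (fun st => hB.block_le st.1.2 (by omega)) hB.indep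
    (S := {st : Fin S × Fin (T + 1) | st.1.1 < s ∨ st.1.1 = s ∧ st.2.1 < t})
    (T := {(⟨s, hs⟩, ⟨t, by omega⟩)}) (by
      rw [Set.disjoint_singleton_right]
      rintro (h | h)
      · exact lt_irrefl _ h
      · exact lt_irrefl _ h.2)
  simpa only [Set.mem_singleton_iff, iSup_iSup_eq_left] using h

theorem indepFun_of_indep {α β : Type*} [MeasurableSpace α] [MeasurableSpace β]
    {m₁ m₂ : MeasurableSpace Ω} (h : Indep m₁ m₂ μ) {X : Ω → α} {Y : Ω → β}
    (hX : Measurable[m₁] X) (hY : Measurable[m₂] Y) : IndepFun X Y μ :=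
  indep_of_indep_of_le_left (indep_of_indep_of_le_right h hY.comap_le) hX.comap_le

end Batches

namespace MinimaxData

variable {p n q : ℕ} {Ξ : Type*} [MeasurableSpace Ξ] {D : MinimaxData p n q Ξ}
  {LF σF σJ MF Mψ : ℝ} {b₀ bJ₀ b₁ bJ₁ b₂ bJ₂ : ℕ} {par : StepParams}

/-- The state at iteration `t` of stage `s` in the restarting variant. -/
def algState (D : MinimaxData p n q Ξ) (par : StepParams) (B : Batches Ξ b₀ bJ₀ b₁ bJ₁ b₂ bJ₂)
    (T : ℕ) (x₀ : Euc p) (s t : ℕ) : AlgState p q Ξ :=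
  D.stageState par B s (D.restart par B T x₀ s).1 (D.restart par B T x₀ s).2.1
    (D.restart par B T x₀ s).2.2 t

theorem nextX_eq (D : MinimaxData p n q Ξ) (par : StepParams) (st : AlgState p q Ξ) :
    D.nextX par st = D.nextPt par.γ par.η par.θ st.x (cols st.Jest) st.Fest := by
  rw [nextX, nextPt, gradEst, colAdj_cols]

section

variable (D par) (B : Batches Ξ b₀ bJ₀ b₁ bJ₁ b₂ bJ₂) (T : ℕ) (x₀ : Euc p) (s t : ℕ)

theorem algState_zero_x : (D.algState par B T x₀ s 0).x = (D.restart par B T x₀ s).1 := rfl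

theorem algState_zero_Fest : (D.algState par B T x₀ s 0).Fest
    = (b₀ : ℝ)⁻¹ • ∑ i, D.F (D.restart par B T x₀ s).1 (B.zero s i) := rfl

theorem algState_zero_cols : cols (D.algState par B T x₀ s 0).Jest
    = (bJ₀ : ℝ)⁻¹ • ∑ i, cols (D.jac (D.restart par B T x₀ s).1 (B.zeroJ s i)) := by
  rw [← cols_sum, ← cols_smul]; rfl

theorem algState_succ_x : (D.algState par B T x₀ s (t + 1)).x
    = D.nextX par (D.algState par B T x₀ s t) := rfl

theorem algState_succ_Fest : (D.algState par B T x₀ s (t + 1)).Fest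
    = hybrid par.β D.F (D.algState par B T x₀ s t).x
        (D.nextX par (D.algState par B T x₀ s t)) (D.algState par B T x₀ s t).Fest
        (B.one s (t + 1)) (B.two s (t + 1)) := rfl

theorem algState_succ_cols : cols (D.algState par B T x₀ s (t + 1)).Jest
    = hybrid par.β (fun x ξ => cols (D.jac x ξ)) (D.algState par B T x₀ s t).x
        (D.nextX par (D.algState par B T x₀ s t)) (cols (D.algState par B T x₀ s t).Jest)
        (B.oneJ s (t + 1)) (B.twoJ s (t + 1)) := by
  unfold hybrid
  simp_rw [← cols_sub, ← cols_sum, ← cols_smul, ← cols_add]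
  rfl

end

theorem algState_x_mem (hD : D.Standing) (hη : 0 < par.η) (hθ : 0 < par.θ) (hθ1 : par.θ ≤ 1)
    (B : Batches Ξ b₀ bJ₀ b₁ bJ₁ b₂ bJ₂) (T : ℕ) {x₀ : Euc p} (hx₀ : x₀ ∈ effDom D.R) (s t : ℕ) :
    (D.algState par B T x₀ s t).x ∈ effDom D.R := by
  have hnext : ∀ st : AlgState p q Ξ, st.x ∈ effDom D.R → D.nextX par st ∈ effDom D.R := by
    intro st hst
    rw [nextX_eq]; exact nextPt_mem hD hη hθ hθ1 hst _ _
  have hstage : ∀ s, (D.restart par B T x₀ s).1 ∈ effDom D.R →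
      ∀ t, (D.algState par B T x₀ s t).x ∈ effDom D.R := by
    intro s hs t
    induction t with
    | zero => exact hs
    | succ t ih => exact hnext _ ih
  refine hstage s ?_ t
  induction s with
  | zero => exact hx₀
  | succ s ih => exact hnext _ (hstage s ih T)

section Measurability

variable {Ω : Type*} [mΩ : MeasurableSpace Ω] {B : Ω → Batches Ξ b₀ bJ₀ b₁ bJ₁ b₂ bJ₂} {T : ℕ}
  {x₀ : Euc p}

/-- The random part of the state that determines the future iterates. -/
def core (D : MinimaxData p n q Ξ) (par : StepParams) (B : Batches Ξ b₀ bJ₀ b₁ bJ₁ b₂ bJ₂)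
    (T : ℕ) (x₀ : Euc p) (s t : ℕ) : Euc p × Cols p q × Euc q :=
  ((D.algState par B T x₀ s t).x, cols (D.algState par B T x₀ s t).Jest,
    (D.algState par B T x₀ s t).Fest)

theorem measurable_nextX (hD : D.Standing) (hψ : D.AssumptionPsi Mψ) (hγ : 0 < par.γ)
    (hη : 0 < par.η) {s t : ℕ} (h : Measurable fun ω => D.core par (B ω) T x₀ s t) :
    Measurable fun ω => D.nextX par (D.algState par (B ω) T x₀ s t) := by
  simp_rw [nextX_eq]
  exact (measurable_nextPt (θ := par.θ) hD hψ hγ hη).comp h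

/-- The σ-algebra on `Ω` is arbitrary as long as it contains the relevant blocks. Taken to be
`past`, it shows that the state depends on earlier samples only; taken to be the ambient one, it
gives ordinary measurability. -/
theorem measurable_core_of_start (hD : D.Standing) (hψ : D.AssumptionPsi Mψ) (hγ : 0 < par.γ)
    (hη : 0 < par.η) {s t : ℕ} (hs : Measurable fun ω => (D.restart par (B ω) T x₀ s).1)
    (h : ∀ t' ≤ t, Batches.block B s t' ≤ mΩ) :
    Measurable fun ω => D.core par (B ω) T x₀ s t := by
  induction t with
  | zero =>
    have h0 := h 0 le_rfl
    have h1 : ∀ i, Measurable fun ω =>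
        cols (D.jac (D.restart par (B ω) T x₀ s).1 ((B ω).zeroJ s i)) := fun i =>
      (measurable_cols_jac hD).comp (hs.prodMk (Batches.measurable_zeroJ h0 i))
    have h2 : ∀ i, Measurable fun ω =>
        D.F (D.restart par (B ω) T x₀ s).1 ((B ω).zero s i) := fun i =>
      (measurable_F hD).comp (hs.prodMk (Batches.measurable_zero h0 i))
    simp only [core, algState_zero_x, algState_zero_cols, algState_zero_Fest]
    have h3 := Finset.measurable_sum Finset.univ fun i _ => h1 i
    have h4 := Finset.measurable_sum Finset.univ fun i _ => h2 i
    exact hs.prodMk ((h3.const_smul (bJ₀ : ℝ)⁻¹).prodMk (h4.const_smul (b₀ : ℝ)⁻¹))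
  | succ t ih =>
    have ih := ih fun t' ht' => h t' (by omega)
    have hb := h (t + 1) le_rfl
    have hn := measurable_nextX hD hψ hγ hη ih
    have hx : Measurable fun ω => (D.algState par (B ω) T x₀ s t).x := measurable_fst.comp ih
    have hJ : Measurable fun ω => cols (D.algState par (B ω) T x₀ s t).Jest :=
      (measurable_fst.comp measurable_snd).comp ih
    have hF : Measurable fun ω => (D.algState par (B ω) T x₀ s t).Fest :=
      (measurable_snd.comp measurable_snd).comp ih
    simp only [core, algState_succ_x, algState_succ_cols, algState_succ_Fest]
    refine hn.prodMk (Measurable.prodMk ?_ ?_)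
    · exact Measurable.hybrid (measurable_cols_jac hD) par.β hx hn hJ
        (fun i => Batches.measurable_oneJ hb i) fun i => Batches.measurable_twoJ hb i
    · exact Measurable.hybrid (measurable_F hD) par.β hx hn hF
        (fun i => Batches.measurable_one hb i) fun i => Batches.measurable_two hb i

theorem measurable_restart (hD : D.Standing) (hψ : D.AssumptionPsi Mψ) (hγ : 0 < par.γ)
    (hη : 0 < par.η) {s : ℕ} (h : ∀ s' < s, ∀ t' ≤ T, Batches.block B s' t' ≤ mΩ) :
    Measurable fun ω => (D.restart par (B ω) T x₀ s).1 := by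
  induction s with
  | zero => exact measurable_const
  | succ s ih =>
    exact measurable_nextX hD hψ hγ hη (measurable_core_of_start hD hψ hγ hη
      (ih fun s' hs' => h s' (by omega)) (h s (by omega)))

theorem measurable_core (hD : D.Standing) (hψ : D.AssumptionPsi Mψ) (hγ : 0 < par.γ)
    (hη : 0 < par.η) {s t : ℕ} (h : ∀ s' < s, ∀ t' ≤ T, Batches.block B s' t' ≤ mΩ)
    (h' : ∀ t' ≤ t, Batches.block B s t' ≤ mΩ) :
    Measurable fun ω => D.core par (B ω) T x₀ s t :=
  measurable_core_of_start hD hψ hγ hη (measurable_restart hD hψ hγ hη h) h'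

end Measurability

end MinimaxData

/-! ### Mean squared errors along the algorithm -/

/-- The assumptions on the problem, the parameters and the samples under which the restarting
variant is analyzed. -/
structure RunAssumptions {p n q : ℕ} {Ξ Ω : Type*} [MeasurableSpace Ξ] [MeasurableSpace Ω]
    (μ : Measure Ω) (D : MinimaxData p n q Ξ) (LF σF σJ MF Mψ : ℝ) (par : StepParams)
    {b₀ bJ₀ b₁ bJ₁ b₂ bJ₂ : ℕ} (B : Ω → Batches Ξ b₀ bJ₀ b₁ bJ₁ b₂ bJ₂) (S T : ℕ) (x₀ : Euc p)
    (κ κJ : ℝ) : Prop where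
  standing : D.Standing
  K_ne : D.K ≠ 0
  asmF : D.AssumptionF LF σF σJ MF
  asmPsi : D.AssumptionPsi Mψ
  γ_pos : 0 < par.γ
  θ_pos : 0 < par.θ
  θ_le : par.θ ≤ 1
  η_eq : par.η = 2 / (D.constL par.γ MF LF Mψ * (3 + par.θ))
  adm : Batches.Admissible B D.law μ S T
  b₀_pos : 0 < b₀
  bJ₀_pos : 0 < bJ₀
  b₁_pos : 0 < b₁
  bJ₁_pos : 0 < bJ₁
  b₂_pos : 0 < b₂
  bJ₂_pos : 0 < bJ₂
  kappa : κ = 2 ∨ κ = 1 ∧ Batches.IndepF B μ S T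
  kappaJ : κJ = 2 ∨ κJ = 1 ∧ Batches.IndepJ B μ S T
  start_mem : x₀ ∈ effDom D.R

namespace MinimaxData

variable {p n q : ℕ} {Ξ Ω : Type*} [MeasurableSpace Ξ] (D : MinimaxData p n q Ξ)
  (par : StepParams) {b₀ bJ₀ b₁ bJ₁ b₂ bJ₂ : ℕ}

section Quantities

variable [MeasurableSpace Ω] (μ : Measure Ω) (B : Ω → Batches Ξ b₀ bJ₀ b₁ bJ₁ b₂ bJ₂) (T : ℕ)
  (x₀ : Euc p) (s t : ℕ)

/-- Mean squared error of the estimator of `F`. -/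
def errF : ENNReal := ∫⁻ ω, ENNReal.ofReal (‖(D.algState par (B ω) T x₀ s t).Fest
  - D.meanF (D.algState par (B ω) T x₀ s t).x‖ ^ 2) ∂μ

/-- Mean squared error of the estimator of the Jacobian. -/
def errJ : ENNReal := ∫⁻ ω, ENNReal.ofReal (‖cols (D.algState par (B ω) T x₀ s t).Jest
  - D.meanCols (D.algState par (B ω) T x₀ s t).x‖ ^ 2) ∂μ

/-- Mean squared distance of successive iterates. -/
def stepSq : ENNReal := ∫⁻ ω, ENNReal.ofReal (‖D.nextX par (D.algState par (B ω) T x₀ s t)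
  - (D.algState par (B ω) T x₀ s t).x‖ ^ 2) ∂μ

/-- Mean squared norm of the gradient mapping. -/
def gradSq : ENNReal := ∫⁻ ω, ENNReal.ofReal
  (‖D.gradMap par.γ par.η (D.algState par (B ω) T x₀ s t).x‖ ^ 2) ∂μ

/-- Mean gap of the smoothed objective at a random point. -/
def gapAt (X : Ω → Euc p) : ENNReal :=
  ∫⁻ ω, ENNReal.ofReal (D.PsiS par.γ (X ω) - (D.Psi0Star.toReal - par.γ * D.Bpsi)) ∂μ

end Quantities

end MinimaxData

namespace RunAssumptions

open MinimaxData Batches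

variable {p n q : ℕ} {Ξ Ω : Type*} [MeasurableSpace Ξ] [mΩ : MeasurableSpace Ω]
  {μ : Measure Ω} [IsProbabilityMeasure μ] {D : MinimaxData p n q Ξ} {LF σF σJ MF Mψ : ℝ}
  {par : StepParams} {b₀ bJ₀ b₁ bJ₁ b₂ bJ₂ : ℕ} {B : Ω → Batches Ξ b₀ bJ₀ b₁ bJ₁ b₂ bJ₂}
  {S T : ℕ} {x₀ : Euc p} {κ κJ : ℝ} {s t : ℕ}

theorem L_pos (h : RunAssumptions μ D LF σF σJ MF Mψ par B S T x₀ κ κJ) :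
    0 < D.constL par.γ MF LF Mψ := constL_pos h.K_ne h.asmF h.asmPsi h.γ_pos

theorem η_pos (h : RunAssumptions μ D LF σF σJ MF Mψ par B S T x₀ κ κJ) : 0 < par.η := by
  have h1 := h.L_pos
  have h2 := h.θ_pos
  rw [h.η_eq]; positivity

theorem x_mem (h : RunAssumptions μ D LF σF σJ MF Mψ par B S T x₀ κ κJ) (s t : ℕ) (ω : Ω) :
    (D.algState par (B ω) T x₀ s t).x ∈ effDom D.R :=
  algState_x_mem h.standing h.η_pos h.θ_pos h.θ_le (B ω) T h.start_mem s t

theorem nextX_mem (h : RunAssumptions μ D LF σF σJ MF Mψ par B S T x₀ κ κJ) (s t : ℕ) (ω : Ω) :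
    D.nextX par (D.algState par (B ω) T x₀ s t) ∈ effDom D.R :=
  h.x_mem s (t + 1) ω

theorem measurable_core (h : RunAssumptions μ D LF σF σJ MF Mψ par B S T x₀ κ κJ) (hs : s < S)
    (ht : t ≤ T) : Measurable fun ω => D.core par (B ω) T x₀ s t :=
  MinimaxData.measurable_core h.standing h.asmPsi h.γ_pos h.η_pos
    (fun _ hs' _ ht' => h.adm.block_le (hs'.trans hs) ht')
    fun _ ht' => h.adm.block_le hs (ht'.trans ht)

theorem measurable_core_past (h : RunAssumptions μ D LF σF σJ MF Mψ par B S T x₀ κ κJ)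
    (hs : s < S) (ht : t < T) :
    Measurable[past B S T s (t + 1)] fun ω => D.core par (B ω) T x₀ s t :=
  MinimaxData.measurable_core (mΩ := past B S T s (t + 1)) h.standing h.asmPsi h.γ_pos h.η_pos
    (fun _ hs' _ ht' => block_le_past (hs'.trans hs) ht' (Or.inl hs'))
    fun _ ht' => block_le_past hs (ht'.trans ht.le) (Or.inr ⟨rfl, Nat.lt_succ_of_le ht'⟩)

theorem measurable_x (h : RunAssumptions μ D LF σF σJ MF Mψ par B S T x₀ κ κJ) (hs : s < S)
    (ht : t ≤ T) : Measurable fun ω => (D.algState par (B ω) T x₀ s t).x :=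
  measurable_fst.comp (h.measurable_core hs ht)

theorem measurable_cols (h : RunAssumptions μ D LF σF σJ MF Mψ par B S T x₀ κ κJ) (hs : s < S)
    (ht : t ≤ T) : Measurable fun ω => cols (D.algState par (B ω) T x₀ s t).Jest :=
  (measurable_fst.comp measurable_snd).comp (h.measurable_core hs ht)

theorem measurable_Fest (h : RunAssumptions μ D LF σF σJ MF Mψ par B S T x₀ κ κJ) (hs : s < S)
    (ht : t ≤ T) : Measurable fun ω => (D.algState par (B ω) T x₀ s t).Fest :=
  (measurable_snd.comp measurable_snd).comp (h.measurable_core hs ht)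

theorem measurable_next (h : RunAssumptions μ D LF σF σJ MF Mψ par B S T x₀ κ κJ) (hs : s < S)
    (ht : t ≤ T) : Measurable fun ω => D.nextX par (D.algState par (B ω) T x₀ s t) :=
  measurable_nextX h.standing h.asmPsi h.γ_pos h.η_pos (h.measurable_core hs ht)

/-- The state at iteration `t` is independent of the samples drawn at iteration `t + 1`. -/
theorem indepFun_step (h : RunAssumptions μ D LF σF σJ MF Mψ par B S T x₀ κ κJ)
    (hs : s < S) (ht : t < T) {α β : Type*} [MeasurableSpace α] [MeasurableSpace β]
    {g : (Euc p × Cols p q × Euc q) × Euc p → α} (hg : Measurable g) {W : Ω → β}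
    (hW : Measurable[block B s (t + 1)] W) :
    IndepFun (fun ω => g (D.core par (B ω) T x₀ s t,
      D.nextX par (D.algState par (B ω) T x₀ s t))) W μ := by
  refine indepFun_of_indep (h.adm.indep_past hs ht) ?_ hW
  have h1 := h.measurable_core_past hs ht
  have h2 := measurable_nextX (mΩ := past B S T s (t + 1)) h.standing h.asmPsi h.γ_pos h.η_pos h1
  exact hg.comp (Measurable.prodMk h1 h2)

/-- The starting point of a stage is built from earlier stages only, so the first batches of the
stage are fresh. -/
theorem indepFun_start (h : RunAssumptions μ D LF σF σJ MF Mψ par B S T x₀ κ κJ)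
    (hs : s < S) {β : Type*} [MeasurableSpace β] {W : Ω → β} (hW : Measurable[block B s 0] W) :
    IndepFun (fun ω => (D.algState par (B ω) T x₀ s 0).x) W μ := by
  refine indepFun_of_indep (h.adm.indep_past hs (Nat.zero_le T)) ?_ hW
  exact measurable_restart (mΩ := past B S T s 0) h.standing h.asmPsi h.γ_pos h.η_pos
    fun _ hs' _ ht' => block_le_past (hs'.trans hs) ht' (Or.inl hs')

theorem errF_zero_le (h : RunAssumptions μ D LF σF σJ MF Mψ par B S T x₀ κ κJ) (hs : s < S) :
    D.errF par μ B T x₀ s 0 ≤ ENNReal.ofReal (σF ^ 2 / b₀) := by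
  have := h.standing.prob
  refine lintegral_batch_error_le (μ := μ) (P := D.law) (H := D.F) (C := effDom D.R)
    (measurable_F h.standing) (fun x hx => memLp_F h.standing h.asmF hx)
    (fun x hx => variance_F_le h.standing h.asmF hx) h.b₀_pos (h.adm.zero s hs)
    (h.measurable_x hs (Nat.zero_le T)) (h.x_mem s 0) (h.indepFun_start hs ?_)
  exact @measurable_pi_lambda _ _ _ (block B s 0) _ _ fun i =>
    Batches.measurable_zero (mΩ := block B s 0) le_rfl i

theorem errJ_zero_le (h : RunAssumptions μ D LF σF σJ MF Mψ par B S T x₀ κ κJ) (hs : s < S) :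
    D.errJ par μ B T x₀ s 0 ≤ ENNReal.ofReal (σJ ^ 2 / bJ₀) := by
  have := h.standing.prob
  unfold errJ
  simp_rw [algState_zero_cols]
  refine lintegral_batch_error_le (μ := μ) (P := D.law) (H := fun x ξ => cols (D.jac x ξ))
    (C := effDom D.R) (measurable_cols_jac h.standing)
    (fun x hx => memLp_cols_jac h.standing h.asmF hx)
    (fun x hx => variance_cols_le h.standing h.asmF hx) h.bJ₀_pos (h.adm.zeroJ s hs)
    (h.measurable_x hs (Nat.zero_le T)) (h.x_mem s 0) (h.indepFun_start hs ?_)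
  exact @measurable_pi_lambda _ _ _ (block B s 0) _ _ fun i =>
    Batches.measurable_zeroJ (mΩ := block B s 0) le_rfl i

theorem errF_succ_le (h : RunAssumptions μ D LF σF σJ MF Mψ par B S T x₀ κ κJ) (hs : s < S)
    (ht : t < T) :
    D.errF par μ B T x₀ s (t + 1) ≤ ENNReal.ofReal (par.β ^ 2) * D.errF par μ B T x₀ s t
      + ENNReal.ofReal (κ * (par.β ^ 2 / b₁) * MF ^ 2) * D.stepSq par μ B T x₀ s t
      + ENNReal.ofReal (κ * ((1 - par.β) ^ 2 / b₂) * σF ^ 2) := by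
  have := h.standing.prob
  have htT : t + 1 ∈ Finset.Icc 1 T := Finset.mem_Icc.2 ⟨by omega, ht⟩
  refine lintegral_hybrid_error_le (μ := μ) (P := D.law) (H := D.F) (C := effDom D.R)
    (measurable_F h.standing) (fun x hx => memLp_F h.standing h.asmF hx)
    (fun x hx y hy => second_moment_F_sub_le h.standing h.asmF hx hy)
    (fun x hx => variance_F_le h.standing h.asmF hx) h.b₁_pos h.b₂_pos
    (h.adm.one s hs _ htT) (h.adm.two s hs _ htT)
    (h.kappa.imp id fun hk => ⟨hk.1, hk.2 s hs _ htT⟩) (h.measurable_x hs ht.le)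
    (h.measurable_next hs ht.le) (h.measurable_Fest hs ht.le) (h.x_mem s t) (h.nextX_mem s t)
    ?_ par.β
  refine h.indepFun_step hs ht (g := fun z => (z.1.1, z.2, z.1.2.2)) (by fun_prop) ?_
  exact Measurable.prodMk
    (@measurable_pi_lambda _ _ _ (block B s (t + 1)) _ _ fun i =>
      Batches.measurable_one (mΩ := block B s (t + 1)) le_rfl i)
    (@measurable_pi_lambda _ _ _ (block B s (t + 1)) _ _ fun i =>
      Batches.measurable_two (mΩ := block B s (t + 1)) le_rfl i)

theorem errJ_succ_le (h : RunAssumptions μ D LF σF σJ MF Mψ par B S T x₀ κ κJ) (hs : s < S)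
    (ht : t < T) :
    D.errJ par μ B T x₀ s (t + 1) ≤ ENNReal.ofReal (par.β ^ 2) * D.errJ par μ B T x₀ s t
      + ENNReal.ofReal (κJ * (par.β ^ 2 / bJ₁) * LF ^ 2) * D.stepSq par μ B T x₀ s t
      + ENNReal.ofReal (κJ * ((1 - par.β) ^ 2 / bJ₂) * σJ ^ 2) := by
  have := h.standing.prob
  have htT : t + 1 ∈ Finset.Icc 1 T := Finset.mem_Icc.2 ⟨by omega, ht⟩
  unfold errJ
  simp_rw [algState_succ_cols]
  refine lintegral_hybrid_error_le (μ := μ) (P := D.law) (H := fun x ξ => cols (D.jac x ξ))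
    (C := effDom D.R) (measurable_cols_jac h.standing)
    (fun x hx => memLp_cols_jac h.standing h.asmF hx)
    (fun x hx y hy => second_moment_cols_sub_le h.standing h.asmF hx hy)
    (fun x hx => variance_cols_le h.standing h.asmF hx) h.bJ₁_pos h.bJ₂_pos
    (h.adm.oneJ s hs _ htT) (h.adm.twoJ s hs _ htT)
    (h.kappaJ.imp id fun hk => ⟨hk.1, hk.2 s hs _ htT⟩) (h.measurable_x hs ht.le)
    (h.measurable_next hs ht.le) (h.measurable_cols hs ht.le) (h.x_mem s t) (h.nextX_mem s t)
    ?_ par.β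
  refine h.indepFun_step hs ht (g := fun z => (z.1.1, z.2, z.1.2.1)) (by fun_prop) ?_
  exact Measurable.prodMk
    (@measurable_pi_lambda _ _ _ (block B s (t + 1)) _ _ fun i =>
      Batches.measurable_oneJ (mΩ := block B s (t + 1)) le_rfl i)
    (@measurable_pi_lambda _ _ _ (block B s (t + 1)) _ _ fun i =>
      Batches.measurable_twoJ (mΩ := block B s (t + 1)) le_rfl i)

/-- The expected decrease of the smoothed objective in one iteration. -/
theorem gap_step (h : RunAssumptions μ D LF σF σJ MF Mψ par B S T x₀ κ κJ) (hs : s < S)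
    (ht : t ≤ T) {L : ℝ} (hL : L = D.constL par.γ MF LF Mψ) :
    D.gapAt par μ (fun ω => D.nextX par (D.algState par (B ω) T x₀ s t))
        + ENNReal.ofReal (par.θ / (16 * L)) * D.gradSq par μ B T x₀ s t
        + ENNReal.ofReal (L / (2 * par.θ)) * D.stepSq par μ B T x₀ s t
      ≤ D.gapAt par μ (fun ω => (D.algState par (B ω) T x₀ s t).x)
        + ENNReal.ofReal (13 * par.θ / (9 * L) * (‖D.K‖ ^ 2 * Mψ ^ 2))
          * D.errJ par μ B T x₀ s t
        + ENNReal.ofReal (13 * par.θ / (9 * L) * (MF ^ 2 * ‖D.K‖ ^ 4 / par.γ ^ 2))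
          * D.errF par μ B T x₀ s t := by
  have hL0 : 0 < L := hL ▸ h.L_pos
  have hθ := h.θ_pos
  have hx := h.measurable_x hs ht
  have hn := h.measurable_next hs ht
  have hΨ := measurable_PsiS h.standing h.asmPsi h.γ_pos
  have m1 : Measurable fun ω => ENNReal.ofReal
      (D.PsiS par.γ (D.nextX par (D.algState par (B ω) T x₀ s t))
        - (D.Psi0Star.toReal - par.γ * D.Bpsi)) := ((hΨ.comp hn).sub_const _).ennreal_ofReal
  have m2 : Measurable fun ω => ENNReal.ofReal
      (D.PsiS par.γ (D.algState par (B ω) T x₀ s t).x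
        - (D.Psi0Star.toReal - par.γ * D.Bpsi)) := ((hΨ.comp hx).sub_const _).ennreal_ofReal
  have m3 : Measurable fun ω => ENNReal.ofReal (‖D.nextX par (D.algState par (B ω) T x₀ s t)
      - (D.algState par (B ω) T x₀ s t).x‖ ^ 2) := ((hn.sub hx).norm.pow_const 2).ennreal_ofReal
  have m4 : Measurable fun ω => ENNReal.ofReal (‖cols (D.algState par (B ω) T x₀ s t).Jest
      - D.meanCols (D.algState par (B ω) T x₀ s t).x‖ ^ 2) :=
    (((h.measurable_cols hs ht).sub ((measurable_meanCols h.standing).comp hx)).norm.pow_const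
      2).ennreal_ofReal
  have m5 : Measurable fun ω => ENNReal.ofReal (‖(D.algState par (B ω) T x₀ s t).Fest
      - D.meanF (D.algState par (B ω) T x₀ s t).x‖ ^ 2) :=
    (((h.measurable_Fest hs ht).sub ((measurable_meanF h.standing).comp hx)).norm.pow_const
      2).ennreal_ofReal
  unfold gapAt gradSq stepSq errJ errF
  rw [← lintegral_const_mul' _ _ ENNReal.ofReal_ne_top, ← lintegral_const_mul _ m3,
    ← lintegral_const_mul _ m4, ← lintegral_const_mul _ m5, ← lintegral_add_left m1,
    ← lintegral_add_right _ (m3.const_mul _), ← lintegral_add_left m2,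
    ← lintegral_add_right _ (m5.const_mul _)]
  refine lintegral_mono fun ω => ?_
  have hd := PsiS_nextPt_le h.standing h.K_ne h.asmF h.asmPsi h.γ_pos hθ h.θ_le hL
    (hL ▸ h.η_eq) (h.x_mem s t ω) (cols (D.algState par (B ω) T x₀ s t).Jest)
    (D.algState par (B ω) T x₀ s t).Fest
  rw [← nextX_eq] at hd
  -- Nonnegativity of both gaps is what makes `ENNReal.ofReal` additive on the two sides.
  have l1 := PsiS_lower h.standing h.asmPsi h.γ_pos.le (h.nextX_mem s t ω)
  have l2 := PsiS_lower h.standing h.asmPsi h.γ_pos.le (h.x_mem s t ω)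
  rw [← sub_nonneg] at l1 l2
  rw [← ENNReal.ofReal_mul (by positivity), ← ENNReal.ofReal_mul (by positivity),
    ← ENNReal.ofReal_mul (by positivity), ← ENNReal.ofReal_mul (by positivity),
    ← ENNReal.ofReal_add l1 (by positivity), ← ENNReal.ofReal_add (by positivity) (by positivity),
    ← ENNReal.ofReal_add l2 (by positivity), ← ENNReal.ofReal_add (by positivity) (by positivity)]
  refine ENNReal.ofReal_le_ofReal ?_
  unfold estErr at hd
  rw [mul_add] at hd
  linarith

end RunAssumptions

/-! ### Summation over the iterations of one stage -/

/-- With weights `De / (1 - b)` and `Dj / (1 - b)` on the errors, one contraction step releases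
exactly the amounts `De * e t` and `Dj * j t` that the descent inequality spends. Condition `hC`
says that the growth of the errors caused by `x t` is covered by `C * x t`. -/
theorem stage_sum_real {w g x e j : ℕ → ℝ} {T : ℕ} {A C De Dj b c₁ c₂ d₁ d₂ e₀ j₀ : ℝ}
    (hx : ∀ t, 0 ≤ x t) (he : ∀ t, 0 ≤ e t) (hj : ∀ t, 0 ≤ j t) (hDe : 0 ≤ De) (hDj : 0 ≤ Dj)
    (hb : 0 ≤ b) (hb1 : b < 1) (he0 : e 0 ≤ e₀) (hj0 : j 0 ≤ j₀)
    (hw : ∀ t ≤ T, w (t + 1) + A * g t + C * x t ≤ w t + Dj * j t + De * e t)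
    (hes : ∀ t < T, e (t + 1) ≤ b * e t + c₁ * x t + c₂)
    (hjs : ∀ t < T, j (t + 1) ≤ b * j t + d₁ * x t + d₂)
    (hC0 : 0 ≤ C) (hC : (De * c₁ + Dj * d₁) / (1 - b) ≤ C) :
    w (T + 1) + A * ∑ t ∈ Finset.range (T + 1), g t
      ≤ w 0 + (De * (e₀ + T * c₂) + Dj * (j₀ + T * d₂)) / (1 - b) := by
  have hρ : 0 < 1 - b := by linarith
  rw [div_le_iff₀ hρ] at hC
  set ρ := 1 - b with hρdef
  have key : ∀ t ≤ T, w t + De / ρ * e t + Dj / ρ * j t + A * ∑ i ∈ Finset.range t, g i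
      ≤ w 0 + (De * (e₀ + t * c₂) + Dj * (j₀ + t * d₂)) / ρ := by
    intro t
    induction t with
    | zero =>
      intro _
      have h1 : De / ρ * e 0 ≤ De / ρ * e₀ := by gcongr
      have h2 : Dj / ρ * j 0 ≤ Dj / ρ * j₀ := by gcongr
      have h3 : (De * (e₀ + (0 : ℕ) * c₂) + Dj * (j₀ + (0 : ℕ) * d₂)) / ρ
          = De / ρ * e₀ + Dj / ρ * j₀ := by push_cast; ring
      rw [h3]; simp only [Finset.range_zero, Finset.sum_empty, mul_zero]; linarith
    | succ t ih =>
      intro ht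
      have h0 := ih (by omega)
      have h1 := hw t (by omega)
      have h2 : De / ρ * e (t + 1) ≤ De / ρ * (b * e t + c₁ * x t + c₂) := by
        gcongr; exact hes t (by omega)
      have h3 : Dj / ρ * j (t + 1) ≤ Dj / ρ * (b * j t + d₁ * x t + d₂) := by
        gcongr; exact hjs t (by omega)
      have h4 : (De / ρ * c₁ + Dj / ρ * d₁) * x t ≤ C * x t := by
        refine mul_le_mul_of_nonneg_right ?_ (hx t)
        have : De / ρ * c₁ + Dj / ρ * d₁ = (De * c₁ + Dj * d₁) / ρ := by ring
        rw [this, div_le_iff₀ hρ]; exact hC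
      have h5 : De / ρ * (b * e t) = De / ρ * e t - De * e t := by
        have : b = 1 - ρ := by rw [hρdef]; ring
        rw [this]; field_simp
      have h6 : Dj / ρ * (b * j t) = Dj / ρ * j t - Dj * j t := by
        have : b = 1 - ρ := by rw [hρdef]; ring
        rw [this]; field_simp
      have h7 : (De * (e₀ + (t + 1 : ℕ) * c₂) + Dj * (j₀ + (t + 1 : ℕ) * d₂)) / ρ
          = (De * (e₀ + t * c₂) + Dj * (j₀ + t * d₂)) / ρ + De / ρ * c₂ + Dj / ρ * d₂ := by
        push_cast; ring
      rw [h7, Finset.sum_range_succ, mul_add A]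
      rw [mul_add, mul_add] at h2 h3
      linarith
  have h0 := key T le_rfl
  have h1 := hw T le_rfl
  -- After the last descent step the estimators are not updated again, so the stored error terms pay
  -- directly; this suffices because `1 - b ≤ 1`.
  have h2 : De * e T ≤ De / ρ * e T :=
    mul_le_mul_of_nonneg_right (le_div_self hDe hρ (by linarith)) (he T)
  have h3 : Dj * j T ≤ Dj / ρ * j T :=
    mul_le_mul_of_nonneg_right (le_div_self hDj hρ (by linarith)) (hj T)
  have h4 : 0 ≤ C * x T := mul_nonneg hC0 (hx T)
  rw [Finset.sum_range_succ, mul_add]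
  linarith

/-- A finite start makes every later quantity finite: the descent inequality bounds the next gap
and, since `A` and `C` are positive, also `g t` and `x t`; the recursions then bound the next
errors. After that the real version applies. -/
theorem stage_sum {w g x e j : ℕ → ENNReal} {T : ℕ} {A C De Dj b c₁ c₂ d₁ d₂ e₀ j₀ : ℝ}
    (hA : 0 < A) (hC0 : 0 < C) (hDe : 0 ≤ De) (hDj : 0 ≤ Dj) (hb : 0 ≤ b) (hb1 : b < 1)
    (hc₁ : 0 ≤ c₁) (hc₂ : 0 ≤ c₂) (hd₁ : 0 ≤ d₁) (hd₂ : 0 ≤ d₂) (he₀ : 0 ≤ e₀) (hj₀ : 0 ≤ j₀)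
    (hw0 : w 0 ≠ ⊤) (he0 : e 0 ≤ ENNReal.ofReal e₀) (hj0 : j 0 ≤ ENNReal.ofReal j₀)
    (hw : ∀ t ≤ T, w (t + 1) + ENNReal.ofReal A * g t + ENNReal.ofReal C * x t
      ≤ w t + ENNReal.ofReal Dj * j t + ENNReal.ofReal De * e t)
    (hes : ∀ t < T, e (t + 1) ≤ ENNReal.ofReal b * e t + ENNReal.ofReal c₁ * x t
      + ENNReal.ofReal c₂)
    (hjs : ∀ t < T, j (t + 1) ≤ ENNReal.ofReal b * j t + ENNReal.ofReal d₁ * x t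
      + ENNReal.ofReal d₂)
    (hC : (De * c₁ + Dj * d₁) / (1 - b) ≤ C) :
    w (T + 1) + ENNReal.ofReal A * ∑ t ∈ Finset.range (T + 1), g t
      ≤ w 0 + ENNReal.ofReal ((De * (e₀ + T * c₂) + Dj * (j₀ + T * d₂)) / (1 - b)) := by
  have hAe : ENNReal.ofReal A ≠ 0 := by simpa using hA
  have hCe : ENNReal.ofReal C ≠ 0 := by simpa using hC0
  have hmul : ∀ (r : ℝ) {y : ENNReal}, y ≠ ⊤ → ENNReal.ofReal r * y ≠ ⊤ := fun r y hy =>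
    ENNReal.mul_ne_top ENNReal.ofReal_ne_top hy
  have hmul' : ∀ {r : ENNReal} {y : ENNReal}, r ≠ 0 → r * y ≠ ⊤ → y ≠ ⊤ := by
    intro r y hr h hy
    exact h (by rw [hy, ENNReal.mul_top hr])
  have step : ∀ t ≤ T, w t ≠ ⊤ → e t ≠ ⊤ → j t ≠ ⊤ → w (t + 1) ≠ ⊤ ∧ g t ≠ ⊤ ∧ x t ≠ ⊤ := by
    intro t ht h1 h2 h3
    have h4 := ne_top_of_le_ne_top
      (ENNReal.add_ne_top.2 ⟨ENNReal.add_ne_top.2 ⟨h1, hmul Dj h3⟩, hmul De h2⟩) (hw t ht)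
    obtain ⟨h5, h6⟩ := ENNReal.add_ne_top.1 h4
    obtain ⟨h7, h8⟩ := ENNReal.add_ne_top.1 h5
    exact ⟨h7, hmul' hAe h8, hmul' hCe h6⟩
  have fin : ∀ t ≤ T, w t ≠ ⊤ ∧ e t ≠ ⊤ ∧ j t ≠ ⊤ := by
    intro t
    induction t with
    | zero =>
      exact fun _ => ⟨hw0, ne_top_of_le_ne_top ENNReal.ofReal_ne_top he0,
        ne_top_of_le_ne_top ENNReal.ofReal_ne_top hj0⟩
    | succ t ih =>
      intro ht
      obtain ⟨h1, h2, h3⟩ := ih (by omega)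
      obtain ⟨h4, -, h6⟩ := step t (by omega) h1 h2 h3
      exact ⟨h4, ne_top_of_le_ne_top (ENNReal.add_ne_top.2
          ⟨ENNReal.add_ne_top.2 ⟨hmul b h2, hmul c₁ h6⟩, ENNReal.ofReal_ne_top⟩) (hes t (by omega)),
        ne_top_of_le_ne_top (ENNReal.add_ne_top.2
          ⟨ENNReal.add_ne_top.2 ⟨hmul b h3, hmul d₁ h6⟩, ENNReal.ofReal_ne_top⟩)
          (hjs t (by omega))⟩
  have fin' : ∀ t ≤ T, w (t + 1) ≠ ⊤ ∧ g t ≠ ⊤ ∧ x t ≠ ⊤ := fun t ht =>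
    step t ht (fin t ht).1 (fin t ht).2.1 (fin t ht).2.2
  have real := stage_sum_real (w := fun t => (w t).toReal) (g := fun t => (g t).toReal)
    (x := fun t => (x t).toReal) (e := fun t => (e t).toReal) (j := fun t => (j t).toReal)
    (T := T) (A := A) (C := C) (De := De) (Dj := Dj) (b := b) (c₁ := c₁) (c₂ := c₂) (d₁ := d₁)
    (d₂ := d₂) (e₀ := e₀) (j₀ := j₀) (fun _ => ENNReal.toReal_nonneg)
    (fun _ => ENNReal.toReal_nonneg) (fun _ => ENNReal.toReal_nonneg) hDe hDj hb hb1
    (ENNReal.toReal_le_of_le_ofReal he₀ he0) (ENNReal.toReal_le_of_le_ofReal hj₀ hj0)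
    (by
      intro t ht
      obtain ⟨h1, h2, h3⟩ := fin t ht
      obtain ⟨h4, h5, h6⟩ := fin' t ht
      have h := ENNReal.toReal_mono
        (ENNReal.add_ne_top.2 ⟨ENNReal.add_ne_top.2 ⟨h1, hmul Dj h3⟩, hmul De h2⟩) (hw t ht)
      rwa [ENNReal.toReal_add (ENNReal.add_ne_top.2 ⟨h4, hmul A h5⟩) (hmul C h6),
        ENNReal.toReal_add h4 (hmul A h5),
        ENNReal.toReal_add (ENNReal.add_ne_top.2 ⟨h1, hmul Dj h3⟩) (hmul De h2),
        ENNReal.toReal_add h1 (hmul Dj h3), ENNReal.toReal_mul, ENNReal.toReal_mul,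
        ENNReal.toReal_mul, ENNReal.toReal_mul, ENNReal.toReal_ofReal hA.le,
        ENNReal.toReal_ofReal hC0.le, ENNReal.toReal_ofReal hDj, ENNReal.toReal_ofReal hDe] at h)
    (by
      intro t ht
      obtain ⟨h1, h2, h3⟩ := fin t ht.le
      obtain ⟨h4, h5, h6⟩ := fin' t ht.le
      have h7 := ENNReal.add_ne_top.2 ⟨hmul b h2, hmul c₁ h6⟩
      have h := ENNReal.toReal_mono (ENNReal.add_ne_top.2 ⟨h7, ENNReal.ofReal_ne_top⟩) (hes t ht)
      rwa [ENNReal.toReal_add h7 ENNReal.ofReal_ne_top,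
        ENNReal.toReal_add (hmul b h2) (hmul c₁ h6), ENNReal.toReal_mul, ENNReal.toReal_mul,
        ENNReal.toReal_ofReal hb, ENNReal.toReal_ofReal hc₁, ENNReal.toReal_ofReal hc₂] at h)
    (by
      intro t ht
      obtain ⟨h1, h2, h3⟩ := fin t ht.le
      obtain ⟨h4, h5, h6⟩ := fin' t ht.le
      have h7 := ENNReal.add_ne_top.2 ⟨hmul b h3, hmul d₁ h6⟩
      have h := ENNReal.toReal_mono (ENNReal.add_ne_top.2 ⟨h7, ENNReal.ofReal_ne_top⟩) (hjs t ht)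
      rwa [ENNReal.toReal_add h7 ENNReal.ofReal_ne_top,
        ENNReal.toReal_add (hmul b h3) (hmul d₁ h6), ENNReal.toReal_mul, ENNReal.toReal_mul,
        ENNReal.toReal_ofReal hb, ENNReal.toReal_ofReal hd₁, ENNReal.toReal_ofReal hd₂] at h)
    hC0.le hC
  have hg : ∀ t ∈ Finset.range (T + 1), g t ≠ ⊤ := fun t ht =>
    (fin' t (by have := Finset.mem_range.1 ht; omega)).2.1
  have hsum : ∑ t ∈ Finset.range (T + 1), g t ≠ ⊤ := ENNReal.sum_ne_top.2 hg
  rw [← ENNReal.toReal_sum hg] at real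
  have h1 := (fin' T le_rfl).1
  have hρ : 0 < 1 - b := by linarith
  rw [← ENNReal.ofReal_toReal h1, ← ENNReal.ofReal_toReal hw0, ← ENNReal.ofReal_toReal hsum,
    ← ENNReal.ofReal_mul hA.le, ← ENNReal.ofReal_add ENNReal.toReal_nonneg (by positivity),
    ← ENNReal.ofReal_add ENNReal.toReal_nonneg (by positivity)]
  exact ENNReal.ofReal_le_ofReal real

/-! ### Summation over all stages -/

namespace RunAssumptions

open MinimaxData Batches

variable {p n q : ℕ} {Ξ Ω : Type*} [MeasurableSpace Ξ] [mΩ : MeasurableSpace Ω]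
  {μ : Measure Ω} [IsProbabilityMeasure μ] {D : MinimaxData p n q Ξ} {LF σF σJ MF Mψ : ℝ}
  {par : StepParams} {b₀ bJ₀ b₁ bJ₁ b₂ bJ₂ : ℕ} {B : Ω → Batches Ξ b₀ bJ₀ b₁ bJ₁ b₂ bJ₂}
  {S T : ℕ} {x₀ : Euc p} {κ κJ : ℝ} {s t : ℕ}

/-- Only the objective gap passes from one stage to the next. The estimator errors are discarded at
a restart and replaced by those of the initial batches, so every stage adds the same noise `K₀`. -/
theorem sum_gradSq_le (h : RunAssumptions μ D LF σF σJ MF Mψ par B S T x₀ κ κJ) {L De Dj K₀ : ℝ}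
    (hL : L = D.constL par.γ MF LF Mψ)
    (hDe : De = 13 * par.θ / (9 * L) * (MF ^ 2 * ‖D.K‖ ^ 4 / par.γ ^ 2))
    (hDj : Dj = 13 * par.θ / (9 * L) * (‖D.K‖ ^ 2 * Mψ ^ 2))
    (hβ : 0 ≤ par.β) (hβ1 : par.β < 1)
    (hC : (De * (κ * (par.β ^ 2 / b₁) * MF ^ 2) + Dj * (κJ * (par.β ^ 2 / bJ₁) * LF ^ 2))
      / (1 - par.β ^ 2) ≤ L / (2 * par.θ))
    (hK₀ : (De * (σF ^ 2 / b₀ + T * (κ * ((1 - par.β) ^ 2 / b₂) * σF ^ 2))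
      + Dj * (σJ ^ 2 / bJ₀ + T * (κJ * ((1 - par.β) ^ 2 / bJ₂) * σJ ^ 2)))
      / (1 - par.β ^ 2) ≤ K₀) :
    ENNReal.ofReal (par.θ / (16 * L))
        * ∑ s ∈ Finset.range S, ∑ t ∈ Finset.range (T + 1), D.gradSq par μ B T x₀ s t
      ≤ ENNReal.ofReal (D.PsiS par.γ x₀ - (D.Psi0Star.toReal - par.γ * D.Bpsi))
        + S * ENNReal.ofReal K₀ := by
  have hL0 : 0 < L := hL ▸ h.L_pos
  have hθ := h.θ_pos
  have hκ0 : 0 ≤ κ := by rcases h.kappa with rfl | ⟨rfl, -⟩ <;> norm_num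
  have hκJ0 : 0 ≤ κJ := by rcases h.kappaJ with rfl | ⟨rfl, -⟩ <;> norm_num
  set w : ℕ → ℕ → ENNReal := fun s t =>
    D.gapAt par μ fun ω => (D.algState par (B ω) T x₀ s t).x with hw
  have h00 : w 0 0
      = ENNReal.ofReal (D.PsiS par.γ x₀ - (D.Psi0Star.toReal - par.γ * D.Bpsi)) := by
    have : w 0 0 = ∫⁻ _ : Ω, ENNReal.ofReal
        (D.PsiS par.γ x₀ - (D.Psi0Star.toReal - par.γ * D.Bpsi)) ∂μ := rfl
    rw [this, lintegral_const, measure_univ, mul_one]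
  -- The start of stage `s + 1` is by definition the iterate of index `T + 1` of stage `s`, so the
  -- bound of one stage already has the telescoping form.
  have hstage : ∀ s < S, w s 0 ≠ ⊤ → w (s + 1) 0 + ENNReal.ofReal (par.θ / (16 * L))
      * ∑ t ∈ Finset.range (T + 1), D.gradSq par μ B T x₀ s t ≤ w s 0 + ENNReal.ofReal K₀ := by
    intro s hs hfin
    refine (stage_sum (w := w s) (g := D.gradSq par μ B T x₀ s) (x := D.stepSq par μ B T x₀ s)
      (e := D.errF par μ B T x₀ s) (j := D.errJ par μ B T x₀ s) (T := T)
      (A := par.θ / (16 * L)) (C := L / (2 * par.θ)) (De := De) (Dj := Dj) (b := par.β ^ 2)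
      (c₁ := κ * (par.β ^ 2 / b₁) * MF ^ 2) (c₂ := κ * ((1 - par.β) ^ 2 / b₂) * σF ^ 2)
      (d₁ := κJ * (par.β ^ 2 / bJ₁) * LF ^ 2) (d₂ := κJ * ((1 - par.β) ^ 2 / bJ₂) * σJ ^ 2)
      (e₀ := σF ^ 2 / b₀) (j₀ := σJ ^ 2 / bJ₀) (by positivity) (by positivity)
      (by rw [hDe]; positivity) (by rw [hDj]; positivity) (by positivity)
      (by nlinarith) (by positivity) (by positivity) (by positivity) (by positivity)
      (by positivity) (by positivity) hfin (h.errF_zero_le hs) (h.errJ_zero_le hs)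
      (fun t ht => ?_) (fun t ht => h.errF_succ_le hs ht) (fun t ht => h.errJ_succ_le hs ht)
      hC).trans ?_
    · rw [hDe, hDj]; exact h.gap_step hs ht hL
    · gcongr
  have key : ∀ s ≤ S, w s 0 + ENNReal.ofReal (par.θ / (16 * L))
      * ∑ i ∈ Finset.range s, ∑ t ∈ Finset.range (T + 1), D.gradSq par μ B T x₀ i t
      ≤ w 0 0 + s * ENNReal.ofReal K₀ := by
    intro s
    induction s with
    | zero => simp
    | succ s ih =>
      intro hs
      have h1 := ih (by omega)
      have hfin : w s 0 ≠ ⊤ := by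
        refine ne_top_of_le_ne_top ?_ (le_self_add.trans h1)
        refine ENNReal.add_ne_top.2 ⟨?_, ENNReal.mul_ne_top (ENNReal.natCast_ne_top s)
          ENNReal.ofReal_ne_top⟩
        rw [h00]
        exact ENNReal.ofReal_ne_top
      have h2 := hstage s (by omega) hfin
      rw [Finset.sum_range_succ, mul_add]
      calc _ = (w (s + 1) 0 + ENNReal.ofReal (par.θ / (16 * L))
              * ∑ t ∈ Finset.range (T + 1), D.gradSq par μ B T x₀ s t)
            + ENNReal.ofReal (par.θ / (16 * L))
              * ∑ i ∈ Finset.range s, ∑ t ∈ Finset.range (T + 1), D.gradSq par μ B T x₀ i t := by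
            ring
        _ ≤ (w s 0 + ENNReal.ofReal K₀) + ENNReal.ofReal (par.θ / (16 * L))
              * ∑ i ∈ Finset.range s, ∑ t ∈ Finset.range (T + 1), D.gradSq par μ B T x₀ i t := by
            gcongr
        _ = (w s 0 + ENNReal.ofReal (par.θ / (16 * L))
              * ∑ i ∈ Finset.range s, ∑ t ∈ Finset.range (T + 1), D.gradSq par μ B T x₀ i t)
            + ENNReal.ofReal K₀ := by ring
        _ ≤ (w 0 0 + s * ENNReal.ofReal K₀) + ENNReal.ofReal K₀ := by gcongr
        _ = _ := by push_cast; ring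
  exact (le_add_self.trans (key S le_rfl)).trans_eq (by rw [h00])

/-! ### The random output -/

theorem measurable_output (h : RunAssumptions μ D LF σF σJ MF Mψ par B S T x₀ κ κJ)
    {τ : Ω → Fin S × Fin (T + 1)} (hτ : Measurable τ) :
    Measurable fun ω => D.iterate par (B ω) T x₀ (τ ω).1 (τ ω).2 := by
  have h1 : Measurable fun z : (Fin S × Fin (T + 1)) × Ω =>
      (D.algState par (B z.2) T x₀ z.1.1 z.1.2).x :=
    measurable_from_prod_countable_right fun i => h.measurable_x i.1.2 (Nat.le_of_lt_succ i.2.2)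
  exact h1.comp (hτ.prodMk measurable_id)

theorem measurable_core_iSup (h : RunAssumptions μ D LF σF σJ MF Mψ par B S T x₀ κ κJ)
    (hs : s < S) (ht : t ≤ T) :
    Measurable[⨆ st : Fin S × Fin (T + 1), block B st.1 st.2]
      fun ω => D.core par (B ω) T x₀ s t := by
  have hb : ∀ s' < S, ∀ t' ≤ T,
      block B s' t' ≤ ⨆ st : Fin S × Fin (T + 1), block B st.1 st.2 := fun s' hs' t' ht' =>
    le_iSup (fun st : Fin S × Fin (T + 1) => block B st.1 st.2)
      (⟨s', hs'⟩, ⟨t', Nat.lt_succ_of_le ht'⟩)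
  exact MinimaxData.measurable_core (mΩ := ⨆ st : Fin S × Fin (T + 1), block B st.1 st.2)
    h.standing h.asmPsi h.γ_pos h.η_pos (fun s' hs' t' ht' => hb s' (hs'.trans hs) t' ht')
    fun t' ht' => hb s hs t' (ht'.trans ht)

/-- The integrand is split over the events `τ = i`. Each event is independent of all samples and has
the same probability, so the expectation is the average over all iterates. -/
theorem lintegral_output (h : RunAssumptions μ D LF σF σJ MF Mψ par B S T x₀ κ κJ)
    {τ : Ω → Fin S × Fin (T + 1)} (hτ : UniformOutput B μ S T τ) :
    ∫⁻ ω, ENNReal.ofReal (‖D.gradMap par.γ par.η (D.iterate par (B ω) T x₀ (τ ω).1 (τ ω).2)‖ ^ 2)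
        ∂μ
      = ENNReal.ofReal (1 / ((S : ℝ) * ((T : ℝ) + 1)))
        * ∑ s ∈ Finset.range S, ∑ t ∈ Finset.range (T + 1), D.gradSq par μ B T x₀ s t := by
  classical
  obtain ⟨G, hGm, hG⟩ := exists_measurable_gradMap h.standing h.asmF h.asmPsi h.γ_pos h.η_pos
  have hGx : ∀ s t ω, D.gradMap par.γ par.η (D.algState par (B ω) T x₀ s t).x
      = G (D.algState par (B ω) T x₀ s t).x := fun s t ω => hG _ (h.x_mem s t ω)
  set f : Fin S × Fin (T + 1) → Ω → ENNReal := fun i ω =>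
    ENNReal.ofReal (‖D.gradMap par.γ par.η (D.algState par (B ω) T x₀ i.1 i.2).x‖ ^ 2) with hf
  have hsplit : ∀ ω, ENNReal.ofReal
      (‖D.gradMap par.γ par.η (D.iterate par (B ω) T x₀ (τ ω).1 (τ ω).2)‖ ^ 2)
      = ∑ i, (τ ⁻¹' {i}).indicator 1 ω * f i ω := by
    intro ω
    rw [Finset.sum_eq_single (τ ω)]
    · simp [hf]; rfl
    · intro i _ hi
      rw [Set.indicator_of_notMem (by simpa using hi.symm), zero_mul]
    · simp
  have hle : (⨆ st : Fin S × Fin (T + 1), block B st.1 st.2) ≤ mΩ :=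
    iSup_le fun st => h.adm.block_le st.1.2 (by omega)
  have hfm : ∀ i, Measurable[⨆ st : Fin S × Fin (T + 1), block B st.1 st.2] (f i) := by
    intro i
    have hφ : Measurable fun z : Euc p × Cols p q × Euc q => ENNReal.ofReal (‖G z.1‖ ^ 2) :=
      ((hGm.comp measurable_fst).norm.pow_const 2).ennreal_ofReal
    have hi : f i = (fun z : Euc p × Cols p q × Euc q => ENNReal.ofReal (‖G z.1‖ ^ 2))
        ∘ fun ω => D.core par (B ω) T x₀ i.1 i.2 := by
      funext ω
      simp only [hf, hGx, Function.comp, core]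
    rw [hi]
    exact hφ.comp (h.measurable_core_iSup i.1.2 (Nat.le_of_lt_succ i.2.2))
  have hτm : ∀ i, MeasurableSet (τ ⁻¹' {i}) := fun i => hτ.meas (measurableSet_singleton i)
  have hm : ∀ i, Measurable fun ω => (τ ⁻¹' {i}).indicator (1 : Ω → ENNReal) ω * f i ω := fun i =>
    (measurable_one.indicator (hτm i)).mul ((hfm i).mono hle le_rfl)
  simp_rw [hsplit]
  rw [lintegral_finsetSum _ fun i _ => hm i]
  have hone : ∀ i, ∫⁻ ω, (τ ⁻¹' {i}).indicator 1 ω * f i ω ∂μ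
      = ENNReal.ofReal (1 / ((S : ℝ) * ((T : ℝ) + 1))) * D.gradSq par μ B T x₀ i.1 i.2 := by
    intro i
    have hind : Measurable[MeasurableSpace.comap τ inferInstance]
        ((τ ⁻¹' {i}).indicator (1 : Ω → ENNReal)) := by
      have hi : (τ ⁻¹' {i}).indicator (1 : Ω → ENNReal)
          = ({i} : Set (Fin S × Fin (T + 1))).indicator 1 ∘ τ := by
        ext ω; simp only [Set.indicator, Function.comp]; rfl
      rw [hi]
      exact (measurable_of_countable _).comp (comap_measurable τ)
    rw [lintegral_mul_eq_lintegral_mul_lintegral_of_independent_measurableSpace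
      hτ.meas.comap_le hle hτ.indep
      hind (hfm i),
      lintegral_indicator_one (hτm i), hτ.uniform i]
    rfl
  simp_rw [hone]
  rw [← Finset.mul_sum, Fintype.sum_prod_type, Finset.sum_range]
  congr 1
  refine Finset.sum_congr rfl fun s _ => ?_
  rw [Finset.sum_range]

end RunAssumptions

/-! ### Numbers of oracle calls -/

namespace MinimaxData

variable {p n q : ℕ} {Ξ : Type*} [MeasurableSpace Ξ] (D : MinimaxData p n q Ξ)
  (par : StepParams) {b₀ bJ₀ b₁ bJ₁ b₂ bJ₂ : ℕ} (B : Batches Ξ b₀ bJ₀ b₁ bJ₁ b₂ bJ₂)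
  (T : ℕ) (x₀ : Euc p)

theorem length_logF_stageState (s : ℕ) (lF lJ : List (Euc p × Ξ)) (t : ℕ) :
    (D.stageState par B s x₀ lF lJ t).logF.length = lF.length + (b₀ + t * (2 * b₁ + b₂)) := by
  induction t with
  | zero => simp [stageState, startState]
  | succ t ih => simp [stageState, stepState, ih]; ring

theorem length_logJ_stageState (s : ℕ) (lF lJ : List (Euc p × Ξ)) (t : ℕ) :
    (D.stageState par B s x₀ lF lJ t).logJ.length = lJ.length + (bJ₀ + t * (2 * bJ₁ + bJ₂)) := by
  induction t with
  | zero => simp [stageState, startState]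
  | succ t ih => simp [stageState, stepState, ih]; ring

/-- Each sample of the first batch is queried at two points, the new iterate and the old one, hence
the factor `2`. -/
theorem evalsF_eq (S : ℕ) : D.evalsF par B T x₀ S = S * (b₀ + T * (2 * b₁ + b₂)) := by
  unfold evalsF
  induction S with
  | zero => simp [restart]
  | succ S ih => simp only [restart, length_logF_stageState, ih]; ring

theorem evalsJ_eq (S : ℕ) : D.evalsJ par B T x₀ S = S * (bJ₀ + T * (2 * bJ₁ + bJ₂)) := by
  unfold evalsJ
  induction S with
  | zero => simp [restart]
  | succ S ih => simp only [restart, length_logJ_stageState, ih]; ring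

end MinimaxData

/-! ### Arithmetic of the parameters -/

section Arithmetic

variable {K MF LF Mψ σF σJ c₀ κ κJ γ β θ L P Q b b₀ b₁ bJ₀ T : ℝ}

/-- `P²` is defined so that the left numerator is at most `θ β² P² / (2 L b)`. By `θ P = L b γ` and
`1 - β = b γ²` this equals `L / (2θ)` times `β² (1 - β)`, and `β² (1 - β) ≤ 1 - β²`. -/
theorem coupling_le (hc₀ : 0 < c₀) (hγ : 0 < γ) (hb : 0 < b) (hβ0 : 0 < β)
    (hβ : 1 - β = b * γ ^ 2) (hθ0 : 0 < θ) (hL : 0 < L) (hθ : θ * P = L * (b * γ))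
    (hP : P ^ 2 = 26 * K ^ 2 / (9 * c₀) * (κ * MF ^ 4 * K ^ 2 + c₀ * κJ * LF ^ 2 * Mψ ^ 2))
    (hκ : 0 ≤ κ) (hb₁0 : 0 < b₁) (hb₁ : c₀ * b ≤ b₁ * γ ^ 2) :
    (13 * θ / (9 * L) * (MF ^ 2 * K ^ 4 / γ ^ 2) * (κ * (β ^ 2 / b₁) * MF ^ 2)
      + 13 * θ / (9 * L) * (K ^ 2 * Mψ ^ 2) * (κJ * (β ^ 2 / b) * LF ^ 2)) / (1 - β ^ 2)
      ≤ L / (2 * θ) := by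
  have hβ1 : 0 < 1 - β := by rw [hβ]; positivity
  have hβ2 : 0 < 1 - β ^ 2 := by nlinarith
  rw [div_le_iff₀ hβ2]
  have h1 : 1 / (γ ^ 2 * b₁) ≤ 1 / (c₀ * b) :=
    one_div_le_one_div_of_le (by positivity) (by linarith)
  have h2 : 13 * θ / (9 * L) * (MF ^ 2 * K ^ 4 / γ ^ 2) * (κ * (β ^ 2 / b₁) * MF ^ 2)
      ≤ 13 * θ / (9 * L) * (MF ^ 4 * K ^ 4 * κ * β ^ 2) * (1 / (c₀ * b)) := by
    calc _ = 13 * θ / (9 * L) * (MF ^ 4 * K ^ 4 * κ * β ^ 2) * (1 / (γ ^ 2 * b₁)) := by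
          field_simp
      _ ≤ _ := by gcongr
  have h3 : 13 * θ / (9 * L) * (MF ^ 4 * K ^ 4 * κ * β ^ 2) * (1 / (c₀ * b))
      + 13 * θ / (9 * L) * (K ^ 2 * Mψ ^ 2) * (κJ * (β ^ 2 / b) * LF ^ 2)
      = θ * β ^ 2 / (2 * L * b) * P ^ 2 := by
    rw [hP]; field_simp; ring
  have h4 : θ * β ^ 2 / (2 * L * b) * P ^ 2 = L / (2 * θ) * (β ^ 2 * (1 - β)) := by
    rw [hβ]
    have : θ * β ^ 2 / (2 * L * b) * P ^ 2 = β ^ 2 / (2 * L * b * θ) * (θ * P) ^ 2 := by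
      field_simp
    rw [this, hθ]; field_simp
  have h5 : β ^ 2 * (1 - β) ≤ 1 - β ^ 2 := by nlinarith [mul_pos hβ0 hβ1, mul_pos hβ1 hβ1]
  have h6 : L / (2 * θ) * (β ^ 2 * (1 - β)) ≤ L / (2 * θ) * (1 - β ^ 2) := by gcongr
  linarith

/-- The batch sizes are tuned to powers of `γ` so that the errors of `F`, despite their weight `1 /
γ²`, are of the same order as those of the Jacobian. Both then combine into `Q`; the initial batches
produce `1 / b` and the `T` updates produce `T γ²`. -/
theorem noise_le (hc₀ : 0 < c₀) (hγ : 0 < γ) (hb : 0 < b) (hβ0 : 0 < β)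
    (hβ : 1 - β = b * γ ^ 2) (hθ0 : 0 < θ) (hL : 0 < L)
    (hQ : Q = 26 / (9 * c₀) * K ^ 2 * (κ * MF ^ 2 * K ^ 2 * σF ^ 2 + c₀ * κJ * Mψ ^ 2 * σJ ^ 2))
    (hκ : 1 ≤ κ) (hκJ : 1 ≤ κJ) (hb₁0 : 0 < b₁) (hb₁ : c₀ * b ≤ b₁ * γ ^ 2)
    (hb₀0 : 0 < b₀) (hb₀ : c₀ ≤ b₀ * γ ^ 4) (hbJ₀0 : 0 < bJ₀) (hbJ₀ : 1 ≤ bJ₀ * γ ^ 2)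
    (hT : 0 ≤ T) :
    (13 * θ / (9 * L) * (MF ^ 2 * K ^ 4 / γ ^ 2)
        * (σF ^ 2 / b₀ + T * (κ * ((1 - β) ^ 2 / b₁) * σF ^ 2))
      + 13 * θ / (9 * L) * (K ^ 2 * Mψ ^ 2)
        * (σJ ^ 2 / bJ₀ + T * (κJ * ((1 - β) ^ 2 / b) * σJ ^ 2))) / (1 - β ^ 2)
      ≤ θ / (16 * L) * (8 * Q * (1 / b + T * γ ^ 2)) := by
  have hβ1 : 0 < 1 - β := by rw [hβ]; positivity
  have hβ2 : 0 < 1 - β ^ 2 := by nlinarith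
  have hQ0 : 0 ≤ Q := by rw [hQ]; positivity
  rw [div_le_iff₀ hβ2]
  have e1 : σF ^ 2 / b₀ + T * (κ * ((1 - β) ^ 2 / b₁) * σF ^ 2)
      ≤ κ * σF ^ 2 * γ ^ 2 / c₀ * (γ ^ 2 + T * b * γ ^ 4) := by
    have h1 : 1 / b₀ ≤ γ ^ 4 / c₀ := by rw [div_le_div_iff₀ hb₀0 hc₀]; linarith
    have h2 : 1 / b₁ ≤ γ ^ 2 / (c₀ * b) := by
      rw [div_le_div_iff₀ hb₁0 (by positivity)]; linarith
    calc σF ^ 2 / b₀ + T * (κ * ((1 - β) ^ 2 / b₁) * σF ^ 2)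
        = 1 * σF ^ 2 * (1 / b₀) + T * κ * σF ^ 2 * (b * γ ^ 2) ^ 2 * (1 / b₁) := by
          rw [hβ]; ring
      _ ≤ κ * σF ^ 2 * (γ ^ 4 / c₀)
          + T * κ * σF ^ 2 * (b * γ ^ 2) ^ 2 * (γ ^ 2 / (c₀ * b)) := by gcongr
      _ = _ := by field_simp
  have e2 : σJ ^ 2 / bJ₀ + T * (κJ * ((1 - β) ^ 2 / b) * σJ ^ 2)
      ≤ κJ * σJ ^ 2 * (γ ^ 2 + T * b * γ ^ 4) := by
    have h1 : 1 / bJ₀ ≤ γ ^ 2 := by rw [div_le_iff₀ hbJ₀0]; linarith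
    calc σJ ^ 2 / bJ₀ + T * (κJ * ((1 - β) ^ 2 / b) * σJ ^ 2)
        = 1 * σJ ^ 2 * (1 / bJ₀) + T * κJ * σJ ^ 2 * (b * γ ^ 4) := by
          rw [hβ]; field_simp
      _ ≤ κJ * σJ ^ 2 * γ ^ 2 + T * κJ * σJ ^ 2 * (b * γ ^ 4) := by gcongr
      _ = _ := by ring
  calc _ ≤ 13 * θ / (9 * L) * (MF ^ 2 * K ^ 4 / γ ^ 2)
          * (κ * σF ^ 2 * γ ^ 2 / c₀ * (γ ^ 2 + T * b * γ ^ 4))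
        + 13 * θ / (9 * L) * (K ^ 2 * Mψ ^ 2) * (κJ * σJ ^ 2 * (γ ^ 2 + T * b * γ ^ 4)) := by
        gcongr
    _ = θ / (16 * L) * (8 * Q * (1 / b + T * γ ^ 2)) * (1 - β) := by
        rw [hQ, hβ]; field_simp; ring
    _ ≤ θ / (16 * L) * (8 * Q * (1 / b + T * γ ^ 2)) * (1 - β ^ 2) := by
        have : 1 - β ≤ 1 - β ^ 2 := by nlinarith
        gcongr

/-- Since `T + 1` is at least `1 / γ²`, averaging multiplies by at most `γ²` per stage. The number
of stages brings the gap term down to `ε² / 2`. With `1 / b ≤ 1` and `T γ² ≤ 1` the noise is at most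
`16 Q γ² = ε² / 3`. -/
theorem accuracy_le {ε Rhat R₀ S Δ gap : ℝ} (hε : 0 < ε) (hRhat : 0 < Rhat)
    (hγ : γ = ε / √(2 * Rhat)) (hb : 1 ≤ b) (hθ0 : 0 < θ) (hL : 0 < L) (hP0 : 0 < P)
    (hθ : θ * P = L * (b * γ)) (hQ : Rhat = 24 * Q) (hR₀ : R₀ = 16 * P * Δ) (hgap : gap ≤ Δ)
    (hΔ : 0 ≤ Δ) (hT0 : 0 ≤ T) (hT : 1 ≤ (T + 1) * γ ^ 2) (hT1 : T * γ ^ 2 ≤ 1) (hS0 : 0 < S)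
    (hS : √2 * R₀ / (b * ε * √Rhat) ≤ S) :
    1 / (S * (T + 1)) * ((θ / (16 * L))⁻¹
      * (gap + S * (θ / (16 * L) * (8 * Q * (1 / b + T * γ ^ 2))))) ≤ ε ^ 2 := by
  have hb0 : 0 < b := by linarith
  have hγ0 : 0 < γ := by rw [hγ]; positivity
  have hγ2 : γ ^ 2 = ε ^ 2 / (2 * Rhat) := by
    rw [hγ, div_pow, Real.sq_sqrt (by positivity)]
  have hT2 : 1 / (T + 1) ≤ γ ^ 2 := by rw [div_le_iff₀ (by positivity)]; linarith
  have hA : (θ / (16 * L))⁻¹ = 16 * P / (b * γ) := by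
    rw [inv_div, div_eq_div_iff hθ0.ne' (by positivity)]; linarith
  have h1 : 1 / (S * (T + 1)) * ((θ / (16 * L))⁻¹
      * (gap + S * (θ / (16 * L) * (8 * Q * (1 / b + T * γ ^ 2)))))
      = (16 * P * gap / (b * γ * S)) * (1 / (T + 1))
        + 8 * Q * (1 / b + T * γ ^ 2) * (1 / (T + 1)) := by
    have h2 : ∀ A X : ℝ, A ≠ 0 → A⁻¹ * (gap + S * (A * X)) = A⁻¹ * gap + S * X := by
      intro A X hA
      field_simp
    rw [h2 _ _ (by positivity), hA]
    field_simp
  have hR0 : 0 ≤ R₀ := by rw [hR₀]; positivity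
  have hQ0 : 0 < Q := by linarith
  have h2 : (16 * P * gap / (b * γ * S)) * (1 / (T + 1)) ≤ ε ^ 2 / 2 := by
    have h3 : √2 * √2 = 2 := Real.mul_self_sqrt (by norm_num)
    have h4 : R₀ / (b * S) ≤ ε * √Rhat / √2 := by
      rw [div_le_iff₀ (by positivity)] at hS
      rw [div_le_div_iff₀ (by positivity) (by positivity)]
      linarith
    calc _ ≤ (R₀ / (b * γ * S)) * γ ^ 2 := by
          rw [hR₀]; gcongr
      _ = γ * (R₀ / (b * S)) := by field_simp
      _ ≤ γ * (ε * √Rhat / √2) := by gcongr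
      _ = ε ^ 2 / 2 := by
          rw [hγ, Real.sqrt_mul (by norm_num)]
          have : √Rhat ≠ 0 := (Real.sqrt_pos.2 hRhat).ne'
          field_simp
          nlinarith [h3]
  have h5 : 8 * Q * (1 / b + T * γ ^ 2) * (1 / (T + 1)) ≤ ε ^ 2 / 3 := by
    have h6 : 1 / b ≤ 1 := by rw [div_le_one hb0]; exact hb
    calc _ ≤ 8 * Q * (1 + 1) * γ ^ 2 := by gcongr
      _ = ε ^ 2 / 3 := by rw [hγ2, hQ]; field_simp; norm_num
  rw [h1]
  nlinarith [sq_nonneg ε]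

/-- The constants `a` and `c` measure how much rounding enlarges the number of stages and the batch
sizes; `T` is rounded down and costs nothing. -/
theorem evalsF_bound {ε Rhat R₀ S S' B₀ B₁ TF a c : ℝ} (hε : 0 < ε) (hRhat : 0 < Rhat)
    (hb : 0 < b) (hc₀ : 0 < c₀) (hS' : S' = √2 * R₀ / (b * ε * √Rhat)) (hS : S ≤ a * S')
    (hS0 : 0 ≤ S) (hB₁ : B₁ ≤ c * (2 * c₀ * b * Rhat / ε ^ 2)) (hB₁0 : 0 ≤ B₁)
    (hB₀ : B₀ ≤ c * (4 * c₀ * Rhat ^ 2 / ε ^ 4)) (hB₀0 : 0 ≤ B₀)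
    (hT0 : 0 ≤ T) (hT : T ≤ 2 * Rhat / ε ^ 2)
    (hTF : TF = 4 * √2 * c₀ * R₀ * Rhat ^ (3 / 2 : ℝ) * (3 + b⁻¹) / ε ^ 5) :
    S * (B₀ + T * (2 * B₁ + B₁)) ≤ a * c * TF := by
  set r := √Rhat with hr
  have hr0 : 0 < r := Real.sqrt_pos.2 hRhat
  have hr2 : Rhat = r ^ 2 := (Real.sq_sqrt hRhat.le).symm
  have hpow : Rhat ^ (3 / 2 : ℝ) = r ^ 3 := by
    rw [hr, Real.sqrt_eq_rpow, ← Real.rpow_natCast, ← Real.rpow_mul hRhat.le]; norm_num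
  have h1 : B₀ + T * (2 * B₁ + B₁)
      ≤ c * (4 * c₀ * Rhat ^ 2 / ε ^ 4)
        + 2 * Rhat / ε ^ 2 * (3 * (c * (2 * c₀ * b * Rhat / ε ^ 2))) := by
    have : 2 * B₁ + B₁ ≤ 3 * (c * (2 * c₀ * b * Rhat / ε ^ 2)) := by linarith
    gcongr
  refine (mul_le_mul hS h1 (by positivity) (hS0.trans hS)).trans_eq ?_
  rw [hTF, hpow, hS', hr2]
  field_simp
  ring

theorem evalsJ_bound {ε Rhat R₀ S S' B₀ TJ a c : ℝ} (hε : 0 < ε) (hRhat : 0 < Rhat)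
    (hb : 0 < b) (hS' : S' = √2 * R₀ / (b * ε * √Rhat)) (hS : S ≤ a * S')
    (hS0 : 0 ≤ S) (hc : 1 ≤ c) (hB₀ : B₀ ≤ c * (2 * Rhat / ε ^ 2)) (hB₀0 : 0 ≤ B₀)
    (hT0 : 0 ≤ T) (hT : T ≤ 2 * Rhat / ε ^ 2)
    (hTJ : TJ = 2 * √2 * R₀ * Rhat ^ (1 / 2 : ℝ) * (3 + b⁻¹) / ε ^ 3) :
    S * (B₀ + T * (2 * b + b)) ≤ a * c * TJ := by
  set r := √Rhat with hr
  have hr0 : 0 < r := Real.sqrt_pos.2 hRhat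
  have hr2 : Rhat = r ^ 2 := (Real.sq_sqrt hRhat.le).symm
  have hpow : Rhat ^ (1 / 2 : ℝ) = r := by rw [hr, Real.sqrt_eq_rpow]
  have h1 : B₀ + T * (2 * b + b)
      ≤ c * (2 * Rhat / ε ^ 2) + c * (2 * Rhat / ε ^ 2 * (2 * b + b)) := by
    refine add_le_add hB₀ ?_
    calc T * (2 * b + b) ≤ 1 * (2 * Rhat / ε ^ 2 * (2 * b + b)) := by rw [one_mul]; gcongr
      _ ≤ _ := by gcongr
  refine (mul_le_mul hS h1 (by positivity) (hS0.trans hS)).trans_eq ?_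
  rw [hTJ, hpow, hS', hr2]
  field_simp
  ring

end Arithmetic

theorem ceil_le_two_mul {x : ℝ} (hx : 1 ≤ x) : (⌈x⌉₊ : ℝ) ≤ 2 * x := by
  have := Nat.ceil_lt_add_one (zero_le_one.trans hx)
  linarith

/-! ### The constants `P` and `Q`. -/

namespace MinimaxData

variable {p n q : ℕ} {Ξ : Type*} [MeasurableSpace Ξ] {D : MinimaxData p n q Ξ}
  {LF σF σJ MF Mψ c₀ κ κJ : ℝ}

theorem constP_sq (hc₀ : 0 < c₀) (hκ : 0 ≤ κ) (hκJ : 0 ≤ κJ) :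
    D.constP c₀ κ κJ MF LF Mψ ^ 2
      = 26 * ‖D.K‖ ^ 2 / (9 * c₀)
        * (κ * MF ^ 4 * ‖D.K‖ ^ 2 + c₀ * κJ * LF ^ 2 * Mψ ^ 2) := by
  have h4 : 0 ≤ MF ^ 4 := by positivity
  unfold constP
  rw [mul_pow, div_pow, mul_pow, mul_pow, Real.sq_sqrt (by norm_num), Real.sq_sqrt hc₀.le,
    Real.sq_sqrt (by positivity)]
  norm_num

theorem constP_pos (hK : D.K ≠ 0) (hc₀ : 0 < c₀) (hκ : 0 < κ) (hκJ : 0 < κJ) (hMF : 0 < MF) :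
    0 < D.constP c₀ κ κJ MF LF Mψ := by
  have hK' : 0 < ‖D.K‖ := norm_pos_iff.2 hK
  have : 0 < κ * MF ^ 4 * ‖D.K‖ ^ 2 + c₀ * κJ * LF ^ 2 * Mψ ^ 2 :=
    add_pos_of_pos_of_nonneg (by positivity) (by positivity)
  unfold constP
  positivity

theorem constQ_pos (hK : D.K ≠ 0) (hc₀ : 0 < c₀) (hκ : 0 < κ) (hκJ : 0 < κJ) (hMF : 0 < MF)
    (hσF : 0 < σF) : 0 < D.constQ c₀ κ κJ MF Mψ σF σJ := by
  have hK' : 0 < ‖D.K‖ := norm_pos_iff.2 hK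
  have : 0 < κ * MF ^ 2 * ‖D.K‖ ^ 2 * σF ^ 2 + c₀ * κJ * Mψ ^ 2 * σJ ^ 2 :=
    add_pos_of_pos_of_nonneg (by positivity) (by positivity)
  unfold constQ
  positivity

end MinimaxData

/-! ### From nonnegative integrals to the expectation at the output. -/

namespace RunAssumptions

open MinimaxData Batches

variable {p n q : ℕ} {Ξ Ω : Type*} [MeasurableSpace Ξ] [mΩ : MeasurableSpace Ω]
  {μ : Measure Ω} [IsProbabilityMeasure μ] {D : MinimaxData p n q Ξ} {LF σF σJ MF Mψ : ℝ}
  {par : StepParams} {b₀ bJ₀ b₁ bJ₁ b₂ bJ₂ : ℕ} {B : Ω → Batches Ξ b₀ bJ₀ b₁ bJ₁ b₂ bJ₂}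
  {S T : ℕ} {x₀ : Euc p} {κ κJ : ℝ}

theorem integral_output_le (h : RunAssumptions μ D LF σF σJ MF Mψ par B S T x₀ κ κJ)
    {τ : Ω → Fin S × Fin (T + 1)} (hτ : UniformOutput B μ S T τ) {A gap K₀ δ : ℝ} (hA : 0 < A)
    (hgap : 0 ≤ gap) (hK₀ : 0 ≤ K₀)
    (hsum : ENNReal.ofReal A
        * ∑ s ∈ Finset.range S, ∑ t ∈ Finset.range (T + 1), D.gradSq par μ B T x₀ s t
      ≤ ENNReal.ofReal gap + S * ENNReal.ofReal K₀)
    (hδ : 1 / ((S : ℝ) * (T + 1)) * (A⁻¹ * (gap + S * K₀)) ≤ δ) :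
    Integrable (fun ω => ‖D.gradMap par.γ par.η
        (D.iterate par (B ω) T x₀ (τ ω).1 (τ ω).2)‖ ^ 2) μ ∧
      ∫ ω, ‖D.gradMap par.γ par.η (D.iterate par (B ω) T x₀ (τ ω).1 (τ ω).2)‖ ^ 2 ∂μ ≤ δ := by
  obtain ⟨G, hGm, hG⟩ := exists_measurable_gradMap h.standing h.asmF h.asmPsi h.γ_pos h.η_pos
  have hm : Measurable fun ω => ‖D.gradMap par.γ par.η
      (D.iterate par (B ω) T x₀ (τ ω).1 (τ ω).2)‖ ^ 2 := by
    have e : (fun ω => D.gradMap par.γ par.η (D.iterate par (B ω) T x₀ (τ ω).1 (τ ω).2))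
        = G ∘ fun ω => D.iterate par (B ω) T x₀ (τ ω).1 (τ ω).2 := by
      funext ω
      exact hG _ (h.x_mem _ _ ω)
    have e' : Measurable
        fun ω => D.gradMap par.γ par.η (D.iterate par (B ω) T x₀ (τ ω).1 (τ ω).2) := by
      rw [e]; exact hGm.comp (h.measurable_output hτ.meas)
    exact e'.norm.pow_const 2
  have hS : ∑ s ∈ Finset.range S, ∑ t ∈ Finset.range (T + 1), D.gradSq par μ B T x₀ s t
      ≤ ENNReal.ofReal (A⁻¹ * (gap + S * K₀)) := by
    rw [inv_mul_eq_div, ENNReal.ofReal_div_of_pos hA,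
      ENNReal.le_div_iff_mul_le (Or.inl (ENNReal.ofReal_pos.2 hA).ne')
        (Or.inl ENNReal.ofReal_ne_top), mul_comm, ENNReal.ofReal_add hgap (by positivity),
      ENNReal.ofReal_mul (by positivity), ENNReal.ofReal_natCast]
    exact hsum
  have hle : ∫⁻ ω, ENNReal.ofReal (‖D.gradMap par.γ par.η
      (D.iterate par (B ω) T x₀ (τ ω).1 (τ ω).2)‖ ^ 2) ∂μ ≤ ENNReal.ofReal δ := by
    rw [h.lintegral_output hτ]
    calc _ ≤ ENNReal.ofReal (1 / ((S : ℝ) * ((T : ℝ) + 1)))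
          * ENNReal.ofReal (A⁻¹ * (gap + S * K₀)) := by gcongr
      _ = ENNReal.ofReal (1 / ((S : ℝ) * (T + 1)) * (A⁻¹ * (gap + S * K₀))) :=
          (ENNReal.ofReal_mul (by positivity)).symm
      _ ≤ _ := ENNReal.ofReal_le_ofReal hδ
  have hδ0 : 0 ≤ δ := le_trans (by positivity) hδ
  refine ⟨⟨hm.aestronglyMeasurable, ?_⟩, ?_⟩
  · rw [hasFiniteIntegral_iff_ofReal (ae_of_all _ fun ω => by positivity)]
    exact hle.trans_lt ENNReal.ofReal_lt_top
  · rw [integral_eq_lintegral_of_nonneg_ae (ae_of_all _ fun ω => by positivity)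
      hm.aestronglyMeasurable]
    exact ENNReal.toReal_le_of_le_ofReal hδ0 hle

end RunAssumptions

end

/-! ### The complexity theorem. -/

theorem mainTheorem8 {p n q : ℕ} {Ξ Ω : Type*} [MeasurableSpace Ξ] [MeasurableSpace Ω]
    (μ : Measure Ω) [IsProbabilityMeasure μ]
    (D : MinimaxData p n q Ξ) (hD : D.Standing) (hK : D.K ≠ 0)
    (LF σF σJ MF Mψ : ℝ) (hF : D.AssumptionF LF σF σJ MF) (hψ : D.AssumptionPsi Mψ)
    (x₀ : Euc p) (hx₀ : x₀ ∈ effDom D.R)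
    (c₀ κ κJ ε : ℝ) (hc₀ : 0 < c₀) (hε : 0 < ε)
    (P Q R₀ Rhat : ℝ)
    (hP : P = D.constP c₀ κ κJ MF LF Mψ) (hQ : Q = D.constQ c₀ κ κJ MF Mψ σF σJ)
    (hR₀ : R₀ = 16 * P * ((D.Psi0 x₀).toReal - D.Psi0Star.toReal + D.Bpsi)) (hR₀_pos : 0 < R₀)
    (hRhat : Rhat = 24 * Q)
    -- batch sizes and iteration numbers
    (b b₀ b₁ bJ₀ S T : ℕ) (hb : 0 < b)
    (hb₁ : b₁ = ⌈2 * c₀ * b * Rhat / ε ^ 2⌉₊)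
    (hb₀ : b₀ = ⌈4 * c₀ * Rhat ^ 2 / ε ^ 4⌉₊)
    (hbJ₀ : bJ₀ = ⌈2 * Rhat / ε ^ 2⌉₊)
    (hT : T = ⌊2 * Rhat / ε ^ 2⌋₊)
    (hS : S = ⌈√2 * R₀ / (b * ε * √Rhat)⌉₊)
    -- parameters, with the requirements `β ∈ (0, 1)` and `θ ∈ (0, 1]` of the algorithm
    (par : StepParams)
    (hγ : par.γ = ε / √(2 * Rhat))
    (hβ : par.β = 1 - b * ε ^ 2 / (2 * Rhat)) (hβ_pos : 0 < par.β)
    (hθ : par.θ = D.constL par.γ MF LF Mψ * √(b * (1 - par.β)) / P) (hθ_le : par.θ ≤ 1)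
    (hη : par.η = 2 / (D.constL par.γ MF LF Mψ * (3 + par.θ)))
    -- random samples and random choice of the output
    (B : Ω → Batches Ξ b₀ bJ₀ b₁ b b₁ b) (hB : Batches.Admissible B D.law μ S T)
    (hκ : κ = 2 ∨ κ = 1 ∧ Batches.IndepF B μ S T)
    (hκJ : κJ = 2 ∨ κJ = 1 ∧ Batches.IndepJ B μ S T)
    (τ : Ω → Fin S × Fin (T + 1)) (hτ : UniformOutput B μ S T τ)
    (xbar : Ω → Euc p)
    (hxbar : ∀ ω, xbar ω = D.iterate par (B ω) T x₀ (τ ω).1 (τ ω).2)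
    -- the bounds on the numbers of evaluations
    (TF TJ : ℝ)
    (hTF : TF = 4 * √2 * c₀ * R₀ * Rhat ^ (3 / 2 : ℝ) * (3 + (b : ℝ)⁻¹) / ε ^ 5)
    (hTJ : TJ = 2 * √2 * R₀ * Rhat ^ (1 / 2 : ℝ) * (3 + (b : ℝ)⁻¹) / ε ^ 3) :
    -- quality of the output
    (Integrable (fun ω => ‖D.gradMap par.γ par.η (xbar ω)‖ ^ 2) μ ∧
      ∫ ω, ‖D.gradMap par.γ par.η (xbar ω)‖ ^ 2 ∂μ ≤ ε ^ 2) ∧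
    -- numbers of oracle calls
    (∀ ω, D.evalsF par (B ω) T x₀ S = S * (b₀ + T * (2 * b₁ + b₁)) ∧
      D.evalsJ par (B ω) T x₀ S = S * (bJ₀ + T * (2 * b + b))) ∧
    -- the bounds if no batch size and no number of stages has to be rounded
    ((S : ℝ) = √2 * R₀ / (b * ε * √Rhat) →
      ((b₁ : ℝ) = 2 * c₀ * b * Rhat / ε ^ 2 → (b₀ : ℝ) = 4 * c₀ * Rhat ^ 2 / ε ^ 4 →
        ∀ ω, (D.evalsF par (B ω) T x₀ S : ℝ) ≤ TF) ∧
      ((bJ₀ : ℝ) = 2 * Rhat / ε ^ 2 → ∀ ω, (D.evalsJ par (B ω) T x₀ S : ℝ) ≤ TJ)) ∧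
    -- the bounds with rounding, if the rounded quantities are at least one before rounding
    (1 ≤ √2 * R₀ / (b * ε * √Rhat) →
      (1 ≤ 2 * c₀ * b * Rhat / ε ^ 2 → 1 ≤ 4 * c₀ * Rhat ^ 2 / ε ^ 4 →
        ∀ ω, (D.evalsF par (B ω) T x₀ S : ℝ) ≤ 4 * TF) ∧
      (∀ ω, (D.evalsJ par (B ω) T x₀ S : ℝ) ≤ 4 * TJ)) := by
  have hF' := hF
  obtain ⟨hLF0, hσF0, hσJ0, hMF0, -, -, -, -⟩ := hF'
  have hκ1 : 1 ≤ κ := by rcases hκ with rfl | ⟨rfl, -⟩ <;> norm_num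
  have hκJ1 : 1 ≤ κJ := by rcases hκJ with rfl | ⟨rfl, -⟩ <;> norm_num
  have hκ0 : 0 < κ := by linarith
  have hκJ0 : 0 < κJ := by linarith
  have hP0 : 0 < P := hP ▸ MinimaxData.constP_pos hK hc₀ hκ0 hκJ0 hMF0
  have hQ0 : 0 < Q := hQ ▸ MinimaxData.constQ_pos hK hc₀ hκ0 hκJ0 hMF0 hσF0
  have hRhat0 : 0 < Rhat := by rw [hRhat]; positivity
  have hb' : (0 : ℝ) < b := Nat.cast_pos.2 hb
  have hb1 : (1 : ℝ) ≤ b := by exact_mod_cast hb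
  have hγ0 : 0 < par.γ := by rw [hγ]; positivity
  have hγ2 : par.γ ^ 2 = ε ^ 2 / (2 * Rhat) := by
    rw [hγ, div_pow, Real.sq_sqrt (by positivity)]
  have hγinv : 2 * Rhat / ε ^ 2 * par.γ ^ 2 = 1 := by rw [hγ2]; field_simp
  have hβγ : 1 - par.β = b * par.γ ^ 2 := by rw [hβ, hγ2]; ring
  have hβ1 : par.β < 1 := by
    have : 0 < b * par.γ ^ 2 := by positivity
    linarith
  -- Positivity of `β` together with `b ≥ 1` already forces `γ < 1`.
  have hγlt : par.γ ^ 2 < 1 := by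
    have := le_mul_of_one_le_left (sq_nonneg par.γ) hb1
    linarith
  have hγ1 : par.γ ≤ 1 := ((sq_lt_one_iff₀ hγ0.le).1 hγlt).le
  -- The unrounded size of the initial Jacobian batch is `1 / γ²`. It therefore always exceeds one,
  -- and the rounded bound for Jacobians needs a condition on `S` only.
  have hinv1 : 1 ≤ 2 * Rhat / ε ^ 2 := by
    have h0 : 0 < 2 * Rhat / ε ^ 2 := by positivity
    have := mul_le_mul_of_nonneg_left hγlt.le h0.le
    linarith
  have hL0 : 0 < D.constL par.γ MF LF Mψ := MinimaxData.constL_pos hK hF hψ hγ0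
  set L := D.constL par.γ MF LF Mψ with hLdef
  have hsqrt : √((b : ℝ) * (1 - par.β)) = b * par.γ := by
    rw [hβγ, show (b : ℝ) * (b * par.γ ^ 2) = (b * par.γ) ^ 2 by ring,
      Real.sqrt_sq (by positivity)]
  have hθP : par.θ * P = L * (b * par.γ) := by
    rw [hθ, hsqrt]; field_simp
  have hθ0 : 0 < par.θ := by rw [hθ, hsqrt]; positivity
  have hS0 : 0 < √2 * R₀ / (b * ε * √Rhat) := by positivity
  have hSle : √2 * R₀ / (b * ε * √Rhat) ≤ S := hS ▸ Nat.le_ceil _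
  have hSpos : (0 : ℝ) < S := hS0.trans_le hSle
  have hb₁le : 2 * c₀ * b * Rhat / ε ^ 2 ≤ b₁ := hb₁ ▸ Nat.le_ceil _
  have hb₀le : 4 * c₀ * Rhat ^ 2 / ε ^ 4 ≤ b₀ := hb₀ ▸ Nat.le_ceil _
  have hbJ₀le : 2 * Rhat / ε ^ 2 ≤ bJ₀ := hbJ₀ ▸ Nat.le_ceil _
  have hb₁pos : (0 : ℝ) < b₁ := lt_of_lt_of_le (by positivity) hb₁le
  have hb₀pos : (0 : ℝ) < b₀ := lt_of_lt_of_le (by positivity) hb₀le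
  have hbJ₀pos : (0 : ℝ) < bJ₀ := lt_of_lt_of_le (by positivity) hbJ₀le
  have hb₁γ : c₀ * b ≤ b₁ * par.γ ^ 2 := by
    refine le_trans (le_of_eq ?_) (mul_le_mul_of_nonneg_right hb₁le (sq_nonneg _))
    rw [hγ2]; field_simp
  have hb₀γ : c₀ ≤ b₀ * par.γ ^ 4 := by
    refine le_trans (le_of_eq ?_) (mul_le_mul_of_nonneg_right hb₀le (by positivity))
    rw [show par.γ ^ 4 = (par.γ ^ 2) ^ 2 by ring, hγ2]; field_simp; norm_num
  have hbJ₀γ : 1 ≤ bJ₀ * par.γ ^ 2 :=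
    hγinv.symm.le.trans (mul_le_mul_of_nonneg_right hbJ₀le (sq_nonneg _))
  have hTle : (T : ℝ) ≤ 2 * Rhat / ε ^ 2 := hT ▸ Nat.floor_le (by positivity)
  have hTγ : T * par.γ ^ 2 ≤ 1 :=
    (mul_le_mul_of_nonneg_right hTle (sq_nonneg _)).trans hγinv.le
  have hTγ' : 1 ≤ ((T : ℝ) + 1) * par.γ ^ 2 := by
    refine hγinv.symm.le.trans (mul_le_mul_of_nonneg_right ?_ (sq_nonneg _))
    rw [hT]; exact (Nat.lt_floor_add_one _).le
  have hrun : RunAssumptions μ D LF σF σJ MF Mψ par B S T x₀ κ κJ :=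
    { standing := hD, K_ne := hK, asmF := hF, asmPsi := hψ, γ_pos := hγ0, θ_pos := hθ0,
      θ_le := hθ_le, η_eq := hη, adm := hB, b₀_pos := Nat.cast_pos.1 hb₀pos,
      bJ₀_pos := Nat.cast_pos.1 hbJ₀pos, b₁_pos := Nat.cast_pos.1 hb₁pos, bJ₁_pos := hb,
      b₂_pos := Nat.cast_pos.1 hb₁pos, bJ₂_pos := hb, kappa := hκ, kappaJ := hκJ,
      start_mem := hx₀ }
  have hC := coupling_le (K := ‖D.K‖) (MF := MF) (LF := LF) (Mψ := Mψ) (κJ := κJ) hc₀ hγ0 hb'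
    hβ_pos hβγ hθ0 hL0 hθP (hP ▸ MinimaxData.constP_sq hc₀ hκ0.le hκJ0.le) hκ0.le hb₁pos hb₁γ
  have hN := noise_le (K := ‖D.K‖) (T := T) hc₀ hγ0 hb' hβ_pos hβγ hθ0 hL0 hQ hκ1 hκJ1 hb₁pos
    hb₁γ hb₀pos hb₀γ hbJ₀pos hbJ₀γ (Nat.cast_nonneg T)
  have hsum := hrun.sum_gradSq_le hLdef rfl rfl hβ_pos.le hβ1 hC hN
  have hlow := MinimaxData.PsiS_lower hD hψ hγ0.le hx₀
  have hup := MinimaxData.PsiS_upper hD hψ hγ0.le hx₀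
  have hBpsi := MinimaxData.Standing.Bpsi_nonneg hD
  -- By `γ ≤ 1` the smoothing bias `γ B_ψ` is at most `B_ψ`, the term that appears in `R₀`.
  have hgap : D.PsiS par.γ x₀ - (D.Psi0Star.toReal - par.γ * D.Bpsi)
      ≤ (D.Psi0 x₀).toReal - D.Psi0Star.toReal + D.Bpsi := by
    have := mul_le_of_le_one_left hBpsi hγ1
    linarith
  have hgap0 := sub_nonneg.2 hlow
  have hacc := accuracy_le hε hRhat0 hγ hb1 hθ0 hL0 hP0 hθP hRhat hR₀ hgap (hgap0.trans hgap)
    (Nat.cast_nonneg T) hTγ' hTγ hSpos hSle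
  have hout := hrun.integral_output_le hτ (A := par.θ / (16 * L)) (by positivity) hgap0
    (by positivity) hsum hacc
  have hcF : ∀ ω, D.evalsF par (B ω) T x₀ S = S * (b₀ + T * (2 * b₁ + b₁)) := fun ω =>
    MinimaxData.evalsF_eq D par (B ω) T x₀ S
  have hcJ : ∀ ω, D.evalsJ par (B ω) T x₀ S = S * (bJ₀ + T * (2 * b + b)) := fun ω =>
    MinimaxData.evalsJ_eq D par (B ω) T x₀ S
  refine ⟨by simpa only [hxbar] using hout, fun ω => ⟨hcF ω, hcJ ω⟩, fun hSeq => ⟨?_, ?_⟩,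
    fun hS1 => ⟨?_, ?_⟩⟩
  · intro h1 h0 ω
    rw [hcF]; push_cast
    refine (evalsF_bound (a := 1) (c := 1) hε hRhat0 hb' hc₀ rfl (by rw [one_mul, ← hSeq])
      hSpos.le (by rw [one_mul, ← h1]) hb₁pos.le (by rw [one_mul, ← h0]) hb₀pos.le
      (Nat.cast_nonneg T) hTle hTF).trans_eq (by ring)
  · intro h0 ω
    rw [hcJ]; push_cast
    refine (evalsJ_bound (a := 1) (c := 1) hε hRhat0 hb' rfl (by rw [one_mul, ← hSeq])
      hSpos.le le_rfl (by rw [one_mul, ← h0]) hbJ₀pos.le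
      (Nat.cast_nonneg T) hTle hTJ).trans_eq (by ring)
  · intro h1 h0 ω
    rw [hcF]; push_cast
    refine (evalsF_bound (a := 2) (c := 2) hε hRhat0 hb' hc₀ rfl (hS ▸ ceil_le_two_mul hS1)
      hSpos.le (hb₁ ▸ ceil_le_two_mul h1) hb₁pos.le (hb₀ ▸ ceil_le_two_mul h0) hb₀pos.le
      (Nat.cast_nonneg T) hTle hTF).trans_eq (by ring)
  · intro ω
    rw [hcJ]; push_cast
    refine (evalsJ_bound (a := 2) (c := 2) hε hRhat0 hb' rfl (hS ▸ ceil_le_two_mul hS1)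
      hSpos.le one_le_two (hbJ₀ ▸ ceil_le_two_mul hinv1) hbJ₀pos.le
      (Nat.cast_nonneg T) hTle hTJ).trans_eq (by ring)
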